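/- Let $d\ge 1$ and let $H<\mathrm{GL}(d,\mathbb R)$ be an admissible dilation group, i.e. a closed subgroup such that the quasi-regular representation $[\pi(x,h)f](y)=|\det h|^{-1/2}f(h^{-1}(y-x))$ of $G=\mathbb R^d\rtimes H$ (product $(x,h)(y,g)=(x+hy,hg)$, left Haar measure $|\det h|^{-1}dx\,dh$ with $dh$ a left Haar measure of $H$) on $L^2(\mathbb R^d)$ is irreducible and square-integrable (there is $\psi\neq0$ in $L^2(\mathbb R^d)$ with $\mathcal W_\psi\psi\in L^2(G)$, where $\mathcal W_\psi f(x,h)=\langle f,\pi(x,h)\psi\rangle$). Let $\mathcal O=\{h^T\xi:h\in H\}$ be the open orbit of the dual action, with complement $\mathcal O^c$, and put $$A(\xi)=\min\left(\frac{\mathrm{dist}(\xi,\mathcal O^c)}{1+\sqrt{|\xi|^2-\mathrm{dist}(\xi,\mathcal O^c)^2}},\ \frac1{1+|\xi|}\right).$$ A weight on a group is a continuous, positive, submultiplicative function. Let $s\ge0$, let $w$ be a weight on $H$ and $v$ a weight on $G$ with $v(x,h)\le(1+|x|)^s w(h)$. Let $\|\cdot\|$ be any norm on $\mathbb R^{d\times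 d}$. Suppose that $\mathcal O$ is $(s,1,w)$-temperately embedded with index $\ell\in\mathbb N_0$, i.e. for some $\xi_0\in\mathcal O$ the functions $$h\mapsto|\det h|^{-1/2}(1+\|h\|)^{s+d+1}w(h)A(h^T\xi_0)^\ell,\qquad h\mapsto|\det h|^{-3/2}(1+\|h\|)^{s+d+1}w(h)A(h^{-T}\xi_0)^\ell$$ are in $L^1(H)$. Let $t$ be an integer with $t>\ell+s+d+1$. Say that $\psi\in L^1(\mathbb R^d)$ has vanishing moments in $\mathcal O^c$ of order $t$ if all distributional derivatives $\partial^\alpha\widehat\psi$ with $|\alpha|\le t$ are continuous functions and those with $|\alpha|<t$ vanish identically on $\mathcal O^c$, where $\widehat\psi(\xi)=\int\psi(x)e^{-2\pi i\langle x,\xi\rangle}dx$; and let $|f|_{t,t}=\sup_{x\in\mathbb R^d,\,|\alpha|\le t}(1+|x|)^t|\partial^\alpha f(x)|$. Then every $\psi\in L^1(\mathbb R^d)$ with vanishing moments in $\mathcal O^c$ of order $t$ and $|\widehat\psi|_{t,t}<\infty$ lies in $$\mathcal H_{1,v}=\left\{f\in L^2(\mathbb R^d):\ \int_G|\mathcal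 W_ff(x,h)|\,v(x,h)\,|\det h|^{-1}\,dx\,dh<\infty\right\}.$$ Moreover, there exists a nonzero $\psi\in C_c^\infty(\mathbb R^d)$ with these properties (vanishing moments in $\mathcal O^c$ of order $t$ and $|\widehat\psi|_{t,t}<\infty$), and in particular a nonzero $\psi\in C_c^\infty(\mathbb R^d)\cap\mathcal H_{1,v}$. -/

import Mathlib

open MeasureTheory
open scoped FourierTransform ContDiff ENNReal Matrix MatrixGroups

namespace DualOrbit

/-- `ℝ^d` with the Euclidean norm and inner product. -/
abbrev E (d : ℕ) : Type := EuclideanSpace ℝ (Fin d)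

/-- The linear action `A ξ` of a real matrix on `ℝ^d`. -/
noncomputable def act {d : ℕ} (A : Matrix (Fin d) (Fin d) ℝ) (ξ : E d) : E d :=
  Matrix.toEuclideanLin A ξ

/-- The absolute value of the determinant of `h`. -/
noncomputable def absDet {d : ℕ} (h : GL (Fin d) ℝ) : ℝ :=
  |(h : Matrix (Fin d) (Fin d) ℝ).det|

/-! ### The affine group `G = ℝ^d ⋊ H` and weights -/

/-- The product `(x,h)(y,g) = (x + h y, h g)` of `G = ℝ^d ⋊ H`, whose elements are the pairs
`(x,h) ∈ ℝ^d × H`. -/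
noncomputable def affMul {d : ℕ} (H : Subgroup (GL (Fin d) ℝ)) (p q : E d × H) : E d × H :=
  (p.1 + act (p.2 : GL (Fin d) ℝ) q.1, p.2 * q.2)

/-- A weight on a group `X` with product `mul`: a continuous, positive, submultiplicative
function. -/
structure IsWeight {X : Type*} [TopologicalSpace X] (mul : X → X → X) (v : X → ℝ) : Prop where
  continuous : Continuous v
  pos : ∀ a, 0 < v a
  submul : ∀ a b, v (mul a b) ≤ v a * v b

/-- The left Haar measure `d(x,h) = |det h|⁻¹ dx dh` of `G`, where `dh` is the left Haar measure
`μ` of `H`. -/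
noncomputable def affHaar {d : ℕ} (H : Subgroup (GL (Fin d) ℝ)) [MeasurableSpace H]
    (μ : Measure H) : Measure (E d × H) :=
  ((volume : Measure (E d)).prod μ).withDensity
    (fun p => ENNReal.ofReal (absDet (p.2 : GL (Fin d) ℝ))⁻¹)

/-! ### The quasi-regular representation -/

/-- The function `y ↦ |det h|^{-1/2} f (h⁻¹ (y - x))`. -/
noncomputable def quasiRegFun {d : ℕ} (x : E d) (h : GL (Fin d) ℝ) (f : E d → ℂ) (y : E d) : ℂ :=
  (absDet h ^ (-(1 / 2) : ℝ)) •
    f (act ((h⁻¹ : GL (Fin d) ℝ) : Matrix (Fin d) (Fin d) ℝ) (y - x))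

theorem memLp_quasiRegFun {d : ℕ} (x : E d) (h : GL (Fin d) ℝ) {f : E d → ℂ}
    (hf : MemLp f 2 volume) : MemLp (quasiRegFun x h f) 2 volume := by
  set L : E d →ₗ[ℝ] E d :=
    Matrix.toEuclideanLin ((h⁻¹ : GL (Fin d) ℝ) : Matrix (Fin d) (Fin d) ℝ) with hL
  have hdet : LinearMap.det L ≠ 0 := by
    have : LinearMap.det L = ((h⁻¹ : GL (Fin d) ℝ) : Matrix (Fin d) (Fin d) ℝ).det := by
      rw [hL, Matrix.toEuclideanLin_eq_toLin_orthonormal, LinearMap.det_toLin]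
    rw [this]
    exact (Matrix.isUnits_det_units (h⁻¹)).ne_zero
  have hLc : Continuous L := L.continuous_of_finiteDimensional
  have hfL : MemLp (f ∘ L) 2 volume := by
    refine MemLp.comp_of_map ?_ hLc.measurable.aemeasurable
    rw [Measure.map_linearMap_addHaar_eq_smul_addHaar volume hdet]
    exact hf.smul_measure ENNReal.ofReal_ne_top
  have hsub := hfL.comp_measurePreserving
    (measurePreserving_sub_right (volume : Measure (E d)) x)
  exact hsub.const_smul (absDet h ^ (-(1 / 2) : ℝ))

/-- The quasi-regular representation `π(x,h)` on `L²(ℝ^d)`. -/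
noncomputable def quasiReg {d : ℕ} (x : E d) (h : GL (Fin d) ℝ)
    (f : Lp ℂ 2 (volume : Measure (E d))) : Lp ℂ 2 (volume : Measure (E d)) :=
  (memLp_quasiRegFun x h (Lp.memLp f)).toLp (quasiRegFun x h f)

/-- The wavelet transform `W_ψ f (x,h) = ⟨f, π(x,h) ψ⟩`, with `⟨f, g⟩ = ∫ f \bar g`
(the Mathlib inner product is conjugate-linear in its first argument). -/
noncomputable def wavelet {d : ℕ} (H : Subgroup (GL (Fin d) ℝ))
    (ψ f : Lp ℂ 2 (volume : Measure (E d))) (p : E d × H) : ℂ :=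
  inner ℂ (quasiReg p.1 (p.2 : GL (Fin d) ℝ) ψ) f

/-- `H` is an admissible dilation group: a closed subgroup of `GL(d,ℝ)` for which the
quasi-regular representation of `ℝ^d ⋊ H` is irreducible and square-integrable. -/
structure IsAdmissible {d : ℕ} (H : Subgroup (GL (Fin d) ℝ)) [MeasurableSpace H]
    (μ : Measure H) : Prop where
  isClosed : IsClosed (H : Set (GL (Fin d) ℝ))
  irreducible : ∀ M : Submodule ℂ (Lp ℂ 2 (volume : Measure (E d))),
    IsClosed (M : Set (Lp ℂ 2 (volume : Measure (E d)))) →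
    (∀ (x : E d), ∀ h ∈ H, ∀ f ∈ M, quasiReg x h f ∈ M) → M = ⊥ ∨ M = ⊤
  squareIntegrable : ∃ ψ : Lp ℂ 2 (volume : Measure (E d)), ψ ≠ 0 ∧
    MemLp (wavelet H ψ ψ) 2 (affHaar H μ)

/-- The space `H_{1,v}` of all `f ∈ L²(ℝ^d)` with `W_f f ∈ L¹_v(G)`. -/
def integrableVectors {d : ℕ} (H : Subgroup (GL (Fin d) ℝ)) [MeasurableSpace H]
    (μ : Measure H) (v : E d × H → ℝ) : Set (Lp ℂ 2 (volume : Measure (E d))) :=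
  {f | Integrable (fun p => v p • wavelet H f f p) (affHaar H μ)}

/-- A function `ψ` on `ℝ^d` belongs to `H_{1,v}`: it is in `L²(ℝ^d)` and its class is an element
of `H_{1,v}`. -/
def MemIntegrableVectors {d : ℕ} (H : Subgroup (GL (Fin d) ℝ)) [MeasurableSpace H]
    (μ : Measure H) (v : E d × H → ℝ) (ψ : E d → ℂ) : Prop :=
  ∃ hψ : MemLp ψ 2 (volume : Measure (E d)), hψ.toLp ψ ∈ integrableVectors H μ v

/-! ### The dual orbit -/

/-- The orbit `{h^T ξ : h ∈ H}` of `ξ` under the dual action. -/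
def dualOrbit {d : ℕ} (H : Subgroup (GL (Fin d) ℝ)) (ξ : E d) : Set (E d) :=
  {η | ∃ h ∈ H, η = act (h : Matrix (Fin d) (Fin d) ℝ)ᵀ ξ}

/-- `O` is an open orbit of the dual action. -/
def IsOpenDualOrbit {d : ℕ} (H : Subgroup (GL (Fin d) ℝ)) (O : Set (E d)) : Prop :=
  IsOpen O ∧ ∃ ξ, O = dualOrbit H ξ

/-- The auxiliary function
`A(ξ) = min (dist(ξ,Oᶜ) / (1 + √(|ξ|² - dist(ξ,Oᶜ)²)), 1 / (1 + |ξ|))`. -/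
noncomputable def envelope {d : ℕ} (O : Set (E d)) (ξ : E d) : ℝ :=
  min (Metric.infDist ξ Oᶜ / (1 + √(‖ξ‖ ^ 2 - Metric.infDist ξ Oᶜ ^ 2))) (1 / (1 + ‖ξ‖))

/-- `O` is `(s,q,w)`-temperately embedded with index `ℓ`; `N` is the matrix norm used to measure
the size of `h ∈ H`, and `μ` is the left Haar measure of `H`. -/
def TemperatelyEmbedded {d : ℕ} (H : Subgroup (GL (Fin d) ℝ)) [MeasurableSpace H]
    (μ : Measure H) (N : Matrix (Fin d) (Fin d) ℝ → ℝ) (O : Set (E d))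
    (s q : ℝ) (w : H → ℝ) (ℓ : ℕ) : Prop :=
  ∃ ξ₀ ∈ O,
    MemLp (fun h : H => absDet (h : GL (Fin d) ℝ) ^ (1 / 2 - 1 / q : ℝ) *
        (1 + N (h : GL (Fin d) ℝ)) ^ (s + d + 1 : ℝ) * w h *
        envelope O (act ((h : GL (Fin d) ℝ) : Matrix (Fin d) (Fin d) ℝ)ᵀ ξ₀) ^ ℓ)
      (ENNReal.ofReal q) μ ∧
    MemLp (fun h : H => absDet (h : GL (Fin d) ℝ) ^ (-1 / 2 - 1 / q : ℝ) *
        (1 + N (h : GL (Fin d) ℝ)) ^ (s + d + 1 : ℝ) * w h *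
        envelope O (act (((h : GL (Fin d) ℝ)⁻¹ : GL (Fin d) ℝ) :
          Matrix (Fin d) (Fin d) ℝ)ᵀ ξ₀) ^ ℓ)
      1 μ

/-! ### Derivatives, Schwartz norms, vanishing moments -/

/-- The classical partial derivative `∂_{i 0} ⋯ ∂_{i (k-1)} f (x)` of order `k`. For functions of
class `C^k` these are, as `i` varies, exactly the `∂^α f (x)` with `|α| = k`. -/
noncomputable def partialDeriv {d k : ℕ} (i : Fin k → Fin d) (f : E d → ℂ) (x : E d) : ℂ :=
  iteratedFDeriv ℝ k f x (fun j => EuclideanSpace.single (i j) 1)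

/-- The Schwartz norm `|f|_{r,m} = sup_{x, |α| ≤ r} (1 + |x|)^m |∂^α f (x)|`, with values
in `[0,∞]`. -/
noncomputable def schwartzNorm {d : ℕ} (r m : ℕ) (f : E d → ℂ) : ℝ≥0∞ :=
  ⨆ (x : E d) (k : ℕ) (_ : k ≤ r) (i : Fin k → Fin d),
    ENNReal.ofReal ((1 + ‖x‖) ^ m * ‖partialDeriv i f x‖)

/-- The continuous function `g` is the distributional derivative `∂_{i 0} ⋯ ∂_{i (k-1)} f`. -/
def HasContDistribDeriv {d k : ℕ} (i : Fin k → Fin d) (f g : E d → ℂ) : Prop :=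
  Continuous g ∧ ∀ φ : E d → ℂ, ContDiff ℝ ∞ φ → HasCompactSupport φ →
    ∫ ξ, f ξ * partialDeriv i φ ξ = (-1) ^ k * ∫ ξ, g ξ * φ ξ

/-- `f` has vanishing moments of order `r` in `C`: all distributional derivatives of its Fourier
transform of order at most `r` are continuous functions, and those of order less than `r` vanish
identically on `C`. -/
def HasVanishingMoments {d : ℕ} (C : Set (E d)) (r : ℕ) (f : E d → ℂ) : Prop :=
  ∀ k ≤ r, ∀ i : Fin k → Fin d, ∃ g : E d → ℂ,
    HasContDistribDeriv i (𝓕 f) g ∧ (k < r → ∀ ξ ∈ C, g ξ = 0)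

end DualOrbit

/-! Integrability. Write `F` for the Fourier transform of `ψ`. Irreducibility forces any nonempty
open invariant set to meet every nonempty open set; hence there is only one open orbit, it is
invariant under nonzero scalings, and `Oᶜ` is a closed cone. The nearest point `ζ` of `Oᶜ` to `ξ` is
then an orthogonal projection, so `‖ζ‖² = ‖ξ‖² - dist²`, which explains the square root in `A`.
Since `F` is of class `C^t`, is flat of order `t` on `Oᶜ` and decays, repeated use of the mean value
inequality on the segment from `ζ` to `ξ` bounds derivatives of order `k ≤ t` by a constant times
`A(ξ)^(t-k)` (`norm_iteratedFDeriv_le_envelope`).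

By Parseval, `W_ψ ψ(x,h)` is `|det h|^(1/2)` times the inverse Fourier transform at `x` of `conj
F(h^T ξ) · F(ξ)`. Take the integer `m` with `s + d < m ≤ s + d + 1`. Control of `m` derivatives
bounds this inverse transform by `(1+‖x‖)^(-m) (1+‖h^T‖)^m ∫ A(ξ)^ℓ A(h^T ξ)^ℓ dξ`, up to a constant
and with both points in `O` (`ofReal_fourierInv_correl_le`); here `ℓ ≤ t - m`. The integral in `x`
converges because `m > s + d`.

For the integral in `h`, Lebesgue measure on `O` is dominated by the image of `|det g|⁻¹ dg` under
`g ↦ g^{-T} ξ₀` (`exists_lintegral_orbit_le`). The correlation above becomes a convolution on `H`,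
and integrating a convolution against a submultiplicative function gives at most the product of the
two separate integrals (`lintegral_mul_convolution_le`). Those two integrals are controlled by the
two conditions of temperate embedding.

Existence. The orbit map at a point `ξ₀` of `O` is open by Baire category, and a compactness
argument then realises each basis vector as `X_j ξ₀` with `X_j` generating a one-parameter subgroup
of the dual group (`exists_generator_apply_eq`). The polynomial `P(ξ) = det(X_1 ξ, …, X_d ξ)` has
`P(ξ₀) = 1` and vanishes on `Oᶜ`: where `P ≠ 0` the orbit is a neighbourhood of the point, which
therefore belongs to the unique open orbit. Multiplication by `P^t` in frequency is a differential
operator, so applying it to a bump function gives a test function whose Fourier transform is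
divisible by `P^t`. -/

namespace DualOrbit

variable {d : ℕ}

/-! ### The linear action -/

/-- The action of a matrix as a continuous linear map. -/
noncomputable def actCLM (A : Matrix (Fin d) (Fin d) ℝ) : E d →L[ℝ] E d :=
  Matrix.toEuclideanCLM (𝕜 := ℝ) A

theorem actCLM_apply (A : Matrix (Fin d) (Fin d) ℝ) (ξ : E d) : actCLM A ξ = act A ξ := rfl

theorem act_add (A : Matrix (Fin d) (Fin d) ℝ) (ξ η : E d) :
    act A (ξ + η) = act A ξ + act A η := map_add (actCLM A) ξ η

theorem act_smul (A : Matrix (Fin d) (Fin d) ℝ) (c : ℝ) (ξ : E d) :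
    act A (c • ξ) = c • act A ξ := map_smul (actCLM A) c ξ

theorem act_zero (A : Matrix (Fin d) (Fin d) ℝ) : act A (0 : E d) = 0 := map_zero (actCLM A)

theorem actCLM_one : actCLM (1 : Matrix (Fin d) (Fin d) ℝ) = 1 :=
  map_one (Matrix.toEuclideanCLM (n := Fin d) (𝕜 := ℝ))

theorem actCLM_mul (A B : Matrix (Fin d) (Fin d) ℝ) : actCLM (A * B) = actCLM A * actCLM B :=
  map_mul (Matrix.toEuclideanCLM (n := Fin d) (𝕜 := ℝ)) A B

theorem act_one (ξ : E d) : act 1 ξ = ξ := by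
  rw [← actCLM_apply, actCLM_one]; rfl

theorem act_mul (A B : Matrix (Fin d) (Fin d) ℝ) (ξ : E d) : act (A * B) ξ = act A (act B ξ) := by
  rw [← actCLM_apply, actCLM_mul]; rfl

theorem continuous_act (A : Matrix (Fin d) (Fin d) ℝ) : Continuous (act A) :=
  (actCLM A).continuous

theorem continuous_actCLM : Continuous (actCLM (d := d)) :=
  LinearMap.continuous_of_finiteDimensional
    (Matrix.toEuclideanCLM (n := Fin d) (𝕜 := ℝ)).toAlgEquiv.toLinearMap

theorem continuous_act₂ :
    Continuous (fun p : Matrix (Fin d) (Fin d) ℝ × E d => act p.1 p.2) :=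
  (continuous_actCLM.comp continuous_fst).clm_apply continuous_snd

theorem inner_act_right (A : Matrix (Fin d) (Fin d) ℝ) (x y : E d) :
    inner ℝ x (act A y) = inner ℝ (act Aᵀ x) y := by
  simp only [act, PiLp.inner_apply, Matrix.toLpLin_apply, RCLike.inner_apply, conj_trivial]
  have h := Matrix.dotProduct_mulVec (x.ofLp) A (y.ofLp)
  rw [← Matrix.mulVec_transpose] at h
  simpa [dotProduct, mul_comm] using h

theorem inner_act_left (A : Matrix (Fin d) (Fin d) ℝ) (x y : E d) :
    inner ℝ (act A x) y = inner ℝ x (act Aᵀ y) := by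
  rw [inner_act_right, Matrix.transpose_transpose]

theorem act_inv_act (h : GL (Fin d) ℝ) (ξ : E d) :
    act ((h⁻¹ : GL (Fin d) ℝ) : Matrix (Fin d) (Fin d) ℝ) (act (h : Matrix (Fin d) (Fin d) ℝ) ξ)
      = ξ := by
  rw [← act_mul, ← Units.val_mul, inv_mul_cancel, Units.val_one, act_one]

theorem act_act_inv (h : GL (Fin d) ℝ) (ξ : E d) :
    act (h : Matrix (Fin d) (Fin d) ℝ) (act ((h⁻¹ : GL (Fin d) ℝ) : Matrix (Fin d) (Fin d) ℝ) ξ)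
      = ξ := by
  rw [← act_mul, ← Units.val_mul, mul_inv_cancel, Units.val_one, act_one]

/-- The dual action `ξ ↦ h^T ξ`. -/
noncomputable def dualAct (h : GL (Fin d) ℝ) (ξ : E d) : E d :=
  act (h : Matrix (Fin d) (Fin d) ℝ)ᵀ ξ

theorem dualAct_mul (g h : GL (Fin d) ℝ) (ξ : E d) :
    dualAct (g * h) ξ = dualAct h (dualAct g ξ) := by
  rw [dualAct, Units.val_mul, Matrix.transpose_mul, act_mul]; rfl

theorem dualAct_one (ξ : E d) : dualAct 1 ξ = ξ := by
  rw [dualAct, Units.val_one, Matrix.transpose_one, act_one]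

theorem dualAct_inv_dualAct (h : GL (Fin d) ℝ) (ξ : E d) : dualAct h⁻¹ (dualAct h ξ) = ξ := by
  rw [← dualAct_mul, mul_inv_cancel, dualAct_one]

theorem dualAct_dualAct_inv (h : GL (Fin d) ℝ) (ξ : E d) : dualAct h (dualAct h⁻¹ ξ) = ξ := by
  rw [← dualAct_mul, inv_mul_cancel, dualAct_one]

theorem dualAct_smul (h : GL (Fin d) ℝ) (c : ℝ) (ξ : E d) :
    dualAct h (c • ξ) = c • dualAct h ξ := act_smul _ _ _

theorem continuous_dualAct₂ :
    Continuous (fun p : GL (Fin d) ℝ × E d => dualAct p.1 p.2) := by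
  have : Continuous (fun p : GL (Fin d) ℝ × E d =>
      (((p.1 : Matrix (Fin d) (Fin d) ℝ)ᵀ, p.2) : Matrix (Fin d) (Fin d) ℝ × E d)) :=
    ((Units.continuous_val.comp continuous_fst).matrix_transpose).prodMk continuous_snd
  exact continuous_act₂.comp this

theorem continuous_dualAct (h : GL (Fin d) ℝ) : Continuous (dualAct h) := continuous_act _

/-! ### Determinants and changes of variables -/

theorem absDet_pos (h : GL (Fin d) ℝ) : 0 < absDet h :=
  abs_pos.2 (Matrix.isUnits_det_units h).ne_zero

theorem absDet_mul (g h : GL (Fin d) ℝ) : absDet (g * h) = absDet g * absDet h := by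
  simp [absDet, abs_mul]

theorem absDet_one : absDet (1 : GL (Fin d) ℝ) = 1 := by simp [absDet]

theorem absDet_inv (h : GL (Fin d) ℝ) : absDet h⁻¹ = (absDet h)⁻¹ := by
  refine eq_inv_of_mul_eq_one_left ?_
  rw [← absDet_mul, inv_mul_cancel, absDet_one]

theorem continuous_absDet : Continuous (absDet (d := d)) :=
  (Units.continuous_val.matrix_det).abs

theorem det_actCLM (A : Matrix (Fin d) (Fin d) ℝ) :
    LinearMap.det (actCLM A : E d →ₗ[ℝ] E d) = A.det := by
  have : (actCLM A : E d →ₗ[ℝ] E d) = Matrix.toEuclideanLin A := rfl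
  rw [this, Matrix.toEuclideanLin_eq_toLin_orthonormal, LinearMap.det_toLin]

theorem map_act_volume {A : Matrix (Fin d) (Fin d) ℝ} (hA : A.det ≠ 0) :
    Measure.map (act A) (volume : Measure (E d)) = ENNReal.ofReal |A.det|⁻¹ • volume := by
  have := Measure.map_linearMap_addHaar_eq_smul_addHaar (volume : Measure (E d))
    (f := (actCLM A : E d →ₗ[ℝ] E d)) (by rwa [det_actCLM])
  rw [det_actCLM, abs_inv] at this
  exact this

theorem lintegral_comp_act {A : Matrix (Fin d) (Fin d) ℝ} (hA : A.det ≠ 0) {f : E d → ℝ≥0∞}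
    (hf : Measurable f) :
    ∫⁻ x, f (act A x) = ENNReal.ofReal |A.det|⁻¹ * ∫⁻ x, f x := by
  rw [← lintegral_map hf (continuous_act A).measurable, map_act_volume hA, lintegral_smul_measure,
    smul_eq_mul]

/-- The action of an invertible matrix as a homeomorphism. -/
noncomputable def actHomeo (h : GL (Fin d) ℝ) : E d ≃ₜ E d where
  toFun := act (h : Matrix (Fin d) (Fin d) ℝ)
  invFun := act ((h⁻¹ : GL (Fin d) ℝ) : Matrix (Fin d) (Fin d) ℝ)
  left_inv := act_inv_act h
  right_inv := act_act_inv h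
  continuous_toFun := continuous_act _
  continuous_invFun := continuous_act _

theorem integral_comp_act {F : Type*} [NormedAddCommGroup F] [NormedSpace ℝ F]
    (h : GL (Fin d) ℝ) (f : E d → F) :
    ∫ x, f (act (h : Matrix (Fin d) (Fin d) ℝ) x) = (absDet h)⁻¹ • ∫ x, f x := by
  have h0 : ((h : Matrix (Fin d) (Fin d) ℝ)).det ≠ 0 := (Matrix.isUnits_det_units h).ne_zero
  have := integral_map_equiv (μ := (volume : Measure (E d))) (actHomeo h).toMeasurableEquiv f
  have h2 : Measure.map (actHomeo h).toMeasurableEquiv (volume : Measure (E d))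
      = ENNReal.ofReal |((h : Matrix (Fin d) (Fin d) ℝ)).det|⁻¹ • volume := map_act_volume h0
  rw [h2, integral_smul_measure, ENNReal.toReal_ofReal (by positivity)] at this
  exact this.symm

theorem integrable_comp_act {F : Type*} [NormedAddCommGroup F]
    (h : GL (Fin d) ℝ) {f : E d → F} (hf : Integrable f) :
    Integrable (fun x => f (act (h : Matrix (Fin d) (Fin d) ℝ) x)) := by
  have h0 : ((h : Matrix (Fin d) (Fin d) ℝ)).det ≠ 0 := (Matrix.isUnits_det_units h).ne_zero
  have h2 : Measure.map (actHomeo h).toMeasurableEquiv (volume : Measure (E d))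
      = ENNReal.ofReal |((h : Matrix (Fin d) (Fin d) ℝ)).det|⁻¹ • volume := map_act_volume h0
  have := (integrable_map_equiv (μ := (volume : Measure (E d)))
    (actHomeo h).toMeasurableEquiv f).1 (by
      rw [h2]; exact hf.smul_measure ENNReal.ofReal_ne_top)
  exact this

theorem integrable_quasiRegFun (x : E d) (h : GL (Fin d) ℝ) {f : E d → ℂ} (hf : Integrable f) :
    Integrable (quasiRegFun x h f) :=
  ((integrable_comp_act h⁻¹ hf).comp_sub_right x).smul (absDet h ^ (-(1 / 2) : ℝ))

/-- Change of variables `y = h z + x`. -/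
theorem integral_comp_affine {F : Type*} [NormedAddCommGroup F] [NormedSpace ℝ F]
    (x : E d) (h : GL (Fin d) ℝ) (f : E d → F) :
    ∫ y, f y = absDet h • ∫ z, f (act (h : Matrix (Fin d) (Fin d) ℝ) z + x) := by
  rw [integral_comp_act h (fun y => f (y + x)), smul_smul, mul_inv_cancel₀ (absDet_pos h).ne',
    one_smul, integral_add_right_eq_self]

theorem fourier_quasiRegFun (x : E d) (h : GL (Fin d) ℝ) (f : E d → ℂ) (ξ : E d) :
    𝓕 (quasiRegFun x h f) ξ =
      ((absDet h ^ (1 / 2 : ℝ) : ℝ) : ℂ) * (Real.fourierChar (-inner ℝ x ξ) : ℂ) *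
        𝓕 f (dualAct h ξ) := by
  rw [Real.fourier_eq, Real.fourier_eq, integral_comp_affine x h]
  have h1 : ∀ z : E d, Real.fourierChar (-inner ℝ (act (h : Matrix (Fin d) (Fin d) ℝ) z + x) ξ) •
      quasiRegFun x h f (act (h : Matrix (Fin d) (Fin d) ℝ) z + x) =
      (((absDet h ^ (-(1 / 2) : ℝ) : ℝ) : ℂ) * (Real.fourierChar (-inner ℝ x ξ) : ℂ)) *
        (Real.fourierChar (-inner ℝ z (dualAct h ξ)) • f z) := by
    intro z
    rw [quasiRegFun, add_sub_cancel_right, act_inv_act, inner_add_left, inner_act_left, neg_add,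
      AddChar.map_add_eq_mul]
    simp only [Circle.smul_def, Circle.coe_mul, smul_eq_mul, Complex.real_smul, dualAct]
    ring
  simp_rw [h1]
  rw [integral_const_mul, Complex.real_smul]
  have h2 : absDet h * absDet h ^ (-(1 / 2) : ℝ) = absDet h ^ (1 / 2 : ℝ) := by
    nth_rewrite 1 [← Real.rpow_one (absDet h)]
    rw [← Real.rpow_add (absDet_pos h)]; norm_num
  rw [← h2]; push_cast; ring

/-! ### Consequences of irreducibility -/

/-- `π(x,h)` is unitary. -/
theorem integral_conj_mul_quasiRegFun (x : E d) (h : GL (Fin d) ℝ) (φ f : E d → ℂ) :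
    ∫ y, (starRingEnd ℂ) (φ y) * quasiRegFun x h f y =
      ∫ y, (starRingEnd ℂ) (quasiRegFun
        (-act ((h⁻¹ : GL (Fin d) ℝ) : Matrix (Fin d) (Fin d) ℝ) x) h⁻¹ φ y) * f y := by
  rw [integral_comp_affine x h, ← integral_smul]
  congr 1; funext y
  simp only [quasiRegFun, add_sub_cancel_right, act_inv_act, sub_neg_eq_add, inv_inv, act_add,
    act_act_inv, Complex.real_smul, map_mul, Complex.conj_ofReal, absDet_inv]
  have h2 : absDet h * absDet h ^ (-(1 / 2) : ℝ) = (absDet h)⁻¹ ^ (-(1 / 2) : ℝ) := by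
    nth_rewrite 1 [← Real.rpow_one (absDet h)]
    rw [← Real.rpow_add (absDet_pos h), Real.inv_rpow (absDet_pos h).le,
      ← Real.rpow_neg (absDet_pos h).le]; norm_num
  rw [← h2]; push_cast; ring

theorem inner_toLp_left {φ : E d → ℂ} (hφ : MemLp φ 2 volume)
    (f : Lp ℂ 2 (volume : Measure (E d))) :
    inner ℂ (hφ.toLp φ) f = ∫ y, (starRingEnd ℂ) (φ y) * f y := by
  rw [L2.inner_def]
  refine integral_congr_ae ?_
  filter_upwards [hφ.coeFn_toLp] with y hy
  rw [hy, RCLike.inner_apply, mul_comm]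

/-- Parseval's relation for integrable functions. -/
theorem integral_conj_fourier_mul {f g : E d → ℂ} (hf : Integrable f) (hg : Integrable g) :
    ∫ ξ, (starRingEnd ℂ) (𝓕 f ξ) * g ξ = ∫ y, (starRingEnd ℂ) (f y) * 𝓕⁻ g y := by
  have h := VectorFourier.integral_sesq_fourierIntegral_eq_neg_flip (μ := (volume : Measure (E d)))
    (ν := (volume : Measure (E d))) (e := Real.fourierChar) (L := innerₗ (E d)) (innerSL ℂ)
    Real.continuous_fourierChar continuous_inner hf hg
  simp only [innerSL_apply_apply, RCLike.inner_apply] at h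
  simp_rw [mul_comm ((starRingEnd ℂ) _)]
  have e : (𝓕⁻ g : E d → ℂ) =
      VectorFourier.fourierIntegral Real.fourierChar volume (-(innerₗ (E d)).flip) g := by
    funext y
    rw [Real.fourierInv_eq, VectorFourier.fourierIntegral]
    congr 1; funext ξ
    simp [real_inner_comm]
  rw [e]
  exact h

theorem exists_smooth_bump {V : Set (E d)} (hV : IsOpen V) {ξ₁ : E d} (h₁ : ξ₁ ∈ V) :
    ∃ g : SchwartzMap (E d) ℂ, g ξ₁ ≠ 0 ∧ ∀ ξ ∉ V, g ξ = 0 := by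
  obtain ⟨f, hf1, hf2, hf3, -, hf4⟩ := exists_contDiff_tsupport_subset (n := (⊤ : ℕ∞)) (hV.mem_nhds h₁)
  refine ⟨(HasCompactSupport.toSchwartzMap (f := fun x => (f x : ℂ))
    (hf2.comp_left Complex.ofReal_zero) (Complex.ofRealCLM.contDiff.comp hf3)), ?_, fun ξ hξ => ?_⟩
  · change ((f ξ₁ : ℝ) : ℂ) ≠ 0
    rw [hf4]; simp
  · change ((f ξ : ℝ) : ℂ) = 0
    rw [image_eq_zero_of_notMem_tsupport (fun h => hξ (hf1 h))]; simp

/-- The closed subspace of all `f ∈ L²` orthogonal to the integrable functions in `L²` whose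
Fourier transforms vanish outside of `U`. -/
noncomputable def spectralOrtho (U : Set (E d)) :
    Submodule ℂ (Lp ℂ 2 (volume : Measure (E d))) where
  carrier := {f | ∀ (φ : E d → ℂ) (hφ : MemLp φ 2 volume), Integrable φ → (∀ ξ ∉ U, 𝓕 φ ξ = 0) →
    inner ℂ (hφ.toLp φ) f = 0}
  add_mem' := fun ha hb φ h1 h2 h3 => by rw [inner_add_right, ha φ h1 h2 h3, hb φ h1 h2 h3, add_zero]
  zero_mem' := fun _ _ _ _ => inner_zero_right _
  smul_mem' := fun c _ ha φ h1 h2 h3 => by rw [inner_smul_right, ha φ h1 h2 h3, mul_zero]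

theorem isClosed_spectralOrtho (U : Set (E d)) :
    IsClosed (spectralOrtho U : Set (Lp ℂ 2 (volume : Measure (E d)))) := by
  have : (spectralOrtho U : Set (Lp ℂ 2 (volume : Measure (E d)))) =
      ⋂ (φ : E d → ℂ) (hφ : MemLp φ 2 volume) (_ : Integrable φ) (_ : ∀ ξ ∉ U, 𝓕 φ ξ = 0),
        {f | inner ℂ (hφ.toLp φ) f = 0} := by
    ext f; simp [spectralOrtho]
  rw [this]
  refine isClosed_iInter fun φ => isClosed_iInter fun hφ => isClosed_iInter fun _ =>
    isClosed_iInter fun _ => ?_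
  exact isClosed_eq (continuous_const.inner continuous_id) continuous_const

/-- Unitarity moves `π(x,h)` onto the other factor as its inverse, whose effect in frequency is a
modulation, a scalar factor and the substitution `ξ ↦ h^{-T} ξ`. Invariance of `U` therefore
preserves the condition that the transform vanishes off `U`. -/
theorem quasiReg_mem_spectralOrtho {H : Subgroup (GL (Fin d) ℝ)} {U : Set (E d)}
    (hU : ∀ h ∈ H, ∀ ξ ∈ U, dualAct h ξ ∈ U) (x : E d) {h : GL (Fin d) ℝ} (hh : h ∈ H)
    {f : Lp ℂ 2 (volume : Measure (E d))} (hf : f ∈ spectralOrtho U) :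
    quasiReg x h f ∈ spectralOrtho U := by
  intro φ hφ hi hz
  rw [inner_toLp_left]
  have h1 : ∫ y, (starRingEnd ℂ) (φ y) * quasiReg x h f y =
      ∫ y, (starRingEnd ℂ) (φ y) * quasiRegFun x h f y := by
    refine integral_congr_ae ?_
    filter_upwards [(memLp_quasiRegFun x h (Lp.memLp f)).coeFn_toLp] with y hy
    rw [← hy]; rfl
  rw [h1, integral_conj_mul_quasiRegFun]
  have h2 := memLp_quasiRegFun
    (-act ((h⁻¹ : GL (Fin d) ℝ) : Matrix (Fin d) (Fin d) ℝ) x) h⁻¹ hφ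
  rw [← inner_toLp_left h2]
  refine hf _ h2 (integrable_quasiRegFun _ _ hi) fun ξ hξ => ?_
  rw [fourier_quasiRegFun, hz, mul_zero]
  intro h3
  have := hU h hh _ h3
  rw [dualAct_dualAct_inv] at this
  exact hξ this

/-- If `U` and `V` were disjoint, `spectralOrtho U` would be a closed invariant subspace which
contains functions with spectrum in `V` but no nonzero Schwartz function with spectrum in `U`, hence
a proper nonzero one. -/
theorem inter_nonempty_of_irreducible {H : Subgroup (GL (Fin d) ℝ)} [MeasurableSpace H]
    {μ : Measure H} (hH : IsAdmissible H μ) {U V : Set (E d)} (hU : IsOpen U) (hV : IsOpen V)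
    (hU' : U.Nonempty) (hV' : V.Nonempty) (hinv : ∀ h ∈ H, ∀ ξ ∈ U, dualAct h ξ ∈ U) :
    (U ∩ V).Nonempty := by
  by_contra hUV
  rw [Set.not_nonempty_iff_eq_empty] at hUV
  have key : ∀ g : SchwartzMap (E d) ℂ, ∃ φ : SchwartzMap (E d) ℂ, 𝓕 (φ : E d → ℂ) = g ∧
      (φ : E d → ℂ) = 𝓕⁻ (g : E d → ℂ) := by
    intro g
    refine ⟨𝓕⁻ g, ?_, ?_⟩
    · rw [← SchwartzMap.fourier_coe, FourierTransform.fourier_fourierInv_eq]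
    · rw [SchwartzMap.fourierInv_coe]
  -- The Fourier integral depends only on the class modulo null sets, so a nonzero transform forces
  -- a nonzero class in `L²`.
  have hne : ∀ (g φ : SchwartzMap (E d) ℂ), 𝓕 (φ : E d → ℂ) = g → ∀ ξ, g ξ ≠ 0 →
      (φ.memLp 2 (volume : Measure (E d))).toLp φ ≠ 0 := by
    intro g φ hφ ξ hξ h0
    have h0 := (MemLp.coeFn_toLp (φ.memLp 2 (volume : Measure (E d)))).symm.trans
      ((congrArg (fun x : Lp ℂ 2 (volume : Measure (E d)) => (x : E d → ℂ)) h0 ▸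
        Lp.coeFn_zero ℂ 2 (volume : Measure (E d))))
    apply hξ
    rw [← hφ, Real.fourier_eq]
    rw [integral_congr_ae (g := fun _ => 0)]
    · simp
    · filter_upwards [h0] with y hy
      simp [hy]
  obtain ⟨ξ₁, h₁⟩ := hU'
  obtain ⟨ξ₂, h₂⟩ := hV'
  obtain ⟨g₁, hg₁, hg₁'⟩ := exists_smooth_bump hU h₁
  obtain ⟨g₂, hg₂, hg₂'⟩ := exists_smooth_bump hV h₂
  obtain ⟨φ₁, hφ₁, -⟩ := key g₁
  obtain ⟨φ₂, hφ₂, hφ₂'⟩ := key g₂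
  -- If the subspace is zero, `φ₂` contradicts this, being orthogonal by Parseval to everything with
  -- spectrum in `U`; if it is everything, `φ₁` is orthogonal to itself.
  rcases hH.irreducible (spectralOrtho U) (isClosed_spectralOrtho U)
    (fun x h hh f hf => quasiReg_mem_spectralOrtho hinv x hh hf) with hM | hM
  · have : (φ₂.memLp 2 (volume : Measure (E d))).toLp φ₂ ∈ spectralOrtho U := by
      intro φ hφ hi hz
      rw [inner_toLp_left]
      have e : ∫ y, (starRingEnd ℂ) (φ y) * (φ₂.memLp 2 (volume : Measure (E d))).toLp φ₂ y =
          ∫ y, (starRingEnd ℂ) (φ y) * 𝓕⁻ (g₂ : E d → ℂ) y := by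
        refine integral_congr_ae ?_
        filter_upwards [(φ₂.memLp 2 (volume : Measure (E d))).coeFn_toLp] with y hy
        rw [hy, hφ₂']
      rw [e, ← integral_conj_fourier_mul hi g₂.integrable]
      rw [integral_congr_ae (g := fun _ => 0)]
      · simp
      · refine Filter.Eventually.of_forall fun ξ => ?_
        by_cases h : ξ ∈ U
        · have : ξ ∉ V := fun h' => by
            have : ξ ∈ U ∩ V := ⟨h, h'⟩
            rw [hUV] at this; exact this
          simp [hg₂' ξ this]
        · simp [hz ξ h]
    rw [hM, Submodule.mem_bot] at this
    exact hne g₂ φ₂ hφ₂ ξ₂ hg₂ this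
  · have : (φ₁.memLp 2 (volume : Measure (E d))).toLp φ₁ ∈ spectralOrtho U := by
      rw [hM]; trivial
    have h0 := this φ₁ (φ₁.memLp 2 volume) φ₁.integrable (fun ξ hξ => by rw [hφ₁, hg₁' ξ hξ])
    rw [inner_self_eq_zero] at h0
    exact hne g₁ φ₁ hφ₁ ξ₁ hg₁ h0

/-! ### The open dual orbit and its complement -/

theorem IsOpenDualOrbit.nonempty {H : Subgroup (GL (Fin d) ℝ)} {O : Set (E d)}
    (hO : IsOpenDualOrbit H O) : O.Nonempty := by
  obtain ⟨-, ξ, rfl⟩ := hO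
  exact ⟨ξ, 1, H.one_mem, (dualAct_one ξ).symm⟩

theorem IsOpenDualOrbit.dualAct_mem {H : Subgroup (GL (Fin d) ℝ)} {O : Set (E d)}
    (hO : IsOpenDualOrbit H O) {h : GL (Fin d) ℝ} (hh : h ∈ H) {ξ : E d} (hξ : ξ ∈ O) :
    dualAct h ξ ∈ O := by
  obtain ⟨-, η, rfl⟩ := hO
  obtain ⟨g, hg, rfl⟩ := hξ
  exact ⟨g * h, H.mul_mem hg hh, (dualAct_mul g h η).symm⟩

theorem IsOpenDualOrbit.exists_dualAct_eq {H : Subgroup (GL (Fin d) ℝ)} {O : Set (E d)}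
    (hO : IsOpenDualOrbit H O) {ξ η : E d} (hξ : ξ ∈ O) (hη : η ∈ O) :
    ∃ h ∈ H, η = dualAct h ξ := by
  obtain ⟨-, ζ, rfl⟩ := hO
  obtain ⟨g, hg, rfl⟩ := hξ
  obtain ⟨k, hk, rfl⟩ := hη
  refine ⟨g⁻¹ * k, H.mul_mem (H.inv_mem hg) hk, ?_⟩
  rw [dualAct_mul]
  exact congrArg (dualAct k) (dualAct_inv_dualAct g ζ).symm

theorem IsOpenDualOrbit.mem_of_dualAct_mem {H : Subgroup (GL (Fin d) ℝ)} {O : Set (E d)}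
    (hO : IsOpenDualOrbit H O) {h : GL (Fin d) ℝ} (hh : h ∈ H) {ξ : E d} (hξ : dualAct h ξ ∈ O) :
    ξ ∈ O := by
  have := hO.dualAct_mem (H.inv_mem hh) hξ
  rwa [dualAct_inv_dualAct] at this

/-- A point whose orbit contains a nonempty open set lies in the open dual orbit. -/
theorem mem_of_open_subset_orbit {H : Subgroup (GL (Fin d) ℝ)} [MeasurableSpace H]
    {μ : Measure H} (hH : IsAdmissible H μ) {O : Set (E d)} (hO : IsOpenDualOrbit H O)
    {ξ : E d} {V : Set (E d)} (hV : IsOpen V) (hV' : V.Nonempty) (hVξ : V ⊆ dualOrbit H ξ) :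
    ξ ∈ O := by
  obtain ⟨η, h1, h2⟩ := inter_nonempty_of_irreducible hH hO.1 hV hO.nonempty hV'
    (fun h hh ξ hξ => hO.dualAct_mem hh hξ)
  obtain ⟨h, hh, rfl⟩ := hVξ h2
  exact hO.mem_of_dualAct_mem hh h1

/-- The dual action commutes with scalars, so `r O` is open and contained in the orbit of `r • ξ`.
-/
theorem smul_mem_openOrbit {H : Subgroup (GL (Fin d) ℝ)} [MeasurableSpace H]
    {μ : Measure H} (hH : IsAdmissible H μ) {O : Set (E d)} (hO : IsOpenDualOrbit H O)
    {r : ℝ} (hr : r ≠ 0) {ξ : E d} (hξ : ξ ∈ O) : r • ξ ∈ O := by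
  have hV : IsOpen ((fun η : E d => r⁻¹ • η) ⁻¹' O) := hO.1.preimage (continuous_const_smul r⁻¹)
  refine mem_of_open_subset_orbit hH hO hV ⟨r • ξ, ?_⟩ fun η hη => ?_
  · simpa [smul_smul, inv_mul_cancel₀ hr] using hξ
  · obtain ⟨h, hh, hη'⟩ := hO.exists_dualAct_eq hξ hη
    refine ⟨h, hh, ?_⟩
    change η = dualAct h (r • ξ)
    rw [dualAct_smul, ← hη', smul_smul, mul_inv_cancel₀ hr, one_smul]

theorem smul_mem_compl_openOrbit {H : Subgroup (GL (Fin d) ℝ)} [MeasurableSpace H]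
    {μ : Measure H} (hH : IsAdmissible H μ) {O : Set (E d)} (hO : IsOpenDualOrbit H O)
    {r : ℝ} (hr : r ≠ 0) {ξ : E d} (hξ : ξ ∈ Oᶜ) : r • ξ ∈ Oᶜ := fun h => hξ <| by
  have := smul_mem_openOrbit hH hO (inv_ne_zero hr) h
  rwa [smul_smul, inv_mul_cancel₀ hr, one_smul] at this

/-- The orbit of `0` is `{0}`, which is not open in positive dimension. -/
theorem zero_mem_compl_openOrbit (hd : 0 < d) {H : Subgroup (GL (Fin d) ℝ)} {O : Set (E d)}
    (hO : IsOpenDualOrbit H O) : (0 : E d) ∈ Oᶜ := by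
  intro h0
  have hsub : O ⊆ {0} := by
    intro η hη
    obtain ⟨h, -, rfl⟩ := hO.exists_dualAct_eq h0 hη
    exact act_zero _
  have : Nonempty (Fin d) := ⟨⟨0, hd⟩⟩
  have : Nontrivial (E d) := inferInstance
  have h1 : ({0} : Set (E d)) ∈ nhds 0 := Filter.mem_of_superset (hO.1.mem_nhds h0) hsub
  have h2 := Module.punctured_nhds_neBot ℝ (E d) 0
  refine h2.ne ?_
  rw [nhdsWithin, Filter.inf_principal_eq_bot, compl_compl]
  exact h1

section

open scoped Convolution

/-! ### Regularity of functions with continuous weak derivatives -/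

/-- A continuous function with a continuous weak derivative is differentiable. -/
theorem hasFDerivAt_of_weak {V : Type*} [NormedAddCommGroup V] [NormedSpace ℝ V]
    [FiniteDimensional ℝ V] [MeasurableSpace V] [BorelSpace V] {ν : Measure V} [ν.IsAddHaarMeasure]
    {f : V → ℂ} {G : V → V →L[ℝ] ℂ} (hf : Continuous f) (hG : Continuous G)
    (hw : ∀ φ : V → ℝ, ContDiff ℝ ∞ φ → HasCompactSupport φ → ∀ v : V,
      ∫ x, (fderiv ℝ φ x v) • f x ∂ν = -∫ x, φ x • G x v ∂ν) (x₀ : V) :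
    HasFDerivAt f (G x₀) x₀ := by
  have : IsFiniteMeasureOnCompacts ν := inferInstance
  -- Mollification commutes with the weak derivative: the weak identity is tested against the
  -- reflected translate `t ↦ φ(y - t)`.
  have hconv : ∀ (φ : ContDiffBump (0 : V)) (y : V),
      HasFDerivAt (φ.normed ν ⋆[ContinuousLinearMap.lsmul ℝ ℝ, ν] f)
        ((φ.normed ν ⋆[ContinuousLinearMap.lsmul ℝ ℝ, ν] G) y) y := by
    intro φ y
    have hφc : HasCompactSupport (φ.normed ν) := φ.hasCompactSupport_normed
    have hφs : ContDiff ℝ ∞ (φ.normed ν) := φ.contDiff_normed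
    have h1 := hφc.hasFDerivAt_convolution_left (ContinuousLinearMap.lsmul ℝ ℝ)
      (hφs.of_le (by exact_mod_cast le_top)) (hf.locallyIntegrable (μ := ν)) y
    convert! h1 using 1
    ext v
    have hχs : ContDiff ℝ ∞ (fun t => φ.normed ν (y - t)) := hφs.comp (contDiff_const.sub contDiff_id)
    have hχc : HasCompactSupport (fun t => φ.normed ν (y - t)) :=
      hφc.comp_homeomorph (Homeomorph.subLeft y)
    have h2 := hw _ hχs hχc v
    have h3 : ∀ t, fderiv ℝ (fun t => φ.normed ν (y - t)) t v = -fderiv ℝ (φ.normed ν) (y - t) v := by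
      intro t
      have e := (hφs.differentiable (by simp) (y - t)).hasFDerivAt.comp t
        ((hasFDerivAt_const y t).sub (hasFDerivAt_id t))
      have e' := e.fderiv
      change fderiv ℝ (fun t => φ.normed ν (y - t)) t = _ at e'
      rw [e']; simp
    rw [convolution_lsmul_swap, convolution_eq_swap]
    rw [ContinuousLinearMap.integral_apply, ContinuousLinearMap.integral_apply]
    · simp only [ContinuousLinearMap.precompL_apply, ContinuousLinearMap.lsmul_apply,
        smul_apply]
      simp only [h3, neg_smul, integral_neg, neg_inj] at h2
      exact h2.symm
    · have hc := ((hφc.fderiv (𝕜 := ℝ)).comp_homeomorph (Homeomorph.subLeft y))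
      refine Continuous.integrable_of_hasCompactSupport ?_ ?_
      · have : Continuous (fun t => fderiv ℝ (φ.normed ν) (y - t)) :=
          (hφs.continuous_fderiv (by simp)).comp (continuous_const.sub continuous_id)
        exact (((ContinuousLinearMap.lsmul ℝ ℝ).precompL V).continuous.comp this).clm_apply hf
      · refine hc.mono fun t ht => ?_
        rw [Function.mem_support] at ht ⊢
        intro h0
        apply ht
        have h0' : fderiv ℝ (φ.normed ν) (y - t) = 0 := h0
        rw [h0']; simp
    · refine Continuous.integrable_of_hasCompactSupport
        ((hφs.continuous.comp (continuous_const.sub continuous_id)).smul hG) ?_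
      exact hχc.smul_right
  rw [hasFDerivAt_iff_isLittleO_nhds_zero, Asymptotics.isLittleO_iff]
  intro c hc
  obtain ⟨δ, hδ, hδ'⟩ := Metric.continuous_iff.1 hG x₀ (c / 2) (half_pos hc)
  filter_upwards [Metric.ball_mem_nhds (0 : V) (half_pos hδ)] with v hv
  -- Outer radii at most `δ / 2`: for `y` within `δ / 2` of `x₀`, the mollified `G` at `y` averages
  -- values of `G` over the `δ`-ball about `x₀`. The resulting difference estimate is uniform in `n`
  -- and so survives the limit.
  let φ : ℕ → ContDiffBump (0 : V) := fun n =>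
    ⟨δ / 4 / (n + 1), δ / 2 / (n + 1), by positivity, by gcongr; norm_num⟩
  have hlim : Filter.Tendsto (fun n => (φ n).rOut) Filter.atTop (nhds 0) :=
    tendsto_const_div_atTop_nhds_zero_nat (δ / 2) |>.comp (Filter.tendsto_add_atTop_nat 1) |>.congr
      (fun n => by simp [φ])
  have hb : ∀ n, ‖(((φ n).normed ν ⋆[ContinuousLinearMap.lsmul ℝ ℝ, ν] f) (x₀ + v) -
      ((φ n).normed ν ⋆[ContinuousLinearMap.lsmul ℝ ℝ, ν] f) x₀) - G x₀ v‖ ≤ c * ‖v‖ := by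
    intro n
    have := (convex_ball x₀ (δ / 2)).norm_image_sub_le_of_norm_hasFDerivWithin_le' (C := c)
      (φ := G x₀) (fun y _ => (hconv (φ n) y).hasFDerivWithinAt) (fun y hy => ?_)
      (Metric.mem_ball_self (half_pos hδ)) (y := x₀ + v) (by simpa using hv)
    · simpa using this
    · have hr : (φ n).rOut ≤ δ / 2 := by
        change δ / 2 / ((n : ℝ) + 1) ≤ δ / 2
        exact div_le_self (by positivity) (by linarith [n.cast_nonneg (α := ℝ)])
      have h1' : dist (((φ n).normed ν ⋆[ContinuousLinearMap.lsmul ℝ ℝ, ν] G) y) (G x₀) ≤ c := by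
        refine dist_convolution_le hc.le (φ n).support_normed_eq.subset (φ n).nonneg_normed
          (φ n).integral_normed hG.aestronglyMeasurable fun z hz => ?_
        have h2 := hδ' z ?_
        · linarith
        · rw [Metric.mem_ball] at hy hz
          have := dist_triangle z y x₀; linarith
      rwa [← dist_eq_norm]
  refine le_of_tendsto (((((ContDiffBump.convolution_tendsto_right_of_continuous hlim hf
    (x₀ + v)).sub (ContDiffBump.convolution_tendsto_right_of_continuous hlim hf x₀)).sub
      tendsto_const_nhds)).norm) (Filter.Eventually.of_forall hb)

end

/-! ### Partial derivatives -/

/-- The standard basis vectors. -/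
noncomputable abbrev stdVec (j : Fin d) : E d := EuclideanSpace.single j 1

theorem sum_smul_stdVec (v : E d) : ∑ j, v j • stdVec j = v := by
  have := (EuclideanSpace.basisFun (Fin d) ℝ).sum_repr v
  simpa using this

theorem partialDeriv_cons {k : ℕ} (j : Fin d) (i : Fin k → Fin d) {f : E d → ℂ}
    (hf : Differentiable ℝ (iteratedFDeriv ℝ k f)) (x : E d) :
    partialDeriv (Fin.cons j i : Fin (k + 1) → Fin d) f x =
      fderiv ℝ (partialDeriv i f) x (stdVec j) := by
  rw [partialDeriv, (hf x).iteratedFDeriv_succ_apply_left']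
  rfl

/-- The derivative in the direction `v` commutes with iterated derivatives. -/
theorem fderiv_iteratedFDeriv_apply_comm {V : Type*} [NormedAddCommGroup V] [NormedSpace ℝ V]
    {f : V → ℂ} (hf : ContDiff ℝ ∞ f) {k : ℕ} (m : Fin k → V) (v x : V) :
    fderiv ℝ (fun y => iteratedFDeriv ℝ k f y m) x v =
      iteratedFDeriv ℝ k (fun y => fderiv ℝ f y v) x m := by
  induction k generalizing x with
  | zero => simp
  | succ k ih =>
    have hfv : ContDiff ℝ ∞ (fun y => fderiv ℝ f y v) :=
      (hf.fderiv_right (m := ∞) (by simp)).clm_apply contDiff_const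
    have hdiff : ∀ {g : V → ℂ} (hg : ContDiff ℝ ∞ g), Differentiable ℝ (iteratedFDeriv ℝ k g) :=
      fun hg => hg.differentiable_iteratedFDeriv (by exact_mod_cast WithTop.coe_lt_top _)
    rw [(hdiff hfv x).iteratedFDeriv_succ_apply_left']
    simp_rw [fun y => (hdiff hf y).iteratedFDeriv_succ_apply_left' (m := m)]
    simp_rw [← ih]
    -- With one direction peeled off and the induction hypothesis applied, the claim is the symmetry
    -- of the second derivative of `u` in the directions `v` and `m 0`.
    set u : V → ℂ := fun y => iteratedFDeriv ℝ k f y (Fin.tail m) with hu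
    have hus : ContDiff ℝ ∞ u := by
      have h0 : ContDiff ℝ ∞ (iteratedFDeriv ℝ k f) :=
        hf.iteratedFDeriv_right (m := ∞) (by exact_mod_cast le_top)
      exact (ContinuousMultilinearMap.apply ℝ (fun _ : Fin k => V) ℂ
        (Fin.tail m)).contDiff.comp h0
    have hsymm := (hus.contDiffAt (x := x)).isSymmSndFDerivAt
      (by simp only [minSmoothness_of_isRCLikeNormedField]; exact WithTop.coe_le_coe.2 le_top)
    have hd2 : DifferentiableAt ℝ (fderiv ℝ u) x :=
      (hus.fderiv_right (m := ∞) (by simp)).differentiable (by simp) x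
    have e : ∀ a b : V, fderiv ℝ (fun y => fderiv ℝ u y a) x b = fderiv ℝ (fderiv ℝ u) x b a := by
      intro a b
      rw [fderiv_clm_apply hd2 (differentiableAt_const a)]
      simp
    rw [e, e, hsymm.eq]

/-- `partialDeriv_cons` puts the new derivative outermost; integration by parts needs it innermost,
acting directly on the test function. -/
theorem partialDeriv_cons_comm {k : ℕ} (j : Fin d) (i : Fin k → Fin d) {φ : E d → ℂ}
    (hφ : ContDiff ℝ ∞ φ) (x : E d) :
    partialDeriv (Fin.cons j i : Fin (k + 1) → Fin d) φ x =
      partialDeriv i (fun y => fderiv ℝ φ y (stdVec j)) x := by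
  rw [partialDeriv_cons j i (hφ.differentiable_iteratedFDeriv
    (by exact_mod_cast WithTop.coe_lt_top _))]
  exact fderiv_iteratedFDeriv_apply_comm hφ _ _ _

/-- A left inverse of the map sending a multilinear map to its values on basis vectors. -/
theorem exists_multilinear_leftInverse (d k : ℕ) :
    ∃ S : ((Fin k → Fin d) → ℂ) →L[ℝ] (E d [×k]→L[ℝ] ℂ),
      ∀ m : E d [×k]→L[ℝ] ℂ, S (fun i => m (fun j => stdVec (i j))) = m := by
  let T : (E d [×k]→L[ℝ] ℂ) →ₗ[ℝ] ((Fin k → Fin d) → ℂ) :=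
    { toFun := fun m i => m (fun j => stdVec (i j))
      map_add' := fun _ _ => rfl
      map_smul' := fun _ _ => rfl }
  have hT : LinearMap.ker T = ⊥ := by
    rw [LinearMap.ker_eq_bot']
    intro m hm
    have : m.toMultilinearMap = 0 := by
      refine Module.Basis.ext_multilinear (fun _ => (EuclideanSpace.basisFun (Fin d) ℝ).toBasis)
        fun i => ?_
      have := congrFun hm i
      simpa [T] using this
    ext v
    exact congrArg (fun M : MultilinearMap ℝ (fun _ : Fin k => E d) ℂ => M v) this
  obtain ⟨S, hS⟩ := T.exists_leftInverse_of_injective hT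
  refine ⟨LinearMap.toContinuousLinearMap S, fun m => ?_⟩
  exact congrArg (fun L : (E d [×k]→L[ℝ] ℂ) →ₗ[ℝ] (E d [×k]→L[ℝ] ℂ) => L m) hS

theorem iteratedFDeriv_eq_of_partialDeriv {k : ℕ}
    {S : ((Fin k → Fin d) → ℂ) →L[ℝ] (E d [×k]→L[ℝ] ℂ)}
    (hS : ∀ m : E d [×k]→L[ℝ] ℂ, S (fun i => m (fun j => stdVec (i j))) = m) (f : E d → ℂ)
    (x : E d) : iteratedFDeriv ℝ k f x = S (fun i => partialDeriv i f x) :=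
  (hS (iteratedFDeriv ℝ k f x)).symm

theorem iteratedFDeriv_eq_zero_of_partialDeriv {k : ℕ} {f : E d → ℂ} {x : E d}
    (h : ∀ i : Fin k → Fin d, partialDeriv i f x = 0) : iteratedFDeriv ℝ k f x = 0 := by
  obtain ⟨S, hS⟩ := exists_multilinear_leftInverse d k
  rw [iteratedFDeriv_eq_of_partialDeriv hS]
  simp only [h]
  exact map_zero S

/-! ### Weak derivatives -/

/-- Continuous functions with the same integrals against test functions agree. -/
theorem eq_of_integral_test_eq {f g : E d → ℂ} (hf : Continuous f) (hg : Continuous g)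
    (h : ∀ φ : E d → ℂ, ContDiff ℝ ∞ φ → HasCompactSupport φ →
      ∫ ξ, f ξ * φ ξ = ∫ ξ, g ξ * φ ξ) : f = g := by
  have h0 : ∀ᵐ x : E d, (f - g) x = 0 := by
    refine ae_eq_zero_of_integral_contDiff_smul_eq_zero (hf.sub hg).locallyIntegrable
      fun φ hφ hφc => ?_
    have hφ' : ContDiff ℝ ∞ (fun x => (φ x : ℂ)) := Complex.ofRealCLM.contDiff.comp hφ
    have hφc' : HasCompactSupport (fun x => (φ x : ℂ)) := hφc.comp_left Complex.ofReal_zero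
    have hi : ∀ {u : E d → ℂ}, Continuous u → Integrable (fun x => u x * (φ x : ℂ)) := fun hu =>
      (hu.mul hφ'.continuous).integrable_of_hasCompactSupport hφc'.mul_left
    have h1 := h _ hφ' hφc'
    rw [← sub_eq_zero, ← integral_sub (hi hf) (hi hg)] at h1
    rw [← h1]
    congr 1; funext x
    simp only [Pi.sub_apply, Complex.real_smul]; ring
  have h1 : f - g = 0 := (hf.sub hg).ae_eq_iff_eq (μ := (volume : Measure (E d)))
    continuous_zero |>.1 h0
  exact sub_eq_zero.1 h1

theorem integral_mul_fderiv_test {f φ : E d → ℂ} (hf : ContDiff ℝ 1 f) (hφ : ContDiff ℝ ∞ φ)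
    (hφc : HasCompactSupport φ) (v : E d) :
    ∫ x, f x * fderiv ℝ φ x v = -∫ x, fderiv ℝ f x v * φ x := by
  have hdφ : Continuous (fun x => fderiv ℝ φ x v) :=
    (hφ.continuous_fderiv (by simp)).clm_apply continuous_const
  have hdf : Continuous (fun x => fderiv ℝ f x v) :=
    (hf.continuous_fderiv (by simp)).clm_apply continuous_const
  refine integral_mul_fderiv_eq_neg_fderiv_mul_of_integrable ?_ ?_ ?_
    (fun x _ => hf.differentiable (by simp) x) (fun x _ => hφ.differentiable (by simp) x)
  · exact (hdf.mul hφ.continuous).integrable_of_hasCompactSupport hφc.mul_left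
  · exact (hf.continuous.mul hdφ).integrable_of_hasCompactSupport (hφc.fderiv_apply ℝ v).mul_left
  · exact (hf.continuous.mul hφ.continuous).integrable_of_hasCompactSupport hφc.mul_left

theorem contDiff_fderiv_apply {φ : E d → ℂ} (hφ : ContDiff ℝ ∞ φ) (v : E d) :
    ContDiff ℝ ∞ (fun x => fderiv ℝ φ x v) :=
  (hφ.fderiv_right (m := ∞) (by simp)).clm_apply contDiff_const

theorem contDiff_partialDeriv {f : E d → ℂ} {k : ℕ} {n : ℕ∞ω} (hf : ContDiff ℝ (n + k) f)
    (i : Fin k → Fin d) : ContDiff ℝ n (partialDeriv i f) :=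
  (ContinuousMultilinearMap.apply ℝ (fun _ : Fin k => E d) ℂ
    (fun j => stdVec (i j))).contDiff.comp (hf.iteratedFDeriv_right (m := n) le_rfl)

/-- Classical derivatives are weak derivatives. -/
theorem hasContDistribDeriv_partialDeriv {k : ℕ} (i : Fin k → Fin d) {f : E d → ℂ}
    (hf : ContDiff ℝ k f) : HasContDistribDeriv i f (partialDeriv i f) := by
  refine ⟨(contDiff_partialDeriv (n := 0) (by simpa using hf) i).continuous, ?_⟩
  induction k with
  | zero => intro φ _ _; simp [partialDeriv]
  | succ k ih =>
    intro φ hφ hφc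
    obtain ⟨j, i', rfl⟩ : ∃ (j : Fin d) (i' : Fin k → Fin d), i = Fin.cons j i' :=
      ⟨i 0, Fin.tail i, (Fin.cons_self_tail i).symm⟩
    have hfk : ContDiff ℝ (1 + k : ℕ∞ω) f := by
      rw [add_comm]; exact_mod_cast hf
    simp_rw [partialDeriv_cons_comm j i' hφ]
    rw [ih i' (hf.of_le (by exact_mod_cast Nat.le_succ k)) _ (contDiff_fderiv_apply hφ _)
      (hφc.fderiv_apply ℝ _), integral_mul_fderiv_test (contDiff_partialDeriv hfk i') hφ hφc]
    have hd : Differentiable ℝ (iteratedFDeriv ℝ k f) :=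
      hf.differentiable_iteratedFDeriv (by exact_mod_cast Nat.lt_succ_self k)
    simp_rw [partialDeriv_cons j i' hd]
    ring

/-- A continuous function whose weak derivatives of order at most `r` are continuous is `C^r`. -/
theorem contDiff_of_hasContDistribDeriv {f : E d → ℂ} (hf : Continuous f) {r : ℕ}
    {g : ∀ k : ℕ, (Fin k → Fin d) → E d → ℂ}
    (hg : ∀ k ≤ r, ∀ i : Fin k → Fin d, HasContDistribDeriv i f (g k i)) :
    ∀ k ≤ r, ContDiff ℝ k f ∧ ∀ i : Fin k → Fin d, partialDeriv i f = g k i := by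
  intro k
  induction k with
  | zero =>
    intro h0
    refine ⟨contDiff_zero.2 hf, fun i => ?_⟩
    have e : partialDeriv i f = f := by funext x; simp [partialDeriv]
    rw [e]
    refine eq_of_integral_test_eq hf (hg 0 h0 i).1 fun φ h1 h2 => ?_
    have := (hg 0 h0 i).2 φ h1 h2
    simpa [partialDeriv] using this
  | succ k ih =>
    intro hk
    obtain ⟨hC, hpd⟩ := ih (Nat.le_of_succ_le hk)
    have hproj : ∀ (j : Fin d) (v : E d), (EuclideanSpace.proj j : E d →L[ℝ] ℝ) v = v j :=
      fun _ _ => rfl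
    -- The candidate differential of `∂_i f`, assembled from the given weak derivatives of order `k
    -- + 1`.
    let G : (Fin k → Fin d) → E d → E d →L[ℝ] ℂ := fun i x =>
      ∑ j, (EuclideanSpace.proj j : E d →L[ℝ] ℝ).smulRight (g (k + 1) (Fin.cons j i) x)
    have hG : ∀ i, Continuous (G i) := fun i => by
      refine continuous_finsetSum _ fun j _ => ?_
      exact ((ContinuousLinearMap.smulRightL ℝ (E d) ℂ
        (EuclideanSpace.proj j : E d →L[ℝ] ℝ)).continuous).comp (hg (k + 1) hk (Fin.cons j i)).1
    have hD : ∀ i x, HasFDerivAt (partialDeriv i f) (G i x) x := by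
      intro i x
      have hc : Continuous (partialDeriv i f) := by
        rw [hpd]; exact (hg k (Nat.le_of_succ_le hk) i).1
      refine hasFDerivAt_of_weak (ν := volume) hc (hG i) (fun φ hφ hφc v => ?_) x
      have hφ' : ContDiff ℝ ∞ (fun x => (φ x : ℂ)) := Complex.ofRealCLM.contDiff.comp hφ
      have hφc' : HasCompactSupport (fun x => (φ x : ℂ)) := hφc.comp_left Complex.ofReal_zero
      have hφd : ∀ x u, fderiv ℝ (fun x => (φ x : ℂ)) x u = ((fderiv ℝ φ x u : ℝ) : ℂ) := by
        intro x u
        have := (Complex.ofRealCLM.hasFDerivAt.comp x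
          (hφ.differentiable (by simp) x).hasFDerivAt).fderiv
        change fderiv ℝ (fun x => (φ x : ℂ)) x = _ at this
        rw [this]; rfl
      -- The order `k` identity tested on `∂_j φ` and the order `k + 1` identity tested on `φ` have
      -- the same left side; cancelling the signs shows that `g (k + 1)` is a weak derivative of `g
      -- k`.
      have hj : ∀ j : Fin d, ∫ x, partialDeriv i f x * fderiv ℝ (fun x => (φ x : ℂ)) x (stdVec j) =
          -∫ x, g (k + 1) (Fin.cons j i) x * (φ x : ℂ) := by
        intro j
        have h1 := (hg k (Nat.le_of_succ_le hk) i).2 _ (contDiff_fderiv_apply hφ' (stdVec j))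
          (hφc'.fderiv_apply ℝ (stdVec j))
        have h2 := (hg (k + 1) hk (Fin.cons j i)).2 _ hφ' hφc'
        simp_rw [partialDeriv_cons_comm j i hφ'] at h2
        rw [h2] at h1
        rw [hpd]
        have h3 : ((-1 : ℂ) ^ k) ≠ 0 := pow_ne_zero _ (by norm_num)
        apply mul_left_cancel₀ h3
        rw [← h1]; ring
      have hi1 : ∀ j ∈ Finset.univ, Integrable (fun x => v j •
          (partialDeriv i f x * fderiv ℝ (fun x => (φ x : ℂ)) x (stdVec j))) := by
        intro j _
        refine Integrable.smul (v j) ?_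
        exact (hc.mul (contDiff_fderiv_apply hφ' _).continuous).integrable_of_hasCompactSupport
          (hφc'.fderiv_apply ℝ _).mul_left
      have hi2 : ∀ j ∈ Finset.univ, Integrable (fun x => v j •
          (g (k + 1) (Fin.cons j i) x * (φ x : ℂ))) := by
        intro j _
        refine Integrable.smul (v j) ?_
        exact ((hg (k + 1) hk (Fin.cons j i)).1.mul hφ'.continuous).integrable_of_hasCompactSupport
          hφc'.mul_left
      have e1 : ∀ x, (fderiv ℝ φ x v) • partialDeriv i f x =
          ∑ j, v j • (partialDeriv i f x * fderiv ℝ (fun x => (φ x : ℂ)) x (stdVec j)) := by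
        intro x
        nth_rewrite 1 [← sum_smul_stdVec v]
        simp only [map_sum, map_smul, hφd, Finset.sum_smul, Complex.real_smul, smul_eq_mul]
        refine Finset.sum_congr rfl fun j _ => ?_
        push_cast; ring
      have e2 : ∀ x, φ x • G i x v = ∑ j, v j • (g (k + 1) (Fin.cons j i) x * (φ x : ℂ)) := by
        intro x
        simp only [G, _root_.sum_apply, ContinuousLinearMap.smulRight_apply, Finset.smul_sum,
          Complex.real_smul, hproj]
        refine Finset.sum_congr rfl fun j _ => ?_
        ring
      simp_rw [e1, e2]
      rw [integral_finsetSum _ hi1, integral_finsetSum _ hi2, ← Finset.sum_neg_distrib]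
      refine Finset.sum_congr rfl fun j _ => ?_
      rw [integral_smul, integral_smul, hj j, smul_neg]
    -- The full derivative of order `k` is a continuous linear function of its values on basis
    -- vectors, so it inherits `C¹` regularity from the partial derivatives.
    obtain ⟨S, hS⟩ := exists_multilinear_leftInverse d k
    have hiter : iteratedFDeriv ℝ k f = fun x => S (fun i => partialDeriv i f x) := by
      funext x; exact iteratedFDeriv_eq_of_partialDeriv hS f x
    have hC1 : ContDiff ℝ 1 (iteratedFDeriv ℝ k f) := by
      rw [hiter]
      refine S.contDiff.comp (contDiff_pi.2 fun i => ?_)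
      rw [contDiff_one_iff_fderiv]
      refine ⟨fun x => (hD i x).differentiableAt, ?_⟩
      have : fderiv ℝ (partialDeriv i f) = G i := funext fun x => (hD i x).fderiv
      rw [this]; exact hG i
    have hCk : ContDiff ℝ ((k + 1 : ℕ) : ℕ∞ω) f := by
      rw [contDiff_nat_iff_continuous_differentiable]
      constructor
      · intro m hm
        rcases Nat.le_succ_iff.1 hm with h | rfl
        · exact hC.continuous_iteratedFDeriv (by exact_mod_cast h)
        · rw [iteratedFDeriv_succ_eq_comp_left]
          exact (continuousMultilinearCurryLeftEquiv ℝ (fun _ : Fin (k + 1) => E d) ℂ).symm.continuous.comp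
            (hC1.continuous_fderiv (by simp))
      · intro m hm
        rcases Nat.lt_succ_iff_lt_or_eq.1 hm with h | rfl
        · exact hC.differentiable_iteratedFDeriv (by exact_mod_cast h)
        · exact hC1.differentiable (by simp)
    refine ⟨hCk, fun i => ?_⟩
    funext x
    obtain ⟨j, i', rfl⟩ : ∃ (j : Fin d) (i' : Fin k → Fin d), i = Fin.cons j i' :=
      ⟨i 0, Fin.tail i, (Fin.cons_self_tail i).symm⟩
    rw [partialDeriv_cons j i' (hC1.differentiable (by simp)), (hD i' x).fderiv]
    simp only [G, _root_.sum_apply, ContinuousLinearMap.smulRight_apply, hproj]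
    rw [Finset.sum_eq_single j]
    · simp
    · intro b _ hb; simp [hb]
    · simp

/-! ### Decay towards the complement of the orbit -/

theorem norm_partialDeriv_le_of_schwartzNorm {r m : ℕ} {f : E d → ℂ}
    (hf : schwartzNorm r m f < ⊤) {k : ℕ} (hk : k ≤ r) (i : Fin k → Fin d) (ξ : E d) :
    ‖partialDeriv i f ξ‖ ≤ (schwartzNorm r m f).toReal * ((1 + ‖ξ‖) ^ m)⁻¹ := by
  have h1 : ENNReal.ofReal ((1 + ‖ξ‖) ^ m * ‖partialDeriv i f ξ‖) ≤ schwartzNorm r m f :=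
    le_iSup_of_le ξ (le_iSup_of_le k (le_iSup_of_le hk (le_iSup_of_le i le_rfl)))
  have h2 : (1 + ‖ξ‖) ^ m * ‖partialDeriv i f ξ‖ ≤ (schwartzNorm r m f).toReal :=
    (ENNReal.ofReal_le_iff_le_toReal hf.ne).1 h1
  rw [← div_eq_mul_inv, le_div_iff₀ (by positivity), mul_comm]
  exact h2

/-- Passes from partial derivatives to operator norms of full derivatives. Summing the constants
over all orders up to `r` makes `B` uniform in `k`. -/
theorem exists_norm_iteratedFDeriv_le {r m : ℕ} {f : E d → ℂ} (hf : schwartzNorm r m f < ⊤) :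
    ∃ B : ℝ, 0 ≤ B ∧ ∀ k ≤ r, ∀ ξ, ‖iteratedFDeriv ℝ k f ξ‖ ≤ B * ((1 + ‖ξ‖) ^ m)⁻¹ := by
  choose S hS using exists_multilinear_leftInverse d
  set M := (schwartzNorm r m f).toReal with hM
  have hM0 : 0 ≤ M := ENNReal.toReal_nonneg
  refine ⟨∑ k ∈ Finset.range (r + 1), ‖S k‖ * M, by positivity, fun k hk ξ => ?_⟩
  rw [iteratedFDeriv_eq_of_partialDeriv (hS k)]
  have hξ : 0 ≤ ((1 + ‖ξ‖) ^ m)⁻¹ := by positivity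
  calc ‖S k (fun i => partialDeriv i f ξ)‖ ≤ ‖S k‖ * ‖fun i => partialDeriv i f ξ‖ :=
        (S k).le_opNorm _
    _ ≤ ‖S k‖ * (M * ((1 + ‖ξ‖) ^ m)⁻¹) := by
        gcongr
        exact (pi_norm_le_iff_of_nonneg (by positivity)).2
          fun i => norm_partialDeriv_le_of_schwartzNorm hf hk i ξ
    _ = ‖S k‖ * M * ((1 + ‖ξ‖) ^ m)⁻¹ := by ring
    _ ≤ _ := by
        gcongr
        exact Finset.single_le_sum (f := fun k => ‖S k‖ * M) (fun _ _ => by positivity)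
          (Finset.mem_range.2 (Nat.lt_succ_of_le hk))

/-- The nearest point of a closed cone is an orthogonal projection. -/
theorem exists_nearest_in_cone {C : Set (E d)} (hC : IsClosed C) (hne : C.Nonempty)
    (hcone : ∀ r : ℝ, ∀ x ∈ C, r • x ∈ C) (ξ : E d) :
    ∃ ζ ∈ C, ‖ξ - ζ‖ = Metric.infDist ξ C ∧ inner ℝ (ξ - ζ) ζ = 0 := by
  obtain ⟨ζ, hζ, hd⟩ := hC.exists_infDist_eq_dist hne ξ
  refine ⟨ζ, hζ, by rw [hd, dist_eq_norm], ?_⟩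
  set a : ℝ := inner ℝ (ξ - ζ) ζ with ha
  -- The competitor `(1 + ε) ζ` lies in the cone, hence is no closer to `ξ` than `ζ`.
  have hmin : ∀ ε : ℝ, ‖ξ - ζ‖ ^ 2 ≤ ‖ξ - ζ‖ ^ 2 - 2 * ε * a + ε ^ 2 * ‖ζ‖ ^ 2 := by
    intro ε
    have h1 : Metric.infDist ξ C ≤ dist ξ ((1 + ε) • ζ) :=
      Metric.infDist_le_dist_of_mem (hcone _ _ hζ)
    rw [hd, dist_eq_norm, dist_eq_norm] at h1
    have h2 : ξ - (1 + ε) • ζ = (ξ - ζ) - ε • ζ := by rw [add_smul, one_smul]; abel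
    rw [h2] at h1
    have h3 := pow_le_pow_left₀ (norm_nonneg _) h1 2
    rw [norm_sub_sq_real (ξ - ζ) (ε • ζ), inner_smul_right, norm_smul, mul_pow, Real.norm_eq_abs,
      sq_abs] at h3
    rw [ha]; linarith
  by_contra hne0
  have hζ0 : 0 < ‖ζ‖ ^ 2 := by
    have : ζ ≠ 0 := fun h => hne0 (by rw [ha, h, inner_zero_right])
    positivity
  -- This `ε` minimises the quadratic, and its value falls below `‖ξ - ζ‖²` unless `a = 0`.
  have h := hmin (a / ‖ζ‖ ^ 2)
  have e : ‖ξ - ζ‖ ^ 2 - 2 * (a / ‖ζ‖ ^ 2) * a + (a / ‖ζ‖ ^ 2) ^ 2 * ‖ζ‖ ^ 2 =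
      ‖ξ - ζ‖ ^ 2 - a ^ 2 / ‖ζ‖ ^ 2 := by field_simp; ring
  rw [e] at h
  have : 0 < a ^ 2 / ‖ζ‖ ^ 2 := by positivity
  linarith

theorem envelope_nonneg (O : Set (E d)) (ξ : E d) : 0 ≤ envelope O ξ :=
  le_min (div_nonneg Metric.infDist_nonneg (by positivity)) (by positivity)

theorem envelope_le_one (O : Set (E d)) (ξ : E d) : envelope O ξ ≤ 1 := by
  refine (min_le_right _ _).trans ?_
  rw [div_le_one (by positivity)]
  linarith [norm_nonneg ξ]

theorem continuous_envelope (O : Set (E d)) : Continuous (envelope O) := by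
  unfold envelope
  have h1 : Continuous (fun ξ : E d => Metric.infDist ξ Oᶜ) := Metric.continuous_infDist_pt _
  refine Continuous.min (h1.div ?_ fun ξ => ?_) (continuous_const.div ?_ fun ξ => ?_)
  · exact continuous_const.add ((continuous_norm.pow 2).sub (h1.pow 2)).sqrt
  · positivity
  · exact continuous_const.add continuous_norm
  · positivity

/-- All derivatives of order below `t` vanish at the nearest point `ζ` of the cone. Orthogonality
keeps the segment from `ζ` to `ξ` outside the open ball of radius `‖ζ‖`, so the decay factor there
is at most `(1 + ‖ζ‖)^(-t)`. The second term of the minimum in `envelope` comes from the decay at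
`ξ` itself. -/
theorem norm_iteratedFDeriv_le_envelope {O : Set (E d)} (hC : IsClosed Oᶜ) (hne : Oᶜ.Nonempty)
    (hcone : ∀ r : ℝ, ∀ x ∈ Oᶜ, r • x ∈ Oᶜ) {f : E d → ℂ} {t : ℕ} (hf : ContDiff ℝ t f)
    {B : ℝ} (hB0 : 0 ≤ B) (hB : ∀ k ≤ t, ∀ ξ, ‖iteratedFDeriv ℝ k f ξ‖ ≤ B * ((1 + ‖ξ‖) ^ t)⁻¹)
    (hz : ∀ k < t, ∀ ξ ∈ Oᶜ, iteratedFDeriv ℝ k f ξ = 0) {k : ℕ} (hk : k ≤ t) (ξ : E d) :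
    ‖iteratedFDeriv ℝ k f ξ‖ ≤ B * envelope O ξ ^ (t - k) := by
  obtain ⟨ζ, hζ, hdist, horth⟩ := exists_nearest_in_cone hC hne hcone ξ
  set D := Metric.infDist ξ Oᶜ with hD
  have hD0 : 0 ≤ D := Metric.infDist_nonneg
  have hξ : ‖ξ‖ ^ 2 = D ^ 2 + ‖ζ‖ ^ 2 := by
    have e : ξ = (ξ - ζ) + ζ := by abel
    rw [e, norm_add_sq_real, horth, ← hdist]; ring
  set ρ := 1 + √(‖ξ‖ ^ 2 - D ^ 2) with hρ
  have hρζ : ρ = 1 + ‖ζ‖ := by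
    rw [hρ, hξ, add_sub_cancel_left, Real.sqrt_sq (norm_nonneg _)]
  have hρ1 : 1 ≤ ρ := by rw [hρζ]; linarith [norm_nonneg ζ]
  have hρ0 : 0 < ρ := by linarith
  have hseg : ∀ z ∈ segment ℝ ζ ξ, ρ ≤ 1 + ‖z‖ ∧ ‖z - ζ‖ ≤ D := by
    intro z hz
    rw [segment_eq_image'] at hz
    obtain ⟨τ, ⟨h0, h1⟩, rfl⟩ := hz
    constructor
    · have h2 : ‖ζ‖ ^ 2 ≤ ‖ζ + τ • (ξ - ζ)‖ ^ 2 := by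
        rw [norm_add_sq_real, inner_smul_right, real_inner_comm, horth]
        nlinarith [sq_nonneg ‖τ • (ξ - ζ)‖]
      have := (pow_le_pow_iff_left₀ (norm_nonneg _) (norm_nonneg _) two_ne_zero).1 h2
      rw [hρζ]; simpa using this
    · simp only [add_sub_cancel_left, norm_smul, Real.norm_eq_abs, abs_of_nonneg h0, hdist]
      nlinarith
  -- Descending induction on the order: at order `t` only the decay is used, and each lower order
  -- gains a factor `D` by the mean value inequality starting from `ζ`.
  have hmain : ∀ n : ℕ, ∀ k : ℕ, k + n = t → ∀ z ∈ segment ℝ ζ ξ,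
      ‖iteratedFDeriv ℝ k f z‖ ≤ B * (ρ ^ t)⁻¹ * D ^ n := by
    intro n
    induction n with
    | zero =>
      intro k hk z hz
      have h1 := hB k (by omega) z
      rw [pow_zero, mul_one]
      refine h1.trans ?_
      have := (hseg z hz).1
      gcongr
    | succ n ih =>
      intro k hk z hz'
      have hkt : k < t := by omega
      have hdiff : Differentiable ℝ (iteratedFDeriv ℝ k f) :=
        hf.differentiable_iteratedFDeriv (by exact_mod_cast hkt)
      have := (convex_segment ζ ξ).norm_image_sub_le_of_norm_fderiv_le (𝕜 := ℝ)
        (C := B * (ρ ^ t)⁻¹ * D ^ n) (fun x _ => hdiff x)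
        (fun x hx => by
          rw [norm_fderiv_iteratedFDeriv]
          exact ih (k + 1) (by omega) x hx) (left_mem_segment ℝ ζ ξ) hz'
      rw [hz k hkt ζ hζ, sub_zero] at this
      refine this.trans ?_
      rw [pow_succ, ← mul_assoc]
      gcongr
      exact (hseg z hz').2
  have hle1 : ‖iteratedFDeriv ℝ k f ξ‖ ≤ B * (D / ρ) ^ (t - k) := by
    refine (hmain (t - k) k (by omega) ξ (right_mem_segment ℝ ζ ξ)).trans ?_
    rw [div_pow, div_eq_inv_mul, mul_assoc]
    gcongr
    exact Nat.sub_le t k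
  have hle2 : ‖iteratedFDeriv ℝ k f ξ‖ ≤ B * (1 / (1 + ‖ξ‖)) ^ (t - k) := by
    refine (hB k hk ξ).trans ?_
    rw [one_div, inv_pow]
    gcongr
    · linarith [norm_nonneg ξ]
    · exact Nat.sub_le t k
  rw [envelope]
  rcases min_choice (D / ρ) (1 / (1 + ‖ξ‖)) with h | h
  · rw [← hD, ← hρ, h]; exact hle1
  · rw [← hD, ← hρ, h]; exact hle2

/-! ### Fourier inversion and the wavelet transform -/

theorem continuous_fourierInv {g : E d → ℂ} (hg : Integrable g) : Continuous (𝓕⁻ g) := by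
  have h : Continuous (𝓕 g) := by
    have := Real.contDiff_fourier (f := g) (N := 0) (fun n hn => by
      have : n = 0 := by simpa using hn
      subst this; simpa using hg.norm)
    exact this.continuous
  have e : 𝓕⁻ g = fun y => 𝓕 g (-y) := by funext y; rw [Real.fourierInv_eq_fourier_neg]
  rw [e]; exact h.comp continuous_neg

theorem continuous_fourier {g : E d → ℂ} (hg : Integrable g) : Continuous (𝓕 g) := by
  have e : 𝓕 g = fun y => 𝓕⁻ g (-y) := by
    funext y; rw [Real.fourierInv_eq_fourier_neg, neg_neg]
  rw [e]; exact (continuous_fourierInv hg).comp continuous_neg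

theorem norm_fourier_le_integral (g : E d → ℂ) (y : E d) : ‖𝓕 g y‖ ≤ ∫ x, ‖g x‖ :=
  VectorFourier.norm_fourierIntegral_le_integral_norm _ _ _ _ _

theorem norm_fourierInv_le_integral (g : E d → ℂ) (y : E d) : ‖𝓕⁻ g y‖ ≤ ∫ x, ‖g x‖ := by
  rw [Real.fourierInv_eq_fourier_neg]; exact norm_fourier_le_integral g _

/-- No continuity of `ψ` is available, so both sides are compared as distributions, with Parseval's
relation used once for each order of `ψ` and the test function. -/
theorem ae_eq_fourierInv_fourier {ψ : E d → ℂ} (hψ : Integrable ψ) (hψ' : Integrable (𝓕 ψ)) :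
    ψ =ᵐ[volume] 𝓕⁻ (𝓕 ψ) := by
  refine ae_eq_of_integral_contDiff_smul_eq hψ.locallyIntegrable
    (continuous_fourierInv hψ').locallyIntegrable fun φ hφ hφc => ?_
  let Φ : SchwartzMap (E d) ℂ := HasCompactSupport.toSchwartzMap (f := fun x => (φ x : ℂ))
    (hφc.comp_left Complex.ofReal_zero) (Complex.ofRealCLM.contDiff.comp hφ)
  have hΦ : ∀ x, Φ x = (φ x : ℂ) := fun x => rfl
  have h1 := integral_conj_fourier_mul hψ (𝓕 Φ).integrable
  have h2 := integral_conj_fourier_mul Φ.integrable hψ'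
  have e1 : 𝓕⁻ ((𝓕 Φ : SchwartzMap (E d) ℂ) : E d → ℂ) = Φ := by
    rw [← SchwartzMap.fourierInv_coe, FourierTransform.fourierInv_fourier_eq]
  rw [e1] at h1
  have h3 := congrArg (starRingEnd ℂ) h1
  rw [← integral_conj, ← integral_conj] at h3
  simp only [map_mul, Complex.conj_conj, hΦ, Complex.conj_ofReal, SchwartzMap.fourier_coe] at h2 h3
  simp only [Complex.real_smul]
  rw [← h2]
  simp_rw [mul_comm (φ _ : ℂ)]
  rw [← h3]
  congr 1; funext x; ring

/-- By inversion `ψ` is essentially bounded, and a bounded integrable function is square-integrable.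
-/
theorem memLp_two_of_integrable_fourier {ψ : E d → ℂ} (hψ : Integrable ψ)
    (hψ' : Integrable (𝓕 ψ)) : MemLp ψ 2 volume := by
  rw [memLp_two_iff_integrable_sq_norm hψ.aestronglyMeasurable]
  refine (hψ.norm.const_mul (∫ x, ‖𝓕 ψ x‖)).mono' (hψ.aestronglyMeasurable.norm.pow 2) ?_
  filter_upwards [ae_eq_fourierInv_fourier hψ hψ'] with x hx
  rw [Real.norm_eq_abs, abs_of_nonneg (by positivity), sq]
  gcongr
  rw [hx]; exact norm_fourierInv_le_integral _ _

theorem quasiRegFun_congr_ae (x : E d) (h : GL (Fin d) ℝ) {f g : E d → ℂ}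
    (hfg : f =ᵐ[volume] g) : quasiRegFun x h f =ᵐ[volume] quasiRegFun x h g := by
  have h0 : (((h⁻¹ : GL (Fin d) ℝ) : Matrix (Fin d) (Fin d) ℝ)).det ≠ 0 :=
    (Matrix.isUnits_det_units h⁻¹).ne_zero
  have hq : Measure.QuasiMeasurePreserving
      (act ((h⁻¹ : GL (Fin d) ℝ) : Matrix (Fin d) (Fin d) ℝ)) volume (volume : Measure (E d)) := by
    refine ⟨(continuous_act _).measurable, ?_⟩
    rw [map_act_volume h0]
    exact Measure.smul_absolutelyContinuous
  have hq2 := hq.comp (measurePreserving_sub_right (volume : Measure (E d)) x).quasiMeasurePreserving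
  filter_upwards [hq2.ae hfg] with y hy
  simp only [Function.comp_apply] at hy
  simp only [quasiRegFun, hy]

/-- The product of `F` with the complex conjugate of its translate under the dual action. -/
noncomputable def correl (F : E d → ℂ) (h : GL (Fin d) ℝ) (ξ : E d) : ℂ :=
  (starRingEnd ℂ) (F (dualAct h ξ)) * F ξ

/-- Parseval moves the inner product to frequency. There the translation by `x` becomes the
character of an inverse Fourier integral at `x`. -/
theorem wavelet_eq_fourierInv (H : Subgroup (GL (Fin d) ℝ)) {ψ : E d → ℂ} (hψ : Integrable ψ)
    (hψ' : Integrable (𝓕 ψ)) (hψ2 : MemLp ψ 2 volume) (p : E d × H) :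
    wavelet H (hψ2.toLp ψ) (hψ2.toLp ψ) p =
      ((absDet (p.2 : GL (Fin d) ℝ) ^ (1 / 2 : ℝ) : ℝ) : ℂ) *
        𝓕⁻ (correl (𝓕 ψ) (p.2 : GL (Fin d) ℝ)) p.1 := by
  obtain ⟨x, h⟩ := p
  rw [wavelet, quasiReg, inner_toLp_left]
  have e1 : ∫ y, (starRingEnd ℂ) (quasiRegFun x (h : GL (Fin d) ℝ) (hψ2.toLp ψ) y) *
      hψ2.toLp ψ y = ∫ y, (starRingEnd ℂ) (quasiRegFun x (h : GL (Fin d) ℝ) ψ y) *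
        𝓕⁻ (𝓕 ψ) y := by
    refine integral_congr_ae ?_
    filter_upwards [hψ2.coeFn_toLp, quasiRegFun_congr_ae x (h : GL (Fin d) ℝ) hψ2.coeFn_toLp,
      ae_eq_fourierInv_fourier hψ hψ'] with y h1 h2 h3
    rw [h2, h1, ← h3]
  rw [e1, ← integral_conj_fourier_mul (integrable_quasiRegFun x h hψ) hψ', Real.fourierInv_eq,
    ← integral_const_mul]
  congr 1; funext ξ
  rw [fourier_quasiRegFun, correl, real_inner_comm, AddChar.map_neg_eq_inv, Circle.smul_def,
    smul_eq_mul]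
  simp only [map_mul, Complex.conj_ofReal, Circle.coe_inv_eq_conj, Complex.conj_conj]
  ring

/-! ### Weighted decay of the wavelet transform -/

/-- A submultiplicative measure of the size of `h`. -/
noncomputable def opSize (h : GL (Fin d) ℝ) : ℝ := 1 + ‖actCLM (h : Matrix (Fin d) (Fin d) ℝ)ᵀ‖

theorem one_le_opSize (h : GL (Fin d) ℝ) : 1 ≤ opSize h := by
  unfold opSize; linarith [norm_nonneg (actCLM (h : Matrix (Fin d) (Fin d) ℝ)ᵀ)]

theorem opSize_mul_le (g h : GL (Fin d) ℝ) : opSize (g * h) ≤ opSize g * opSize h := by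
  unfold opSize
  rw [Units.val_mul, Matrix.transpose_mul, actCLM_mul]
  have := norm_mul_le (actCLM (h : Matrix (Fin d) (Fin d) ℝ)ᵀ)
    (actCLM (g : Matrix (Fin d) (Fin d) ℝ)ᵀ)
  nlinarith [norm_nonneg (actCLM (h : Matrix (Fin d) (Fin d) ℝ)ᵀ),
    norm_nonneg (actCLM (g : Matrix (Fin d) (Fin d) ℝ)ᵀ)]

theorem contDiff_correl {F : E d → ℂ} {n : ℕ∞ω} (hF : ContDiff ℝ n F) (h : GL (Fin d) ℝ) :
    ContDiff ℝ n (correl F h) :=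
  (Complex.conjCLE.contDiff.comp (hF.comp (actCLM _).contDiff)).mul hF

/-- Leibniz rule, with powers of `‖h^T‖` from the chain rule. The majorant `b` is arbitrary because
two are needed: polynomial decay, for integrability, and the orbit envelope, for the final estimate.
-/
theorem norm_iteratedFDeriv_correl_le {F : E d → ℂ} {m : ℕ} (hF : ContDiff ℝ m F)
    {b : E d → ℝ} (hb0 : ∀ ξ, 0 ≤ b ξ) (hb : ∀ k ≤ m, ∀ ξ, ‖iteratedFDeriv ℝ k F ξ‖ ≤ b ξ)
    (h : GL (Fin d) ℝ) {k : ℕ} (hk : k ≤ m) (ξ : E d) :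
    ‖iteratedFDeriv ℝ k (correl F h) ξ‖ ≤ 2 ^ m * opSize h ^ m * (b (dualAct h ξ) * b ξ) := by
  set T := actCLM (h : Matrix (Fin d) (Fin d) ℝ)ᵀ with hT
  have hFT : ContDiff ℝ m (F ∘ T) := hF.comp T.contDiff
  have hc : ContDiff ℝ m (fun ξ => (starRingEnd ℂ) (F (dualAct h ξ))) :=
    Complex.conjCLE.contDiff.comp hFT
  have hS := one_le_opSize h
  have h1 : ∀ i ≤ m, ‖iteratedFDeriv ℝ i (fun ξ => (starRingEnd ℂ) (F (dualAct h ξ))) ξ‖ ≤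
      opSize h ^ m * b (dualAct h ξ) := by
    intro i hi
    have e := Complex.conjLIE.norm_iteratedFDeriv_comp_left (𝕜 := ℝ) (F ∘ T) ξ i
    have e' : (Complex.conjLIE ∘ (F ∘ T)) = fun ξ => (starRingEnd ℂ) (F (dualAct h ξ)) := rfl
    rw [e'] at e
    rw [e, T.iteratedFDeriv_comp_right hF ξ (by exact_mod_cast hi)]
    refine (ContinuousMultilinearMap.norm_compContinuousLinearMap_le _ _).trans ?_
    rw [Finset.prod_const, Finset.card_univ, Fintype.card_fin, mul_comm]
    have h2 : ‖T‖ ^ i ≤ opSize h ^ m := by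
      refine (pow_le_pow_left₀ (norm_nonneg _) (?_ : ‖T‖ ≤ opSize h) i).trans
        (pow_le_pow_right₀ hS hi)
      unfold opSize; linarith
    exact mul_le_mul h2 (hb i hi _) (norm_nonneg _) (by positivity)
  refine (norm_iteratedFDeriv_mul_le hc hF ξ (by exact_mod_cast hk)).trans ?_
  have hb1 := hb0 (dualAct h ξ)
  have hb2 := hb0 ξ
  calc ∑ i ∈ Finset.range (k + 1), (k.choose i : ℝ) *
        ‖iteratedFDeriv ℝ i (fun ξ => (starRingEnd ℂ) (F (dualAct h ξ))) ξ‖ *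
          ‖iteratedFDeriv ℝ (k - i) F ξ‖
      ≤ ∑ i ∈ Finset.range (k + 1), (k.choose i : ℝ) *
        (opSize h ^ m * b (dualAct h ξ)) * b ξ := by
        refine Finset.sum_le_sum fun i hi => ?_
        have hi' : i ≤ k := Nat.lt_succ_iff.1 (Finset.mem_range.1 hi)
        have := h1 i (hi'.trans hk)
        have := hb (k - i) ((Nat.sub_le k i).trans hk) ξ
        gcongr
    _ = 2 ^ k * opSize h ^ m * (b (dualAct h ξ) * b ξ) := by
        rw [← Finset.sum_mul, ← Finset.sum_mul]
        have := Nat.sum_range_choose k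
        have h3 : ∑ i ∈ Finset.range (k + 1), (k.choose i : ℝ) = 2 ^ k := by exact_mod_cast this
        rw [h3]; ring
    _ ≤ _ := by
        gcongr
        norm_num

/-- Decay of the inverse Fourier transform in terms of integrals of derivatives. -/
theorem one_add_norm_pow_mul_norm_fourierInv_le {u : E d → ℂ} {m : ℕ} (hu : ContDiff ℝ m u)
    (hi : ∀ k ≤ m, Integrable (iteratedFDeriv ℝ k u)) (x : E d) :
    (1 + ‖x‖) ^ m * ‖𝓕⁻ u x‖ ≤
      2 ^ m * (2 ^ m + 1) * ∑ k ∈ Finset.range (m + 1), ∫ ξ, ‖iteratedFDeriv ℝ k u ξ‖ := by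
  rw [Real.fourierInv_eq_fourier_neg]
  set S := ∑ k ∈ Finset.range (m + 1), ∫ ξ, ‖iteratedFDeriv ℝ k u ξ‖ with hS
  have hS0 : 0 ≤ S := Finset.sum_nonneg fun _ _ => integral_nonneg fun _ => norm_nonneg _
  have h1 : ‖𝓕 u (-x)‖ ≤ S := by
    refine (norm_fourier_le_integral u (-x)).trans ?_
    have := Finset.single_le_sum (f := fun k => ∫ ξ, ‖iteratedFDeriv ℝ k u ξ‖)
      (fun _ _ => integral_nonneg fun _ => norm_nonneg _)
      (Finset.mem_range.2 (Nat.succ_pos m) : 0 ∈ Finset.range (m + 1))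
    simpa using this
  have h2 : ‖x‖ ^ m * ‖𝓕 u (-x)‖ ≤ 2 ^ m * S := by
    have := Real.pow_mul_norm_iteratedFDeriv_fourier_le (f := u) (K := 0) (N := m) hu
      (fun k n hk hn => by
        have hk0 : k = 0 := by simpa using hk
        subst hk0
        simpa using (hi n (by exact_mod_cast hn)).norm) (k := 0) (n := m) le_rfl le_rfl (-x)
    simpa [Finset.sum_product] using this
  have h3 : (1 + ‖x‖) ^ m ≤ 2 ^ m * (1 + ‖x‖ ^ m) := by
    rcases le_total ‖x‖ 1 with hx | hx
    · calc (1 + ‖x‖) ^ m ≤ (2 : ℝ) ^ m := by gcongr; linarith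
        _ ≤ 2 ^ m * (1 + ‖x‖ ^ m) := le_mul_of_one_le_right (by positivity)
            (by linarith [pow_nonneg (norm_nonneg x) m])
    · calc (1 + ‖x‖) ^ m ≤ (2 * ‖x‖) ^ m := by gcongr; linarith
        _ = 2 ^ m * ‖x‖ ^ m := mul_pow _ _ _
        _ ≤ 2 ^ m * (1 + ‖x‖ ^ m) := by gcongr; linarith
  calc (1 + ‖x‖) ^ m * ‖𝓕 u (-x)‖ ≤ 2 ^ m * (1 + ‖x‖ ^ m) * ‖𝓕 u (-x)‖ := by gcongr
    _ = 2 ^ m * (‖x‖ ^ m * ‖𝓕 u (-x)‖ + ‖𝓕 u (-x)‖) := by ring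
    _ ≤ 2 ^ m * (2 ^ m * S + S) := by gcongr
    _ = _ := by ring

/-- The envelope bounding the derivatives of a function with vanishing moments. -/
noncomputable def orbitBound (O : Set (E d)) (ℓ : ℕ) : E d → ℝ :=
  O.indicator (fun ξ => envelope O ξ ^ ℓ)

theorem orbitBound_nonneg (O : Set (E d)) (ℓ : ℕ) (ξ : E d) : 0 ≤ orbitBound O ℓ ξ :=
  Set.indicator_nonneg (fun _ _ => pow_nonneg (envelope_nonneg _ _) _) _

theorem measurable_orbitBound {O : Set (E d)} (hO : IsOpen O) (ℓ : ℕ) :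
    Measurable (orbitBound O ℓ) :=
  ((continuous_envelope O).pow ℓ).measurable.indicator hO.measurableSet

/-- Decay of order `m` in `x` costs `m` derivatives in frequency, after which at least `t - m ≥ ℓ`
powers of the envelope remain. The bound is kept in `[0,∞]` because no finiteness of the correlation
integral for an individual `h` has been established. -/
theorem ofReal_fourierInv_correl_le {O : Set (E d)} {F : E d → ℂ} {m t ℓ : ℕ}
    (hmt : m < t) (hdt : d < t) (hℓ : ℓ ≤ t - m) (hF : ContDiff ℝ t F) {B : ℝ} (hB0 : 0 ≤ B)
    (hB : ∀ k ≤ t, ∀ ξ, ‖iteratedFDeriv ℝ k F ξ‖ ≤ B * ((1 + ‖ξ‖) ^ t)⁻¹)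
    (hz : ∀ k < t, ∀ ξ ∈ Oᶜ, iteratedFDeriv ℝ k F ξ = 0)
    (he : ∀ k ≤ t, ∀ ξ, ‖iteratedFDeriv ℝ k F ξ‖ ≤ B * envelope O ξ ^ (t - k)) :
    ∃ K : ℝ, 0 ≤ K ∧ ∀ (h : GL (Fin d) ℝ) (x : E d),
      ENNReal.ofReal ((1 + ‖x‖) ^ m * ‖𝓕⁻ (correl F h) x‖) ≤
        ENNReal.ofReal (K * opSize h ^ m) *
          ∫⁻ ξ, ENNReal.ofReal (orbitBound O ℓ ξ) * ENNReal.ofReal (orbitBound O ℓ (dualAct h ξ)) := by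
  have hFm : ContDiff ℝ m F := hF.of_le (by exact_mod_cast hmt.le)
  have hb : ∀ k ≤ m, ∀ ξ, ‖iteratedFDeriv ℝ k F ξ‖ ≤ B * orbitBound O ℓ ξ := by
    intro k hk ξ
    -- Off `O` the envelope is zero, but for `ℓ = 0` its power is `1`; the indicator in `orbitBound`
    -- is justified there by the vanishing of the derivatives of order `k ≤ m < t`.
    by_cases hξ : ξ ∈ O
    · rw [orbitBound, Set.indicator_of_mem hξ]
      refine (he k (hk.trans hmt.le) ξ).trans ?_
      refine mul_le_mul_of_nonneg_left ?_ hB0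
      exact pow_le_pow_of_le_one (envelope_nonneg _ _) (envelope_le_one _ _) (by omega)
    · rw [hz k (hk.trans_lt hmt) ξ hξ, norm_zero]
      exact mul_nonneg hB0 (orbitBound_nonneg _ _ _)
  refine ⟨2 ^ m * (2 ^ m + 1) * ((m + 1 : ℕ) * (2 ^ m * B ^ 2)), by positivity, fun h x => ?_⟩
  have hu := contDiff_correl hFm h
  have hS := one_le_opSize h
  have hint : ∀ k ≤ m, Integrable (iteratedFDeriv ℝ k (correl F h)) := by
    intro k hk
    have hdom : Integrable (fun ξ : E d => (2 ^ m * opSize h ^ m * B ^ 2) * (1 + ‖ξ‖) ^ (-(t : ℝ))) :=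
      (integrable_one_add_norm (by rw [finrank_euclideanSpace_fin]; exact_mod_cast hdt)).const_mul _
    refine hdom.mono' (hu.continuous_iteratedFDeriv (by exact_mod_cast hk)).aestronglyMeasurable
      (Filter.Eventually.of_forall fun ξ => ?_)
    have h1 := norm_iteratedFDeriv_correl_le hFm (b := fun ξ => B * ((1 + ‖ξ‖) ^ t)⁻¹)
      (fun ξ => by positivity) (fun k hk ξ => hB k (hk.trans hmt.le) ξ) h hk ξ
    refine h1.trans ?_
    rw [Real.rpow_neg (by positivity), Real.rpow_natCast]
    have h2 : ((1 + ‖dualAct h ξ‖) ^ t)⁻¹ ≤ 1 :=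
      inv_le_one_of_one_le₀ (one_le_pow₀ (by linarith [norm_nonneg (dualAct h ξ)]))
    calc 2 ^ m * opSize h ^ m * (B * ((1 + ‖dualAct h ξ‖) ^ t)⁻¹ * (B * ((1 + ‖ξ‖) ^ t)⁻¹))
        ≤ 2 ^ m * opSize h ^ m * (B * 1 * (B * ((1 + ‖ξ‖) ^ t)⁻¹)) := by gcongr
      _ = _ := by ring
  set I := ∫⁻ ξ, ENNReal.ofReal (orbitBound O ℓ ξ) * ENNReal.ofReal (orbitBound O ℓ (dualAct h ξ))
    with hI
  have hk : ∀ k ∈ Finset.range (m + 1), ENNReal.ofReal (∫ ξ, ‖iteratedFDeriv ℝ k (correl F h) ξ‖) ≤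
      ENNReal.ofReal (2 ^ m * opSize h ^ m * B ^ 2) * I := by
    intro k hk
    have hk' : k ≤ m := Nat.lt_succ_iff.1 (Finset.mem_range.1 hk)
    rw [ofReal_integral_norm_eq_lintegral_enorm (hint k hk'), hI, ← lintegral_const_mul']
    · refine lintegral_mono fun ξ => ?_
      rw [← ENNReal.ofReal_mul (orbitBound_nonneg _ _ _), ← ENNReal.ofReal_mul (by positivity),
        ← ofReal_norm]
      refine ENNReal.ofReal_le_ofReal ?_
      refine (norm_iteratedFDeriv_correl_le hFm (b := fun ξ => B * orbitBound O ℓ ξ)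
        (fun ξ => mul_nonneg hB0 (orbitBound_nonneg _ _ _)) hb h hk' ξ).trans (le_of_eq ?_)
      ring
    · exact ENNReal.ofReal_ne_top
  calc ENNReal.ofReal ((1 + ‖x‖) ^ m * ‖𝓕⁻ (correl F h) x‖)
      ≤ ENNReal.ofReal (2 ^ m * (2 ^ m + 1) *
          ∑ k ∈ Finset.range (m + 1), ∫ ξ, ‖iteratedFDeriv ℝ k (correl F h) ξ‖) :=
        ENNReal.ofReal_le_ofReal (one_add_norm_pow_mul_norm_fourierInv_le hu hint x)
    _ = ENNReal.ofReal (2 ^ m * (2 ^ m + 1)) * ∑ k ∈ Finset.range (m + 1),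
          ENNReal.ofReal (∫ ξ, ‖iteratedFDeriv ℝ k (correl F h) ξ‖) := by
        rw [ENNReal.ofReal_mul (by positivity), ENNReal.ofReal_sum_of_nonneg
          (fun _ _ => integral_nonneg fun _ => norm_nonneg _)]
    _ ≤ ENNReal.ofReal (2 ^ m * (2 ^ m + 1)) * ∑ k ∈ Finset.range (m + 1),
          ENNReal.ofReal (2 ^ m * opSize h ^ m * B ^ 2) * I := by
        gcongr with k hk'
        exact hk k hk'
    _ = _ := by
        rw [Finset.sum_const, Finset.card_range, nsmul_eq_mul, ← mul_assoc, ← mul_assoc,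
          ← ENNReal.ofReal_natCast, ← ENNReal.ofReal_mul (by positivity),
          ← ENNReal.ofReal_mul (by positivity)]
        congr 2
        ring

section

open scoped Pointwise

/-! ### Lebesgue measure on the orbit -/

instance : SecondCountableTopology (GL (Fin d) ℝ) := by
  have : SecondCountableTopology (Matrix (Fin d) (Fin d) ℝ) :=
    inferInstanceAs (SecondCountableTopology (Fin d → Fin d → ℝ))
  have : SecondCountableTopology (Matrix (Fin d) (Fin d) ℝ)ᵐᵒᵖ :=
    MulOpposite.opHomeomorph.symm.secondCountableTopology
  exact (Units.isEmbedding_embedProduct (M := Matrix (Fin d) (Fin d) ℝ)).secondCountableTopology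

instance (H : Subgroup (GL (Fin d) ℝ)) : SecondCountableTopology H :=
  inferInstanceAs (SecondCountableTopology (H : Set (GL (Fin d) ℝ)))

theorem locallyCompactSpace_of_isClosed {H : Subgroup (GL (Fin d) ℝ)}
    (hH : IsClosed (H : Set (GL (Fin d) ℝ))) : LocallyCompactSpace H := by
  have : LocallyCompactSpace (Matrix (Fin d) (Fin d) ℝ) :=
    inferInstanceAs (LocallyCompactSpace (Fin d → Fin d → ℝ))
  have : LocallyCompactSpace (GL (Fin d) ℝ) :=
    inferInstanceAs (LocallyCompactSpace (Matrix (Fin d) (Fin d) ℝ)ˣ)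
  exact hH.isClosedEmbedding_subtypeVal.locallyCompactSpace

/-- Right translations by elements of a compact set distort left Haar measure boundedly. -/
theorem exists_lintegral_mul_right_le {G : Type*} [Group G] [TopologicalSpace G]
    [IsTopologicalGroup G] [LocallyCompactSpace G] [SecondCountableTopology G] [MeasurableSpace G]
    [BorelSpace G] (μ : Measure G) [μ.IsHaarMeasure] {V : Set G} (hV : IsCompact V) :
    ∃ c : ℝ≥0∞, c ≠ ⊤ ∧ ∀ k ∈ V, ∀ f : G → ℝ≥0∞, Measurable f →
      ∫⁻ h, f (h * k) ∂μ ≤ c * ∫⁻ h, f h ∂μ := by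
  obtain ⟨W, hW, hW1⟩ := exists_compact_mem_nhds (1 : G)
  have hW0 : μ W ≠ 0 := (Measure.measure_pos_of_mem_nhds μ hW1).ne'
  have hWt : μ W ≠ ⊤ := hW.measure_lt_top.ne
  have hK : IsCompact (W * V⁻¹) := hW.mul hV.inv
  have hcl : MeasurableSet (closure W) := isClosed_closure.measurableSet
  -- The inclusion `W k⁻¹ ⊆ W V⁻¹` bounds the modular function on `V` by this ratio. Closures give
  -- measurable sets without a Hausdorff assumption.
  refine ⟨μ (closure (W * V⁻¹)) / μ (closure W), ?_, fun k hk f hf => ?_⟩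
  · refine ENNReal.div_ne_top hK.closure.measure_lt_top.ne ?_
    exact fun h => hW0 (measure_mono_null subset_closure h)
  · have h1 := Measure.map_right_mul_eq_modularCharacterFun_smul μ k
    set Δ := Measure.modularCharacterFun k with hΔ
    have hm : Measurable (fun h : G => h * k) := (continuous_mul_const k).measurable
    have h2 : (Δ : ℝ≥0∞) * μ (closure W) ≤ μ (closure (W * V⁻¹)) := by
      have e : (Measure.map (· * k) μ) (closure W) = (Δ : ℝ≥0∞) * μ (closure W) := by
        rw [h1]; rfl
      rw [← e, Measure.map_apply hm hcl]
      refine measure_mono fun h hh => ?_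
      have h3 : h * k ∈ closure W := hh
      have h4 : closure W ⊆ (fun g => g * k⁻¹) ⁻¹' closure (W * V⁻¹) := by
        refine closure_minimal (fun g hg => subset_closure ?_)
          (isClosed_closure.preimage (continuous_mul_const _))
        exact Set.mul_mem_mul hg (Set.inv_mem_inv.2 hk)
      have := h4 h3
      simpa using this
    have h5 : (Δ : ℝ≥0∞) ≤ μ (closure (W * V⁻¹)) / μ (closure W) := by
      rw [ENNReal.le_div_iff_mul_le]
      · exact h2
      · exact Or.inl fun h => hW0 (measure_mono_null subset_closure h)
      · exact Or.inl hW.closure.measure_lt_top.ne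
    calc ∫⁻ h, f (h * k) ∂μ = ∫⁻ h, f h ∂(Measure.map (· * k) μ) := (lintegral_map hf hm).symm
      _ = (Δ : ℝ≥0∞) * ∫⁻ h, f h ∂μ := by rw [h1]; exact lintegral_smul_measure _ _
      _ ≤ _ := by gcongr

variable {H : Subgroup (GL (Fin d) ℝ)} [MeasurableSpace H] [BorelSpace H]

omit [MeasurableSpace H] [BorelSpace H] in
theorem continuous_dualAct_prod :
    Continuous (fun p : H × E d => dualAct (p.1 : GL (Fin d) ℝ) p.2) := by
  have h1 : Continuous (fun p : H × E d => (p.1 : GL (Fin d) ℝ)) :=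
    continuous_subtype_val.comp continuous_fst
  have h2 : Continuous (fun p : H × E d => ((p.1 : GL (Fin d) ℝ), p.2)) :=
    Continuous.prodMk h1 continuous_snd
  have h3 := continuous_dualAct₂.comp h2
  exact h3

theorem measurable_dualAct_prod :
    Measurable (fun p : H × E d => dualAct (p.1 : GL (Fin d) ℝ) p.2) :=
  continuous_dualAct_prod.measurable

theorem measurable_dualAct_inv_prod :
    Measurable (fun p : H × E d => dualAct (p.1 : GL (Fin d) ℝ)⁻¹ p.2) := by
  have h1 : Continuous (fun p : H × E d => (p.1⁻¹, p.2)) :=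
    Continuous.prodMk continuous_fst.inv continuous_snd
  have h2 := continuous_dualAct_prod.comp h1
  exact h2.measurable

omit [MeasurableSpace H] [BorelSpace H] in
theorem continuous_dualAct_left (ξ : E d) :
    Continuous (fun h : H => dualAct (h : GL (Fin d) ℝ) ξ) := by
  have h1 : Continuous (fun h : H => (h, ξ)) := Continuous.prodMk continuous_id continuous_const
  have h2 := continuous_dualAct_prod.comp h1
  exact h2

theorem measurable_dualAct_inv_left (ξ : E d) :
    Measurable (fun h : H => dualAct (h : GL (Fin d) ℝ)⁻¹ ξ) := by
  have h1 := (continuous_dualAct_left (H := H) ξ).comp continuous_inv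
  exact h1.measurable

omit [MeasurableSpace H] [BorelSpace H] in
theorem continuous_absDet_coe : Continuous (fun h : H => absDet (h : GL (Fin d) ℝ)) :=
  continuous_absDet.comp continuous_subtype_val

theorem lintegral_dualAct (h : GL (Fin d) ℝ) {f : E d → ℝ≥0∞} (hf : Measurable f) :
    ∫⁻ ξ, f (dualAct h ξ) = ENNReal.ofReal (absDet h)⁻¹ * ∫⁻ ξ, f ξ := by
  have := lintegral_comp_act (A := (h : Matrix (Fin d) (Fin d) ℝ)ᵀ)
    (by rw [Matrix.det_transpose]; exact (Matrix.isUnits_det_units h).ne_zero) hf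
  rw [Matrix.det_transpose] at this
  exact this

/-- Lebesgue measure on a dual orbit is dominated by the image of a weighted Haar measure. -/
theorem exists_lintegral_orbit_le (hcl : IsClosed (H : Set (GL (Fin d) ℝ)))
    (μ : Measure H) [μ.IsHaarMeasure] (ξ₀ : E d) :
    ∃ C : ℝ≥0∞, C ≠ ⊤ ∧ ∀ F : E d → ℝ≥0∞, Measurable F →
      ∀ O : Set (E d), (∀ ξ ∈ O, ∃ h ∈ H, ξ = dualAct h ξ₀) → MeasurableSet O →
      ∫⁻ ξ in O, F ξ ≤ C * ∫⁻ h : H, ENNReal.ofReal (absDet (h : GL (Fin d) ℝ))⁻¹ *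
        F (dualAct (h : GL (Fin d) ℝ)⁻¹ ξ₀) ∂μ := by
  have := locallyCompactSpace_of_isClosed hcl
  obtain ⟨V, hV, hV1⟩ := exists_compact_mem_nhds (1 : H)
  have hV0 : μ V ≠ 0 := (Measure.measure_pos_of_mem_nhds μ hV1).ne'
  have hVt : μ V ≠ ⊤ := hV.measure_lt_top.ne
  obtain ⟨c, hc, hc'⟩ := exists_lintegral_mul_right_le μ hV.inv
  set p : H → E d := fun h => dualAct (h : GL (Fin d) ℝ) ξ₀ with hp
  have hP : IsCompact (p '' V) := hV.image (continuous_dualAct_left ξ₀)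
  have hPm : MeasurableSet (p '' V) := hP.isClosed.measurableSet
  obtain ⟨c₁, hc₁⟩ : ∃ c₁ : ℝ, ∀ k ∈ V, (absDet (k : GL (Fin d) ℝ))⁻¹ ≤ c₁ := by
    have hcont : ContinuousOn (fun k : H => (absDet (k : GL (Fin d) ℝ))⁻¹) V :=
      (continuous_absDet_coe.inv₀ fun k => (absDet_pos _).ne').continuousOn
    obtain ⟨c₁, hc₁⟩ := hV.bddAbove_image hcont
    exact ⟨c₁, fun k hk => hc₁ ⟨k, hk, rfl⟩⟩
  refine ⟨volume (p '' V) * (ENNReal.ofReal c₁ * c) / μ V, ?_, fun F hF O hO hOm => ?_⟩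
  · exact ENNReal.div_ne_top (ENNReal.mul_ne_top hP.measure_lt_top.ne
      (ENNReal.mul_ne_top ENNReal.ofReal_ne_top hc)) hV0
  set J : H → ℝ≥0∞ := fun h => ENNReal.ofReal (absDet (h : GL (Fin d) ℝ))⁻¹ *
        F (dualAct (h : GL (Fin d) ℝ)⁻¹ ξ₀) with hJ
  have hdm : Measurable (fun h : H => ENNReal.ofReal (absDet (h : GL (Fin d) ℝ))⁻¹) :=
    (continuous_absDet_coe.inv₀ fun k => (absDet_pos _).ne').measurable.ennreal_ofReal
  have hJm : Measurable J := by
    exact hdm.mul (hF.comp (measurable_dualAct_inv_left ξ₀))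
  set u : E d → ℝ≥0∞ := (p '' V).indicator 1 with hu
  have hum : Measurable u := measurable_one.indicator hPm
  -- For `ξ = k^T ξ₀`, the set of `h` with `h^T ξ ∈ p(V)` contains `k⁻¹ V`, of measure `μ V` by left
  -- invariance. This smears the integral over `O` into a double integral.
  have hlow : μ V * ∫⁻ ξ in O, F ξ ≤
      ∫⁻ ξ in O, ∫⁻ h : H, F ξ * u (dualAct (h : GL (Fin d) ℝ) ξ) ∂μ := by
    rw [← lintegral_const_mul _ hF]
    refine setLIntegral_mono' hOm fun ξ hξ => ?_
    obtain ⟨k, hk, rfl⟩ := hO ξ hξ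
    have hum' : Measurable (fun h : H => u (dualAct (h : GL (Fin d) ℝ) (dualAct k ξ₀))) := by
      have h1 := hum.comp (continuous_dualAct_left (H := H) (dualAct k ξ₀)).measurable
      exact h1
    rw [lintegral_const_mul _ hum', mul_comm]
    gcongr
    have hsub : ∀ h : H, ((⟨k, hk⟩ : H)⁻¹ • V).indicator 1 h ≤
        u (dualAct (h : GL (Fin d) ℝ) (dualAct k ξ₀)) := by
      intro h
      by_cases hh : h ∈ (⟨k, hk⟩ : H)⁻¹ • V
      swap
      · rw [Set.indicator_of_notMem hh]; exact zero_le
      have hmem : dualAct (h : GL (Fin d) ℝ) (dualAct k ξ₀) ∈ p '' V := by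
        obtain ⟨g, hg, rfl⟩ := hh
        refine ⟨g, hg, ?_⟩
        change dualAct (g : GL (Fin d) ℝ) ξ₀ = dualAct (k⁻¹ * (g : GL (Fin d) ℝ)) (dualAct k ξ₀)
        rw [← dualAct_mul, mul_inv_cancel_left]
      rw [hu, Set.indicator_of_mem hh, Set.indicator_of_mem hmem]
      exact le_rfl
    calc μ V = μ ((⟨k, hk⟩ : H)⁻¹ • V) := (measure_smul _ _ _).symm
      _ = ∫⁻ h, ((⟨k, hk⟩ : H)⁻¹ • V).indicator 1 h ∂μ := by
          rw [lintegral_indicator_one]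
          exact (hV.smul _).isClosed.measurableSet
      _ ≤ _ := lintegral_mono hsub
  have hswap : ∫⁻ ξ in O, ∫⁻ h : H, F ξ * u (dualAct (h : GL (Fin d) ℝ) ξ) ∂μ =
      ∫⁻ h : H, (∫⁻ ξ in O, F ξ * u (dualAct (h : GL (Fin d) ℝ) ξ)) ∂μ := by
    refine lintegral_lintegral_swap (Measurable.aemeasurable ?_)
    have h1 := measurable_dualAct_prod.comp
      ((measurable_snd.prodMk measurable_fst : Measurable (fun p : E d × H => (p.2, p.1))))
    have h2 := hum.comp h1
    exact (hF.comp measurable_fst).mul h2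
  -- The substitution `η = h^T ξ` gives the factor `|det h|⁻¹` and confines `η` to the compact set
  -- `p(V)`.
  have hup1 : ∀ h : H, ∫⁻ ξ in O, F ξ * u (dualAct (h : GL (Fin d) ℝ) ξ) ≤
      ∫⁻ η in p '' V, ENNReal.ofReal (absDet (h : GL (Fin d) ℝ))⁻¹ *
        F (dualAct (h : GL (Fin d) ℝ)⁻¹ η) := by
    intro h
    have hFm : Measurable (fun η => F (dualAct (h : GL (Fin d) ℝ)⁻¹ η)) :=
      hF.comp (continuous_dualAct _).measurable
    have := lintegral_dualAct (h : GL (Fin d) ℝ)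
      (f := fun η => F (dualAct (h : GL (Fin d) ℝ)⁻¹ η) * u η) (hFm.mul hum)
    simp only [dualAct_inv_dualAct] at this
    refine (setLIntegral_le_lintegral _ _).trans ?_
    rw [this, lintegral_const_mul _ hFm]
    refine mul_le_mul_right (le_of_eq ?_) _
    rw [← lintegral_indicator hPm]
    congr 1; funext η
    by_cases hη : η ∈ p '' V <;> simp [u, hη]
  have hup2 : ∫⁻ h : H, (∫⁻ η in p '' V, ENNReal.ofReal (absDet (h : GL (Fin d) ℝ))⁻¹ *
        F (dualAct (h : GL (Fin d) ℝ)⁻¹ η)) ∂μ =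
      ∫⁻ η in p '' V, ∫⁻ h : H, ENNReal.ofReal (absDet (h : GL (Fin d) ℝ))⁻¹ *
        F (dualAct (h : GL (Fin d) ℝ)⁻¹ η) ∂μ := by
    refine lintegral_lintegral_swap (Measurable.aemeasurable ?_)
    have h1 := hF.comp (measurable_dualAct_inv_prod (H := H))
    exact (hdm.comp measurable_fst).mul h1
  -- For `η = k^T ξ₀` the integrand is `J` translated on the right by `k⁻¹`, up to a factor `|det
  -- k|⁻¹`; both effects are bounded for `k` in the compact set `V`.
  have hup3 : ∀ η ∈ p '' V, ∫⁻ h : H, ENNReal.ofReal (absDet (h : GL (Fin d) ℝ))⁻¹ *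
        F (dualAct (h : GL (Fin d) ℝ)⁻¹ η) ∂μ ≤ ENNReal.ofReal c₁ * c * ∫⁻ h, J h ∂μ := by
    rintro _ ⟨k, hk, rfl⟩
    have e : ∀ h : H, ENNReal.ofReal (absDet (h : GL (Fin d) ℝ))⁻¹ *
        F (dualAct (h : GL (Fin d) ℝ)⁻¹ (p k)) ≤ ENNReal.ofReal c₁ * J (h * k⁻¹) := by
      intro h
      have e1 : dualAct (h : GL (Fin d) ℝ)⁻¹ (p k) =
          dualAct ((h * k⁻¹ : H) : GL (Fin d) ℝ)⁻¹ ξ₀ := by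
        simp only [hp, Subgroup.coe_mul, Subgroup.coe_inv, mul_inv_rev, inv_inv, dualAct_mul]
      rw [hJ, e1]
      simp only
      rw [← mul_assoc, ← ENNReal.ofReal_mul ((inv_pos.2 (absDet_pos _)).le.trans (hc₁ k hk))]
      gcongr
      have e2 : (absDet (h : GL (Fin d) ℝ))⁻¹ = (absDet (k : GL (Fin d) ℝ))⁻¹ *
          (absDet ((h * k⁻¹ : H) : GL (Fin d) ℝ))⁻¹ := by
        rw [← mul_inv, Subgroup.coe_mul, absDet_mul, Subgroup.coe_inv, absDet_inv]
        have := (absDet_pos (k : GL (Fin d) ℝ)).ne'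
        field_simp
      rw [e2]
      exact mul_le_mul_of_nonneg_right (hc₁ k hk) (inv_pos.2 (absDet_pos _)).le
    refine (lintegral_mono e).trans ?_
    have hJk : Measurable (fun h => J (h * k⁻¹)) := hJm.comp (measurable_mul_const _)
    rw [lintegral_const_mul _ hJk, mul_assoc]
    gcongr
    exact hc' k⁻¹ (Set.inv_mem_inv.2 hk) J hJm
  have htot : μ V * ∫⁻ ξ in O, F ξ ≤
      volume (p '' V) * (ENNReal.ofReal c₁ * c) * ∫⁻ h, J h ∂μ := by
    calc μ V * ∫⁻ ξ in O, F ξ ≤ _ := hlow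
      _ ≤ _ := hswap.le
      _ ≤ _ := lintegral_mono hup1
      _ ≤ _ := hup2.le
      _ ≤ ∫⁻ η in p '' V, ENNReal.ofReal c₁ * c * ∫⁻ h, J h ∂μ := setLIntegral_mono' hPm hup3
      _ = _ := by rw [setLIntegral_const]; ring
  rw [ENNReal.div_eq_inv_mul, mul_assoc, ← ENNReal.div_eq_inv_mul, ENNReal.le_div_iff_mul_le
    (Or.inl hV0) (Or.inl hVt), mul_comm]
  exact htot

/-! ### Convolution estimates on the dilation group -/

/-- A submultiplicative function is integrable against a convolution if it is integrable against
both factors. -/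
theorem lintegral_mul_convolution_le {G : Type*} [Group G] [TopologicalSpace G]
    [IsTopologicalGroup G] [SecondCountableTopology G] [MeasurableSpace G] [BorelSpace G]
    (μ : Measure G) [μ.IsMulLeftInvariant] [SFinite μ] {m a p : G → ℝ≥0∞} (hm : Measurable m)
    (ha : Measurable a) (hp : Measurable p) (hsub : ∀ g h, m (g * h) ≤ m g * m h) :
    ∫⁻ h, m h * (∫⁻ g, a g * p (g⁻¹ * h) ∂μ) ∂μ ≤
      (∫⁻ g, m g * a g ∂μ) * ∫⁻ h, m h * p h ∂μ := by
  have hmp : Measurable (fun h => m h * p h) := hm.mul hp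
  have hp2 : Measurable (fun x : G × G => p (x.2⁻¹ * x.1)) :=
    hp.comp ((measurable_snd.inv).mul measurable_fst)
  have hpl : ∀ g : G, Measurable (fun h => p (g⁻¹ * h)) := fun g => hp.comp (measurable_const_mul _)
  have hpr : ∀ h : G, Measurable (fun g => p (g⁻¹ * h)) := fun h =>
    hp.comp (measurable_inv.mul_const h)
  -- Left invariance replaces `h` by `g h`, after which submultiplicativity of `m` separates the
  -- variables.
  have step : ∀ g : G, ∫⁻ h, m h * p (g⁻¹ * h) ∂μ ≤ m g * ∫⁻ h, m h * p h ∂μ := by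
    intro g
    rw [← lintegral_mul_left_eq_self _ g, ← lintegral_const_mul _ hmp]
    refine lintegral_mono fun h => ?_
    rw [inv_mul_cancel_left, ← mul_assoc]
    gcongr
    exact hsub g h
  calc ∫⁻ h, m h * (∫⁻ g, a g * p (g⁻¹ * h) ∂μ) ∂μ
      = ∫⁻ h, ∫⁻ g, m h * (a g * p (g⁻¹ * h)) ∂μ ∂μ := by
        congr 1; funext h
        exact (lintegral_const_mul _ (ha.mul (hpr h))).symm
    _ = ∫⁻ g, ∫⁻ h, m h * (a g * p (g⁻¹ * h)) ∂μ ∂μ := by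
        refine lintegral_lintegral_swap (Measurable.aemeasurable ?_)
        exact (hm.comp measurable_fst).mul ((ha.comp measurable_snd).mul hp2)
    _ ≤ ∫⁻ g, m g * a g * ∫⁻ h, m h * p h ∂μ ∂μ := by
        refine lintegral_mono fun g => ?_
        calc ∫⁻ h, m h * (a g * p (g⁻¹ * h)) ∂μ
            = ∫⁻ h, a g * (m h * p (g⁻¹ * h)) ∂μ := by congr 1; funext h; ring
          _ = a g * ∫⁻ h, m h * p (g⁻¹ * h) ∂μ := lintegral_const_mul _ (hm.mul (hpl g))
          _ ≤ a g * (m g * ∫⁻ h, m h * p h ∂μ) := mul_le_mul_right (step g) _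
          _ = _ := by ring
    _ = _ := lintegral_mul_const _ (hm.mul ha)

/-- Integrability of the cross-correlation of the orbit envelope against a submultiplicative
function. -/
theorem lintegral_correlation_lt_top (hcl : IsClosed (H : Set (GL (Fin d) ℝ)))
    (μ : Measure H) [μ.IsHaarMeasure] {O : Set (E d)} (hO : IsOpenDualOrbit H O)
    {ξ₀ : E d} (hξ₀ : ξ₀ ∈ O) {b : E d → ℝ≥0∞} (hb : Measurable b) (hbO : ∀ ξ ∉ O, b ξ = 0)
    {m : H → ℝ≥0∞} (hm : Measurable m) (hsub : ∀ g h, m (g * h) ≤ m g * m h)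
    (h₁ : ∫⁻ h : H, m h * b (dualAct (h : GL (Fin d) ℝ) ξ₀) ∂μ < ⊤)
    (h₂ : ∫⁻ h : H, m h * ENNReal.ofReal (absDet (h : GL (Fin d) ℝ))⁻¹ *
      b (dualAct (h : GL (Fin d) ℝ)⁻¹ ξ₀) ∂μ < ⊤) :
    ∫⁻ h : H, m h * (∫⁻ ξ, b ξ * b (dualAct (h : GL (Fin d) ℝ) ξ)) ∂μ < ⊤ := by
  have := locallyCompactSpace_of_isClosed hcl
  obtain ⟨C, hC, hC'⟩ := exists_lintegral_orbit_le hcl μ ξ₀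
  set D : H → ℝ≥0∞ := fun g => ENNReal.ofReal (absDet (g : GL (Fin d) ℝ))⁻¹ with hD
  have hDm : Measurable D :=
    (continuous_absDet_coe.inv₀ fun k => (absDet_pos _).ne').measurable.ennreal_ofReal
  set q : H → ℝ≥0∞ := fun g => b (dualAct (g : GL (Fin d) ℝ)⁻¹ ξ₀) with hq
  have hqm : Measurable q := by
    have h1 := hb.comp (measurable_dualAct_inv_left (H := H) ξ₀)
    exact h1
  set p : H → ℝ≥0∞ := fun g => b (dualAct (g : GL (Fin d) ℝ) ξ₀) with hp
  have hpm : Measurable p := by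
    have h1 := hb.comp (continuous_dualAct_left (H := H) ξ₀).measurable
    exact h1
  -- Parametrising `ξ = g^{-T} ξ₀` turns `b(h^T ξ)` into `p(g⁻¹ h)`, so the correlation is dominated
  -- by the convolution of `D q` with `p`.
  have step1 : ∀ h : H, ∫⁻ ξ, b ξ * b (dualAct (h : GL (Fin d) ℝ) ξ) ≤
      C * ∫⁻ g : H, D g * (q g * p (g⁻¹ * h)) ∂μ := by
    intro h
    have hbm : Measurable (fun ξ => b ξ * b (dualAct (h : GL (Fin d) ℝ) ξ)) :=
      hb.mul (hb.comp (continuous_dualAct _).measurable)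
    have e : ∫⁻ ξ, b ξ * b (dualAct (h : GL (Fin d) ℝ) ξ) =
        ∫⁻ ξ in O, b ξ * b (dualAct (h : GL (Fin d) ℝ) ξ) := by
      rw [← lintegral_indicator hO.1.measurableSet]
      congr 1; funext ξ
      by_cases hξ : ξ ∈ O <;> simp [hξ, hbO]
    rw [e]
    refine (hC' _ hbm O (fun ξ hξ => hO.exists_dualAct_eq hξ₀ hξ) hO.1.measurableSet).trans
      (le_of_eq ?_)
    congr 2; funext g
    simp only [hp, hq, hD, Subgroup.coe_mul, Subgroup.coe_inv, dualAct_mul]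
  have hDq : Measurable (fun g => D g * q g) := hDm.mul hqm
  refine lt_of_le_of_lt (b := C * ∫⁻ h : H, m h * (∫⁻ g : H, D g * q g * p (g⁻¹ * h) ∂μ) ∂μ) ?_ ?_
  · rw [← lintegral_const_mul' _ _ hC]
    refine lintegral_mono fun h => ?_
    rw [mul_left_comm]
    refine mul_le_mul_right ((step1 h).trans (le_of_eq ?_)) _
    simp only [mul_assoc]
  · refine (mul_le_mul_right (lintegral_mul_convolution_le μ hm hDq hpm hsub) C).trans_lt ?_
    refine ENNReal.mul_lt_top hC.lt_top (ENNReal.mul_lt_top ?_ h₁)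
    simp only [← mul_assoc]
    exact h₂

end

/-! ### Vanishing moments imply integrability of the wavelet transform -/

/-- A linear map on a finite-dimensional space is bounded with respect to any norm. -/
theorem exists_norm_le_mul_seminorm {X Y : Type*} [AddCommGroup X] [Module ℝ X]
    [FiniteDimensional ℝ X] [NormedAddCommGroup Y] [NormedSpace ℝ Y] (N : Seminorm ℝ X)
    (hN : ∀ x, N x = 0 → x = 0) (L : X →ₗ[ℝ] Y) : ∃ C : ℝ, 0 ≤ C ∧ ∀ x, ‖L x‖ ≤ C * N x := by
  let _ : NormedAddCommGroup X := AddGroupNorm.toNormedAddCommGroup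
    { toFun := N
      map_zero' := map_zero N
      add_le' := map_add_le_add N
      neg' := map_neg_eq_map N
      eq_zero_of_map_eq_zero' := hN }
  let _ : NormedSpace ℝ X := ⟨fun a x => (map_smul_eq_mul N a x).le⟩
  exact ⟨‖LinearMap.toContinuousLinearMap L‖, norm_nonneg _,
    fun x => (LinearMap.toContinuousLinearMap L).le_opNorm x⟩

theorem exists_opSize_le {N : Seminorm ℝ (Matrix (Fin d) (Fin d) ℝ)}
    (hN : ∀ B, N B = 0 → B = 0) : ∃ C : ℝ, 1 ≤ C ∧ ∀ h : GL (Fin d) ℝ,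
      opSize h ≤ C * (1 + N (h : Matrix (Fin d) (Fin d) ℝ)) := by
  let L : Matrix (Fin d) (Fin d) ℝ →ₗ[ℝ] (E d →L[ℝ] E d) :=
    (Matrix.toEuclideanCLM (n := Fin d) (𝕜 := ℝ)).toAlgEquiv.toLinearMap ∘ₗ
      (Matrix.transposeLinearEquiv (Fin d) (Fin d) ℝ ℝ).toLinearMap
  obtain ⟨C, hC, h⟩ := exists_norm_le_mul_seminorm N hN L
  refine ⟨1 + C, by linarith, fun g => ?_⟩
  have h1 : ‖actCLM (g : Matrix (Fin d) (Fin d) ℝ)ᵀ‖ ≤ C * N (g : Matrix (Fin d) (Fin d) ℝ) := h g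
  have h2 : 0 ≤ N (g : Matrix (Fin d) (Fin d) ℝ) := apply_nonneg N _
  unfold opSize
  nlinarith

theorem continuous_opSize : Continuous (opSize (d := d)) := by
  have h1 : Continuous (fun h : GL (Fin d) ℝ => (h : Matrix (Fin d) (Fin d) ℝ)ᵀ) :=
    Units.continuous_val.matrix_transpose
  exact continuous_const.add (continuous_actCLM.comp h1).norm

variable {H : Subgroup (GL (Fin d) ℝ)} [MeasurableSpace H] [BorelSpace H]

theorem stronglyMeasurable_fourierInv_correl {F : E d → ℂ} (hF : Continuous F) :
    StronglyMeasurable (fun p : E d × H => 𝓕⁻ (correl F (p.2 : GL (Fin d) ℝ)) p.1) := by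
  have h1 : Continuous (fun q : (E d × H) × E d => dualAct (q.1.2 : GL (Fin d) ℝ) q.2) := by
    have h0 : Continuous (fun q : (E d × H) × E d => (q.1.2, q.2)) :=
      Continuous.prodMk (continuous_snd.comp continuous_fst) continuous_snd
    have := continuous_dualAct_prod.comp h0
    exact this
  have h2 : Continuous (fun q : (E d × H) × E d => correl F (q.1.2 : GL (Fin d) ℝ) q.2) := by
    have h3 := hF.comp h1
    have h4 : Continuous (fun q : (E d × H) × E d => F q.2) := hF.comp continuous_snd
    exact (Complex.continuous_conj.comp h3).mul h4
  have h5 : Continuous (fun q : (E d × H) × E d => Real.fourierChar (inner ℝ q.2 q.1.1) •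
      correl F (q.1.2 : GL (Fin d) ℝ) q.2) := by
    have h6 : Continuous (fun q : (E d × H) × E d => inner ℝ q.2 q.1.1) :=
      continuous_snd.inner (continuous_fst.comp continuous_fst)
    exact (Real.continuous_fourierChar.comp h6).smul h2
  simp_rw [Real.fourierInv_eq]
  exact h5.stronglyMeasurable.integral_prod_right

theorem integrable_affHaar {μ : Measure H} [SFinite μ] {f : E d × H → ℂ} (hf : StronglyMeasurable f)
    (hfi : ∫⁻ p, ENNReal.ofReal (absDet (p.2 : GL (Fin d) ℝ))⁻¹ * ‖f p‖ₑ
      ∂((volume : Measure (E d)).prod μ) < ⊤) : Integrable f (affHaar H μ) := by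
  refine ⟨hf.aestronglyMeasurable, ?_⟩
  have hm : Measurable (fun p : E d × H => ENNReal.ofReal (absDet (p.2 : GL (Fin d) ℝ))⁻¹) := by
    have h1 : Continuous (fun h : H => (absDet (h : GL (Fin d) ℝ))⁻¹) :=
      continuous_absDet_coe.inv₀ fun k => (absDet_pos _).ne'
    exact (h1.measurable.comp measurable_snd).ennreal_ofReal
  rw [HasFiniteIntegral, affHaar, lintegral_withDensity_eq_lintegral_mul _ hm hf.enorm]
  exact hfi

/-- The bound on the wavelet transform splits as a function of `x` times a function of `h`.
Condition one of the temperate embedding controls the factor `p` of the convolution on `H`,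
condition two the factor `D q`. -/
theorem memIntegrableVectors_of_hasVanishingMoments (hd : 0 < d) {μ : Measure H} [μ.IsHaarMeasure]
    (hH : IsAdmissible H μ) {O : Set (E d)} (hO : IsOpenDualOrbit H O)
    {N : Seminorm ℝ (Matrix (Fin d) (Fin d) ℝ)} (hN : ∀ B, N B = 0 → B = 0) {s : ℝ} (hs : 0 ≤ s)
    {w : H → ℝ} (hw : IsWeight (fun a b : H => a * b) w) {v : E d × H → ℝ}
    (hv : IsWeight (affMul H) v) (hvw : ∀ (x : E d) (h : H), v (x, h) ≤ (1 + ‖x‖) ^ s * w h)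
    {ℓ : ℕ} (hemb : TemperatelyEmbedded H μ N O s 1 w ℓ) {t : ℕ} (ht : (ℓ : ℝ) + s + d + 1 < t)
    {ψ : E d → ℂ} (hψ : Integrable ψ) (hvm : HasVanishingMoments Oᶜ t ψ)
    (hnorm : schwartzNorm t t (𝓕 ψ) < ⊤) : MemIntegrableVectors H μ v ψ := by
  have hcl := hH.isClosed
  have := locallyCompactSpace_of_isClosed hcl
  set F := 𝓕 ψ with hF
  have hFc : Continuous F := continuous_fourier hψ
  -- regularity and decay of the Fourier transform
  choose! g hg using hvm
  have hreg := contDiff_of_hasContDistribDeriv (r := t) hFc (fun k hk i => (hg k hk i).1)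
  have hFt : ContDiff ℝ t F := (hreg t le_rfl).1
  obtain ⟨B, hB0, hB⟩ := exists_norm_iteratedFDeriv_le hnorm
  have hz : ∀ k < t, ∀ ξ ∈ Oᶜ, iteratedFDeriv ℝ k F ξ = 0 := fun k hk ξ hξ =>
    iteratedFDeriv_eq_zero_of_partialDeriv fun i => by
      rw [(hreg k hk.le).2 i]; exact (hg k hk.le i).2 hk ξ hξ
  have h0O := zero_mem_compl_openOrbit hd hO
  have hcone : ∀ r : ℝ, ∀ x ∈ Oᶜ, r • x ∈ Oᶜ := by
    intro r x hx
    rcases eq_or_ne r 0 with rfl | hr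
    · rw [zero_smul]; exact h0O
    · exact smul_mem_compl_openOrbit hH hO hr hx
  have he : ∀ k ≤ t, ∀ ξ, ‖iteratedFDeriv ℝ k F ξ‖ ≤ B * envelope O ξ ^ (t - k) :=
    fun k hk ξ => norm_iteratedFDeriv_le_envelope hO.1.isClosed_compl ⟨0, h0O⟩ hcone hFt hB0 hB hz
      hk ξ
  -- exponents
  set m : ℕ := ⌊s + d⌋₊ + 1 with hm
  have hsd : 0 ≤ s + d := by positivity
  -- Floor plus one rather than a ceiling: strictness is needed for `(1 + ‖x‖)^(s - m)` to be
  -- integrable, even when `s + d` is an integer.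
  have hm1 : s + d < m := by rw [hm]; push_cast; exact Nat.lt_floor_add_one _
  have hm2 : (m : ℝ) ≤ s + d + 1 := by
    rw [hm]; push_cast; linarith [Nat.floor_le hsd]
  have hlt : ℓ + m < t := by
    have : ((ℓ + m : ℕ) : ℝ) < t := by push_cast; linarith
    exact_mod_cast this
  have hdt : d < t := by
    have : (d : ℝ) < t := by linarith [ℓ.cast_nonneg (α := ℝ)]
    exact_mod_cast this
  obtain ⟨K, hK0, hK⟩ := ofReal_fourierInv_correl_le (O := O) (m := m) (t := t) (ℓ := ℓ) (by omega)
    hdt (by omega) hFt hB0 hB hz he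
  have hFi : Integrable F := by
    refine ((integrable_one_add_norm (μ := (volume : Measure (E d))) (r := (t : ℝ))
      (by rw [finrank_euclideanSpace_fin]; exact_mod_cast hdt)).const_mul B).mono'
      hFc.aestronglyMeasurable (Filter.Eventually.of_forall fun ξ => ?_)
    have := hB 0 (Nat.zero_le _) ξ
    rwa [norm_iteratedFDeriv_zero, ← Real.rpow_natCast, ← Real.rpow_neg (by positivity)] at this
  have hψ2 := memLp_two_of_integrable_fourier hψ hFi
  refine ⟨hψ2, ?_⟩
  set b : E d → ℝ≥0∞ := fun ξ => ENNReal.ofReal (orbitBound O ℓ ξ) with hb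
  have hbm : Measurable b := (measurable_orbitBound hO.1 ℓ).ennreal_ofReal
  -- The exponent `-1/2` combines `|det h|⁻¹` from Haar measure with `|det h|^(1/2)` from the
  -- wavelet transform. `opSize` replaces `1 + N` because it is submultiplicative, while `N` is an
  -- arbitrary norm.
  set M : H → ℝ≥0∞ := fun h => ENNReal.ofReal (absDet (h : GL (Fin d) ℝ) ^ (-(1 / 2) : ℝ) *
    opSize (h : GL (Fin d) ℝ) ^ m * w h) with hM
  have hdc : Continuous (fun h : H => absDet (h : GL (Fin d) ℝ) ^ (-(1 / 2) : ℝ)) :=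
    continuous_absDet_coe.rpow_const fun h => Or.inl (absDet_pos _).ne'
  have hMm : Measurable M :=
    ((hdc.mul ((continuous_opSize.comp continuous_subtype_val).pow m)).mul
      hw.continuous).measurable.ennreal_ofReal
  have hMsub : ∀ g h, M (g * h) ≤ M g * M h := by
    intro g h
    have hw1 := hw.submul g h
    have hwg := (hw.pos g).le
    have hwh := (hw.pos h).le
    have hdg := (absDet_pos (g : GL (Fin d) ℝ)).le
    have hdh := (absDet_pos (h : GL (Fin d) ℝ)).le
    have h1g := one_le_opSize (g : GL (Fin d) ℝ)
    have h1h := one_le_opSize (h : GL (Fin d) ℝ)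
    have h1gh := one_le_opSize ((g : GL (Fin d) ℝ) * (h : GL (Fin d) ℝ))
    rw [hM]
    simp only
    rw [← ENNReal.ofReal_mul (by positivity)]
    refine ENNReal.ofReal_le_ofReal ?_
    rw [Subgroup.coe_mul, absDet_mul, Real.mul_rpow hdg hdh]
    calc absDet (g : GL (Fin d) ℝ) ^ (-(1 / 2) : ℝ) * absDet (h : GL (Fin d) ℝ) ^ (-(1 / 2) : ℝ) *
          opSize ((g : GL (Fin d) ℝ) * (h : GL (Fin d) ℝ)) ^ m * w (g * h)
        ≤ absDet (g : GL (Fin d) ℝ) ^ (-(1 / 2) : ℝ) * absDet (h : GL (Fin d) ℝ) ^ (-(1 / 2) : ℝ) *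
          (opSize (g : GL (Fin d) ℝ) * opSize (h : GL (Fin d) ℝ)) ^ m * (w g * w h) := by
          have := opSize_mul_le (g : GL (Fin d) ℝ) (h : GL (Fin d) ℝ)
          have := (hw.pos (g * h)).le
          gcongr
      _ = _ := by rw [mul_pow]; ring
  -- the integrability conditions
  obtain ⟨ξ₀, hξ₀, hI1, hI2⟩ := hemb
  obtain ⟨C, hC1, hC⟩ := exists_opSize_le hN
  have hpow : ∀ h : GL (Fin d) ℝ, opSize h ^ m ≤
      C ^ m * (1 + N (h : Matrix (Fin d) (Fin d) ℝ)) ^ (s + d + 1 : ℝ) := by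
    intro h
    have hNh : 0 ≤ N (h : Matrix (Fin d) (Fin d) ℝ) := apply_nonneg N _
    have h1 := one_le_opSize h
    calc opSize h ^ m ≤ (C * (1 + N (h : Matrix (Fin d) (Fin d) ℝ))) ^ m := by
          gcongr; exact hC h
      _ = C ^ m * (1 + N (h : Matrix (Fin d) (Fin d) ℝ)) ^ (m : ℝ) := by
          rw [mul_pow, Real.rpow_natCast]
      _ ≤ _ := by
          gcongr
          linarith
  have hob : ∀ ξ, orbitBound O ℓ ξ ≤ envelope O ξ ^ ℓ := fun ξ =>
    Set.indicator_le_self' (fun _ _ => pow_nonneg (envelope_nonneg _ _) _) ξ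
  have hfin1 : ∫⁻ h : H, M h * b (dualAct (h : GL (Fin d) ℝ) ξ₀) ∂μ < ⊤ := by
    have h1 := hI1.eLpNorm_lt_top
    rw [ENNReal.ofReal_one, eLpNorm_one_eq_lintegral_enorm] at h1
    refine lt_of_le_of_lt ?_ (ENNReal.mul_lt_top (ENNReal.ofReal_lt_top (r := C ^ m)) h1)
    rw [← lintegral_const_mul' _ _ ENNReal.ofReal_ne_top]
    refine lintegral_mono fun h => ?_
    have hdp := absDet_pos (h : GL (Fin d) ℝ)
    have hwp := (hw.pos h).le
    have hNh : 0 ≤ N ((h : GL (Fin d) ℝ) : Matrix (Fin d) (Fin d) ℝ) := apply_nonneg N _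
    have hop := one_le_opSize (h : GL (Fin d) ℝ)
    have hen := envelope_nonneg O (dualAct (h : GL (Fin d) ℝ) ξ₀)
    have hpo := hpow (h : GL (Fin d) ℝ)
    have hobh := hob (dualAct (h : GL (Fin d) ℝ) ξ₀)
    have eL : M h * b (dualAct (h : GL (Fin d) ℝ) ξ₀) =
        ENNReal.ofReal (absDet (h : GL (Fin d) ℝ) ^ (-(1 / 2) : ℝ) *
          opSize (h : GL (Fin d) ℝ) ^ m * w h * orbitBound O ℓ (dualAct (h : GL (Fin d) ℝ) ξ₀)) :=
      (ENNReal.ofReal_mul (by positivity)).symm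
    rw [eL, ← ofReal_norm, ← ENNReal.ofReal_mul (by positivity)]
    refine ENNReal.ofReal_le_ofReal ?_
    have e : (1 / 2 - 1 / 1 : ℝ) = -(1 / 2) := by norm_num
    rw [e]
    refine le_trans ?_ (mul_le_mul_of_nonneg_left (Real.le_norm_self _) (by positivity))
    change _ ≤ C ^ m * (_ * _ * _ * envelope O (dualAct (h : GL (Fin d) ℝ) ξ₀) ^ ℓ)
    calc _ ≤ absDet (h : GL (Fin d) ℝ) ^ (-(1 / 2) : ℝ) *
          (C ^ m * (1 + N ((h : GL (Fin d) ℝ) : Matrix (Fin d) (Fin d) ℝ)) ^ (s + d + 1 : ℝ)) *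
            w h * envelope O (dualAct (h : GL (Fin d) ℝ) ξ₀) ^ ℓ := by
          have := orbitBound_nonneg O ℓ (dualAct (h : GL (Fin d) ℝ) ξ₀)
          gcongr
      _ = _ := by ring
  have hfin2 : ∫⁻ h : H, M h * ENNReal.ofReal (absDet (h : GL (Fin d) ℝ))⁻¹ *
      b (dualAct (h : GL (Fin d) ℝ)⁻¹ ξ₀) ∂μ < ⊤ := by
    have h1 := hI2.eLpNorm_lt_top
    rw [eLpNorm_one_eq_lintegral_enorm] at h1
    refine lt_of_le_of_lt ?_ (ENNReal.mul_lt_top (ENNReal.ofReal_lt_top (r := C ^ m)) h1)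
    rw [← lintegral_const_mul' _ _ ENNReal.ofReal_ne_top]
    refine lintegral_mono fun h => ?_
    have hdp := absDet_pos (h : GL (Fin d) ℝ)
    have hwp := (hw.pos h).le
    have hNh : 0 ≤ N ((h : GL (Fin d) ℝ) : Matrix (Fin d) (Fin d) ℝ) := apply_nonneg N _
    have hop := one_le_opSize (h : GL (Fin d) ℝ)
    have hen := envelope_nonneg O (dualAct (h : GL (Fin d) ℝ)⁻¹ ξ₀)
    have hpo := hpow (h : GL (Fin d) ℝ)
    have hobh := hob (dualAct (h : GL (Fin d) ℝ)⁻¹ ξ₀)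
    have eL : M h * ENNReal.ofReal (absDet (h : GL (Fin d) ℝ))⁻¹ *
        b (dualAct (h : GL (Fin d) ℝ)⁻¹ ξ₀) =
        ENNReal.ofReal (absDet (h : GL (Fin d) ℝ) ^ (-(1 / 2) : ℝ) *
          opSize (h : GL (Fin d) ℝ) ^ m * w h * (absDet (h : GL (Fin d) ℝ))⁻¹ *
            orbitBound O ℓ (dualAct (h : GL (Fin d) ℝ)⁻¹ ξ₀)) := by
      rw [ENNReal.ofReal_mul (by positivity), ENNReal.ofReal_mul (by positivity)]
    rw [eL, ← ofReal_norm, ← ENNReal.ofReal_mul (by positivity)]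
    refine ENNReal.ofReal_le_ofReal ?_
    have e : absDet (h : GL (Fin d) ℝ) ^ (-1 / 2 - 1 / 1 : ℝ) =
        absDet (h : GL (Fin d) ℝ) ^ (-(1 / 2) : ℝ) * (absDet (h : GL (Fin d) ℝ))⁻¹ := by
      rw [← Real.rpow_neg_one, ← Real.rpow_add hdp]; norm_num
    rw [e]
    refine le_trans ?_ (mul_le_mul_of_nonneg_left (Real.le_norm_self _) (by positivity))
    change _ ≤ C ^ m * (_ * _ * _ * envelope O (dualAct (h : GL (Fin d) ℝ)⁻¹ ξ₀) ^ ℓ)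
    calc _ ≤ absDet (h : GL (Fin d) ℝ) ^ (-(1 / 2) : ℝ) *
          (C ^ m * (1 + N ((h : GL (Fin d) ℝ) : Matrix (Fin d) (Fin d) ℝ)) ^ (s + d + 1 : ℝ)) *
            w h * (absDet (h : GL (Fin d) ℝ))⁻¹ *
              envelope O (dualAct (h : GL (Fin d) ℝ)⁻¹ ξ₀) ^ ℓ := by
          have := orbitBound_nonneg O ℓ (dualAct (h : GL (Fin d) ℝ)⁻¹ ξ₀)
          gcongr
      _ = _ := by ring
  have hcorr := lintegral_correlation_lt_top hcl μ hO hξ₀ hbm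
    (fun ξ hξ => by rw [hb]; simp [orbitBound, hξ]) hMm hMsub hfin1 hfin2
  -- the wavelet transform
  have hWm : StronglyMeasurable (fun p : E d × H => v p • wavelet H (hψ2.toLp ψ) (hψ2.toLp ψ) p) := by
    simp_rw [wavelet_eq_fourierInv H hψ hFi hψ2]
    have h1 : Continuous (fun h : H => ((absDet (h : GL (Fin d) ℝ) ^ (1 / 2 : ℝ) : ℝ) : ℂ)) :=
      Complex.continuous_ofReal.comp
        (continuous_absDet_coe.rpow_const fun h => Or.inl (absDet_pos _).ne')
    have h2 : StronglyMeasurable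
        (fun p : E d × H => ((absDet (p.2 : GL (Fin d) ℝ) ^ (1 / 2 : ℝ) : ℝ) : ℂ)) :=
      (h1.measurable.comp measurable_snd).stronglyMeasurable
    exact hv.continuous.stronglyMeasurable.smul (h2.mul (stronglyMeasurable_fourierInv_correl hFc))
  refine integrable_affHaar hWm ?_
  set I : H → ℝ≥0∞ := fun h => ∫⁻ ξ, b ξ * b (dualAct (h : GL (Fin d) ℝ) ξ) with hI
  have hIm : Measurable I := by
    have h1 := hbm.comp (measurable_dualAct_prod (H := H))
    exact Measurable.lintegral_prod_right ((hbm.comp measurable_snd).mul h1)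
  -- Here `(1 + ‖x‖)^s` is written as `(1 + ‖x‖)^(s - m) (1 + ‖x‖)^m`, the second factor being
  -- absorbed by the decay of the inverse transform.
  have hbound : ∀ p : E d × H, ENNReal.ofReal (absDet (p.2 : GL (Fin d) ℝ))⁻¹ *
      ‖v p • wavelet H (hψ2.toLp ψ) (hψ2.toLp ψ) p‖ₑ ≤
        ENNReal.ofReal (K * (1 + ‖p.1‖) ^ (-((m : ℝ) - s))) * (M p.2 * I p.2) := by
    rintro ⟨x, h⟩
    have hdp := absDet_pos (h : GL (Fin d) ℝ)
    have hwp := (hw.pos h).le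
    have hop := one_le_opSize (h : GL (Fin d) ℝ)
    have hx : 0 < 1 + ‖x‖ := by positivity
    set y : ℝ := ‖𝓕⁻ (correl F (h : GL (Fin d) ℝ)) x‖ with hy
    have hy0 : 0 ≤ y := norm_nonneg _
    rw [wavelet_eq_fourierInv H hψ hFi hψ2, ← ofReal_norm, norm_smul, norm_mul, Complex.norm_real,
      Real.norm_eq_abs, Real.norm_eq_abs, abs_of_pos (hv.pos _),
      abs_of_pos (Real.rpow_pos_of_pos hdp _), ← ENNReal.ofReal_mul (by positivity)]
    calc ENNReal.ofReal ((absDet (h : GL (Fin d) ℝ))⁻¹ *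
          (v (x, h) * (absDet (h : GL (Fin d) ℝ) ^ (1 / 2 : ℝ) * y)))
        ≤ ENNReal.ofReal ((1 + ‖x‖) ^ (-((m : ℝ) - s)) *
            (absDet (h : GL (Fin d) ℝ) ^ (-(1 / 2) : ℝ) * w h) * ((1 + ‖x‖) ^ m * y)) := by
          refine ENNReal.ofReal_le_ofReal ?_
          have e1 : absDet (h : GL (Fin d) ℝ) ^ (-(1 / 2) : ℝ) =
              (absDet (h : GL (Fin d) ℝ))⁻¹ * absDet (h : GL (Fin d) ℝ) ^ (1 / 2 : ℝ) := by
            rw [← Real.rpow_neg_one, ← Real.rpow_add hdp]; norm_num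
          have e2 : (1 + ‖x‖) ^ (-((m : ℝ) - s)) * (1 + ‖x‖) ^ m = (1 + ‖x‖) ^ s := by
            rw [← Real.rpow_natCast, ← Real.rpow_add hx]; congr 1; ring
          calc _ ≤ (absDet (h : GL (Fin d) ℝ))⁻¹ * (((1 + ‖x‖) ^ s * w h) *
                (absDet (h : GL (Fin d) ℝ) ^ (1 / 2 : ℝ) * y)) := by
                gcongr; exact hvw x h
            _ = _ := by rw [← e2, e1]; ring
      _ = ENNReal.ofReal ((1 + ‖x‖) ^ (-((m : ℝ) - s)) *
            (absDet (h : GL (Fin d) ℝ) ^ (-(1 / 2) : ℝ) * w h)) *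
              ENNReal.ofReal ((1 + ‖x‖) ^ m * y) := ENNReal.ofReal_mul (by positivity)
      _ ≤ ENNReal.ofReal ((1 + ‖x‖) ^ (-((m : ℝ) - s)) *
            (absDet (h : GL (Fin d) ℝ) ^ (-(1 / 2) : ℝ) * w h)) *
              (ENNReal.ofReal (K * opSize (h : GL (Fin d) ℝ) ^ m) * I h) :=
          mul_le_mul_right (hK h x) _
      _ = _ := by
          have eM : ENNReal.ofReal (K * (1 + ‖x‖) ^ (-((m : ℝ) - s))) * M h =
              ENNReal.ofReal (K * (1 + ‖x‖) ^ (-((m : ℝ) - s)) *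
                (absDet (h : GL (Fin d) ℝ) ^ (-(1 / 2) : ℝ) * opSize (h : GL (Fin d) ℝ) ^ m * w h)) :=
            (ENNReal.ofReal_mul (by positivity)).symm
          change _ = ENNReal.ofReal (K * (1 + ‖x‖) ^ (-((m : ℝ) - s))) * (M h * I h)
          rw [← mul_assoc _ (M h) (I h), eM, ← mul_assoc _ _ (I h),
            ← ENNReal.ofReal_mul (by positivity)]
          congr 2; ring
  refine (lintegral_mono hbound).trans_lt ?_
  have hxi : Integrable (fun x : E d => K * (1 + ‖x‖) ^ (-((m : ℝ) - s))) :=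
    (integrable_one_add_norm (by rw [finrank_euclideanSpace_fin]; linarith)).const_mul K
  rw [lintegral_prod_mul (f := fun x : E d => ENNReal.ofReal (K * (1 + ‖x‖) ^ (-((m : ℝ) - s))))
    (g := fun h : H => M h * I h) hxi.aestronglyMeasurable.aemeasurable.ennreal_ofReal
    (hMm.mul hIm).aemeasurable]
  refine ENNReal.mul_lt_top ?_ hcorr
  exact (lintegral_ofReal_le_lintegral_enorm _).trans_lt hxi.hasFiniteIntegral

/-! ### One-parameter subgroups of closed groups of units -/

section OneParameter

open Filter Topology

variable {A : Type*} [NormedRing A] [NormedAlgebra ℝ A]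

/-- The generators of the one-parameter subgroups of `G`. -/
def generators (G : Subgroup Aˣ) : Set A :=
  {Z | ∀ t : ℝ, ∃ u ∈ G, (u : A) = NormedSpace.exp (t • Z)}

theorem smul_mem_generators {G : Subgroup Aˣ} {Z : A} (hZ : Z ∈ generators G) (c : ℝ) :
    c • Z ∈ generators G := fun t => by
  obtain ⟨u, hu, h⟩ := hZ (t * c)
  exact ⟨u, hu, by rw [h, smul_smul]⟩

variable [CompleteSpace A]

-- `G` is closed only among the units, so limits taken in `A` stay in `G` once they are known to be
-- invertible.
omit [NormedAlgebra ℝ A] in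
theorem exists_mem_val_eq_of_tendsto {G : Subgroup Aˣ} (hG : IsClosed (G : Set Aˣ))
    {ι : Type*} {l : Filter ι} [l.NeBot] {u : ι → Aˣ} (hu : ∀ᶠ n in l, u n ∈ G) {a : A}
    (ha : IsUnit a) (h : Tendsto (fun n => (u n : A)) l (𝓝 a)) : ∃ u' ∈ G, (u' : A) = a := by
  obtain ⟨a, rfl⟩ := ha
  refine ⟨a, ?_, rfl⟩
  have : Tendsto u l (𝓝 a) := Units.isOpenEmbedding_val.isInducing.tendsto_nhds_iff.2 h
  exact hG.mem_of_tendsto this hu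

theorem isUnit_exp_real (a : A) : IsUnit (NormedSpace.exp a) := by
  let _ := NormedAlgebra.restrictScalars ℚ ℝ A
  exact NormedSpace.isUnit_exp a

theorem exp_nsmul_real (n : ℕ) (a : A) : NormedSpace.exp (n • a) = NormedSpace.exp a ^ n := by
  let _ := NormedAlgebra.restrictScalars ℚ ℝ A
  exact NormedSpace.exp_nsmul n a

theorem continuous_exp_real : Continuous (NormedSpace.exp : A → A) := by
  let _ := NormedAlgebra.restrictScalars ℚ ℝ A
  exact NormedSpace.exp_continuous

theorem exp_neg_mul_exp (a : A) : NormedSpace.exp (-a) * NormedSpace.exp a = 1 := by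
  let _ := NormedAlgebra.restrictScalars ℚ ℝ A
  rw [← NormedSpace.exp_add_of_commute (Commute.refl a).neg_left, neg_add_cancel,
    NormedSpace.exp_zero]

theorem contDiff_exp_real : ContDiff ℝ ∞ (NormedSpace.exp : A → A) :=
  contDiff_iff_contDiffAt.2 fun x => (NormedSpace.exp_analytic (𝕂 := ℝ) x).contDiffAt

/-- Limits of directions in which elements of a closed group `G` approach `1` generate
one-parameter subgroups of `G`. -/
theorem mem_generators_of_tendsto {G : Subgroup Aˣ} (hG : IsClosed (G : Set Aˣ)) {u : ℕ → Aˣ}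
    (hu : ∀ n, u n ∈ G) {ε : ℕ → ℝ} (hε : ∀ n, 0 < ε n) (hε0 : Tendsto ε atTop (𝓝 0)) {Z : A}
    (hZ : Tendsto (fun n => (ε n)⁻¹ • ((u n : A) - 1)) atTop (𝓝 Z)) : Z ∈ generators G := by
  have hexp : HasStrictFDerivAt (NormedSpace.exp : A → A)
      ((ContinuousLinearEquiv.refl ℝ A : A ≃L[ℝ] A) : A →L[ℝ] A) 0 :=
    hasStrictFDerivAt_exp_zero (𝕂 := ℝ)
  set L := hexp.localInverse _ _ _ with hL
  have hu1 : Tendsto (fun n => (u n : A)) atTop (𝓝 1) := by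
    have h := (hε0.smul hZ).add_const (1 : A)
    simp only [zero_smul, zero_add] at h
    refine h.congr fun n => ?_
    rw [smul_smul, mul_inv_cancel₀ (hε n).ne', one_smul, sub_add_cancel]
  have hLd : HasFDerivAt L (ContinuousLinearMap.id ℝ A) 1 := by
    have := hexp.to_localInverse.hasFDerivAt
    rw [NormedSpace.exp_zero] at this
    exact this
  have hL1 : L 1 = 0 := by
    have := hexp.localInverse_apply_image
    rwa [NormedSpace.exp_zero] at this
  have hLr : ∀ᶠ n in atTop, NormedSpace.exp (L (u n)) = (u n : A) := by
    have := hexp.eventually_right_inverse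
    rw [NormedSpace.exp_zero] at this
    exact hu1.eventually this
  -- The local logarithm `L` satisfies `L(u) = (u - 1) + o(‖u - 1‖)`, and `u n - 1 = O(ε n)`, so
  -- `L(u n)` has the same limiting direction as `u n - 1`.
  have hy : Tendsto (fun n => (ε n)⁻¹ • L (u n)) atTop (𝓝 Z) := by
    have h1 := (hLd.isLittleO.comp_tendsto hu1)
    have h2 : (fun n => (u n : A) - 1) =O[atTop] ε := by
      have h3 := (Asymptotics.isBigO_refl ε atTop).smul (hZ.isBigO_one ℝ)
      refine (h3.congr (fun n => ?_) (fun n => ?_))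
      · rw [smul_smul, mul_inv_cancel₀ (hε n).ne', one_smul]
      · simp
    have h3 := (h1.trans_isBigO h2).tendsto_inv_smul_nhds_zero
    have h4 := h3.add hZ
    rw [zero_add] at h4
    refine h4.congr fun n => ?_
    simp only [Function.comp, hL1, ContinuousLinearMap.id_apply]
    rw [← smul_add, sub_zero, sub_add_cancel]
  have hpos : ∀ t : ℝ, 0 ≤ t → ∃ u ∈ G, (u : A) = NormedSpace.exp (t • Z) := by
    intro t ht
    -- With `k n ≈ t / ε n`, the powers `u n ^ k n = exp(k n • L(u n))` in `G` converge to `exp(t •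
    -- Z)`.
    set k : ℕ → ℕ := fun n => ⌊t * (ε n)⁻¹⌋₊
    have hinv : Tendsto (fun n => (ε n)⁻¹) atTop atTop :=
      Filter.Tendsto.inv_tendsto_nhdsGT_zero
        (tendsto_nhdsWithin_iff.2 ⟨hε0, Eventually.of_forall hε⟩)
    have hk : Tendsto (fun n => (k n : ℝ) * ε n) atTop (𝓝 t) := by
      refine ((tendsto_nat_floor_mul_div_atTop ht).comp hinv).congr fun n => ?_
      simp [k]
    have hky : Tendsto (fun n => k n • L (u n)) atTop (𝓝 (t • Z)) := by
      refine (hk.smul hy).congr fun n => ?_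
      rw [smul_smul, mul_assoc, mul_inv_cancel₀ (hε n).ne', mul_one, Nat.cast_smul_eq_nsmul]
    refine exists_mem_val_eq_of_tendsto hG (l := atTop) (u := fun n => u n ^ k n)
      (Eventually.of_forall fun n => G.pow_mem (hu n) _) (isUnit_exp_real _) ?_
    refine ((continuous_exp_real.tendsto _).comp hky).congr' ?_
    filter_upwards [hLr] with n hn
    simp only [Function.comp, exp_nsmul_real, hn, Units.val_pow_eq_pow_val]
  intro t
  rcases le_total 0 t with ht | ht
  · exact hpos t ht
  · obtain ⟨g, hg, h⟩ := hpos (-t) (neg_nonneg.2 ht)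
    refine ⟨g⁻¹, G.inv_mem hg, ?_⟩
    have := exp_neg_mul_exp ((-t) • Z)
    rw [← h, neg_smul, neg_neg] at this
    rw [← mul_one (NormedSpace.exp (t • Z)), ← g.mul_inv, ← mul_assoc, this, one_mul]

end OneParameter

/-! ### Velocities of one-parameter subgroups at a point -/

section Orbit

open Filter Topology

variable {V : Type*} [NormedAddCommGroup V] [NormedSpace ℝ V] [FiniteDimensional ℝ V]

theorem exp_smul_apply_eq_self {Z : V →L[ℝ] V} {ξ : V} (h : Z ξ = 0) (t : ℝ) :
    NormedSpace.exp (t • Z) ξ = ξ := by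
  have : CompleteSpace V := FiniteDimensional.complete ℝ V
  have h1 : ∀ s : ℝ, HasDerivAt (fun s : ℝ => NormedSpace.exp (s • Z) ξ) 0 s := fun s => by
    have := (hasDerivAt_exp_smul_const (𝕂 := ℝ) Z s).clm_apply (hasDerivAt_const s ξ)
    simpa [h] using this
  have h2 := is_const_of_deriv_eq_zero (fun s => (h1 s).differentiableAt) (fun s => (h1 s).deriv)
    t 0
  simpa [NormedSpace.exp_zero] using h2

/-- If the orbit map of `ξ` is open at `1`, then every vector is the velocity at `ξ` of a
one-parameter subgroup. -/
theorem exists_generator_apply_eq {G : Subgroup (V →L[ℝ] V)ˣ}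
    (hG : IsClosed (G : Set (V →L[ℝ] V)ˣ)) {ξ : V}
    (horb : ∀ δ > 0, ∀ᶠ η in 𝓝 ξ, ∃ u ∈ G, ‖(u : V →L[ℝ] V) - 1‖ ≤ δ ∧ (u : V →L[ℝ] V) ξ = η)
    (e : V) : ∃ Z ∈ generators G, Z ξ = e := by
  have : CompleteSpace V := FiniteDimensional.complete ℝ V
  have : ProperSpace (V →L[ℝ] V) := FiniteDimensional.proper ℝ _
  rcases eq_or_ne e 0 with rfl | he
  · refine ⟨0, fun t => ⟨1, G.one_mem, ?_⟩, rfl⟩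
    rw [smul_zero, NormedSpace.exp_zero, Units.val_one]
  set η : ℕ → V := fun n => ξ + (1 / ((n : ℝ) + 1)) • e with hη
  have hηt : Tendsto η atTop (𝓝 ξ) := by
    have := (tendsto_one_div_add_atTop_nhds_zero_nat (𝕜 := ℝ)).smul_const e
    rw [zero_smul] at this
    have h := this.const_add ξ
    rwa [add_zero] at h
  have hηξ : ∀ n, η n ≠ ξ := fun n h => by
    rw [hη, add_eq_left, smul_eq_zero] at h
    rcases h with h | h
    · have : (0 : ℝ) < 1 / ((n : ℝ) + 1) := by positivity
      exact this.ne' h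
    · exact he h
  -- Among the group elements carrying `ξ` to `η n`, one closest to `1` is selected; this minimality
  -- later excludes directions that fix `ξ`.
  have hmin : ∀ᶠ n in atTop, ∃ u ∈ G, (u : V →L[ℝ] V) ξ = η n ∧
      ∀ u' ∈ G, (u' : V →L[ℝ] V) ξ = η n → ‖(u : V →L[ℝ] V) - 1‖ ≤ ‖(u' : V →L[ℝ] V) - 1‖ := by
    filter_upwards [hηt.eventually (horb (1 / 2) (by norm_num))] with n hn
    obtain ⟨u₀, hu₀, hu₀n, hu₀ξ⟩ := hn
    -- A radius below `1` keeps limits of group elements invertible, which makes `K` closed and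
    -- hence compact.
    set K : Set (V →L[ℝ] V) := Metric.closedBall 1 (1 / 2) ∩
      {a | (∃ u ∈ G, (u : V →L[ℝ] V) = a) ∧ a ξ = η n} with hK
    have hKc : IsClosed K := by
      refine IsSeqClosed.isClosed fun a a' ha haa => ?_
      have hb : a' ∈ Metric.closedBall (1 : V →L[ℝ] V) (1 / 2) :=
        Metric.isClosed_closedBall.mem_of_tendsto haa (Eventually.of_forall fun n => (ha n).1)
      have hun : IsUnit a' := by
        have h1 : ‖1 - a'‖ < 1 := by
          rw [Metric.mem_closedBall, dist_eq_norm, norm_sub_rev] at hb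
          linarith
        have := (Units.oneSub (1 - a') h1).isUnit
        rwa [Units.val_oneSub, sub_sub_cancel] at this
      choose u hu hua using fun n => (ha n).2.1
      refine ⟨hb, exists_mem_val_eq_of_tendsto hG (Eventually.of_forall hu) hun
        (by simpa only [hua] using haa), ?_⟩
      have h1 : Tendsto (fun n => a n ξ) atTop (𝓝 (a' ξ)) :=
        ((ContinuousLinearMap.apply ℝ V ξ).continuous.tendsto a').comp haa
      exact tendsto_nhds_unique h1 (by simpa only [(ha _).2.2] using tendsto_const_nhds)
    have hKne : K.Nonempty :=
      ⟨u₀, by rwa [Metric.mem_closedBall, dist_eq_norm], ⟨u₀, hu₀, rfl⟩, hu₀ξ⟩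
    have hKk : IsCompact K := (isCompact_closedBall (1 : V →L[ℝ] V) (1 / 2)).of_isClosed_subset
      hKc Set.inter_subset_left
    obtain ⟨a, ⟨haB, ⟨u, hu, rfl⟩, huξ⟩, hmin⟩ :=
      hKk.exists_isMinOn hKne (f := fun a => ‖a - 1‖) (by fun_prop)
    refine ⟨u, hu, huξ, fun u' hu' hu'ξ => ?_⟩
    by_cases h : ‖(u' : V →L[ℝ] V) - 1‖ ≤ 1 / 2
    · exact hmin ⟨by rwa [Metric.mem_closedBall, dist_eq_norm], ⟨u', hu', rfl⟩, hu'ξ⟩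
    · rw [Metric.mem_closedBall, dist_eq_norm] at haB
      linarith
  obtain ⟨n₀, hn₀⟩ := eventually_atTop.1 hmin
  choose u hu huξ humin using fun n : ℕ => hn₀ (n + n₀) (by omega)
  have hη' : Tendsto (fun n => η (n + n₀)) atTop (𝓝 ξ) := hηt.comp (tendsto_add_atTop_nat n₀)
  set ε : ℕ → ℝ := fun n => ‖(u n : V →L[ℝ] V) - 1‖ with hεdef
  have hε : ∀ n, 0 < ε n := fun n => by
    refine norm_pos_iff.2 fun h => hηξ (n + n₀) ?_
    rw [← huξ, sub_eq_zero.1 h]; rfl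
  have hε0 : Tendsto ε atTop (𝓝 0) := by
    refine Metric.tendsto_nhds.2 fun δ hδ => ?_
    filter_upwards [hη'.eventually (horb (δ / 2) (by positivity))] with n hn
    obtain ⟨u', hu', hn', hξ'⟩ := hn
    rw [dist_zero_right, Real.norm_of_nonneg (hε n).le]
    exact (humin n u' hu' hξ').trans_lt (by linarith)
  obtain ⟨Z, -, φ, hφ, hZ⟩ := (isCompact_sphere (0 : V →L[ℝ] V) 1).tendsto_subseq
    (x := fun n => (ε n)⁻¹ • ((u n : V →L[ℝ] V) - 1)) (fun n => by
      rw [mem_sphere_zero_iff_norm, norm_smul, norm_inv, Real.norm_of_nonneg (hε n).le]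
      exact inv_mul_cancel₀ (hε n).ne')
  have hεφ : Tendsto (fun n => ε (φ n)) atTop (𝓝 0) := hε0.comp hφ.tendsto_atTop
  have hZG : Z ∈ generators G :=
    mem_generators_of_tendsto hG (fun n => hu (φ n)) (fun n => hε (φ n)) hεφ hZ
  -- Each `(u n - 1) ξ` is a multiple of `e`, and the line through `e` is closed.
  have hZξ : Z ξ ∈ Submodule.span ℝ {e} := by
    have h1 : Tendsto (fun n => ((ε (φ n))⁻¹ • ((u (φ n) : V →L[ℝ] V) - 1)) ξ) atTop (𝓝 (Z ξ)) :=
      ((ContinuousLinearMap.apply ℝ V ξ).continuous.tendsto Z).comp hZ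
    refine (Submodule.closed_of_finiteDimensional (Submodule.span ℝ {e})).mem_of_tendsto h1
      (Eventually.of_forall fun n => ?_)
    have h2 : ((ε (φ n))⁻¹ • ((u (φ n) : V →L[ℝ] V) - 1)) ξ =
        ((ε (φ n))⁻¹ * (1 / (((φ n + n₀ : ℕ) : ℝ) + 1))) • e := by
      simp only [smul_apply, sub_apply, huξ, hη,
        one_apply_eq_self, add_sub_cancel_left, smul_smul]
    rw [h2]
    exact Submodule.smul_mem _ _ (Submodule.mem_span_singleton_self e)
  obtain ⟨c, hc⟩ := Submodule.mem_span_singleton.1 hZξ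
  -- If `Z ξ = 0`, then `exp(-ε Z)` fixes `ξ`, so `u exp(-ε Z)` also carries `ξ` to `η`. It differs
  -- from `1` by `o(ε)`, whereas `u` differs by exactly `ε`, against minimality.
  rcases eq_or_ne c 0 with rfl | hc0
  · exfalso
    rw [zero_smul] at hc
    choose g hg hgexp using fun n => hZG (-ε (φ n))
    have hgξ : ∀ n, (g n : V →L[ℝ] V) ξ = ξ := fun n => by
      rw [hgexp, exp_smul_apply_eq_self hc.symm]
    have hexp : Tendsto (fun n => (ε (φ n))⁻¹ • ((g n : V →L[ℝ] V) - 1)) atTop (𝓝 (-Z)) := by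
      have h1 := hasDerivAt_iff_tendsto_slope_zero.1 (hasDerivAt_exp_smul_const (𝕂 := ℝ) Z 0)
      have h2 : Tendsto (fun n => -ε (φ n)) atTop (𝓝[≠] 0) := by
        refine tendsto_nhdsWithin_iff.2 ⟨?_, Eventually.of_forall fun n => ?_⟩
        · have := hεφ.neg
          rwa [neg_zero] at this
        · exact neg_ne_zero.2 (hε _).ne'
      have h3 := (h1.comp h2).neg
      simp only [zero_smul, NormedSpace.exp_zero, one_mul, zero_add] at h3
      refine h3.congr fun n => ?_
      rw [Function.comp, hgexp, inv_neg, neg_smul, neg_neg]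
    have hg1 : Tendsto (fun n => (g n : V →L[ℝ] V)) atTop (𝓝 1) := by
      have h1 := (hεφ.neg.smul_const Z)
      rw [neg_zero, zero_smul] at h1
      have h2 := (continuous_exp_real.tendsto (0 : V →L[ℝ] V)).comp h1
      rw [NormedSpace.exp_zero] at h2
      exact h2.congr fun n => (hgexp n).symm
    have h3 : Tendsto (fun n => (ε (φ n))⁻¹ • (((u (φ n) * g n : (V →L[ℝ] V)ˣ) : V →L[ℝ] V) - 1))
        atTop (𝓝 0) := by
      have := (hZ.mul hg1).add hexp
      rw [mul_one, add_neg_cancel] at this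
      refine this.congr fun n => ?_
      simp only [Function.comp, smul_mul_assoc, ← smul_add, Units.val_mul]
      congr 1
      noncomm_ring
    have h4 := (h3.norm.eventually (gt_mem_nhds (show ‖(0 : V →L[ℝ] V)‖ < 1 by simp))).exists
    obtain ⟨n, hn⟩ := h4
    have h5 := humin (φ n) (u (φ n) * g n) (G.mul_mem (hu _) (hg _)) (by
      rw [Units.val_mul, mul_apply_eq_comp, hgξ, huξ])
    rw [norm_smul, norm_inv, Real.norm_of_nonneg (hε _).le, inv_mul_lt_one₀ (hε _)] at hn
    exact absurd h5 (not_le.2 hn)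
  · refine ⟨c⁻¹ • Z, smul_mem_generators hZG _, ?_⟩
    rw [smul_apply, ← hc, smul_smul, inv_mul_cancel₀ hc0, one_smul]

end Orbit

/-! ### Open orbits, open orbit maps and spanning velocities -/

section OpenOrbit

open Filter Topology
open scoped Pointwise

variable {V : Type*} [NormedAddCommGroup V] [NormedSpace ℝ V] [FiniteDimensional ℝ V]

/-- The orbit map of a point with open orbit is open. -/
theorem eventually_exists_apply_eq {G : Subgroup (V →L[ℝ] V)ˣ}
    (hG : IsClosed (G : Set (V →L[ℝ] V)ˣ)) {ξ : V}
    (hopen : IsOpen {η | ∃ u ∈ G, (u : V →L[ℝ] V) ξ = η}) {δ : ℝ} (hδ : 0 < δ) :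
    ∀ᶠ η in 𝓝 ξ, ∃ u ∈ G, ‖(u : V →L[ℝ] V) - 1‖ ≤ δ ∧ (u : V →L[ℝ] V) ξ = η := by
  have : CompleteSpace V := FiniteDimensional.complete ℝ V
  have : ProperSpace V := FiniteDimensional.proper ℝ V
  have : ProperSpace (V →L[ℝ] V) := FiniteDimensional.proper ℝ _
  have : LocallyCompactSpace (V →L[ℝ] V)ˣ := Units.isOpenEmbedding_val.locallyCompactSpace
  have : SecondCountableTopology (V →L[ℝ] V)ˣ :=
    Units.isOpenEmbedding_val.isEmbedding.secondCountableTopology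
  have : LocallyCompactSpace G := hG.isClosedEmbedding_subtypeVal.locallyCompactSpace
  have : SecondCountableTopology G :=
    inferInstanceAs (SecondCountableTopology (G : Set (V →L[ℝ] V)ˣ))
  have horb : MulAction.orbit G ξ = {η | ∃ u ∈ G, (u : V →L[ℝ] V) ξ = η} := by
    ext η
    exact ⟨fun ⟨u, hu⟩ => ⟨u, u.2, hu⟩, fun ⟨u, hu, h⟩ => ⟨⟨u, hu⟩, h⟩⟩
  have hopen' : IsOpen (MulAction.orbit G ξ) := by rwa [horb]
  -- An open orbit is a Baire space on which the `σ`-compact group `G` acts transitively, so the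
  -- open mapping theorem for group actions applies.
  have : BaireSpace (MulAction.orbit G ξ) := hopen'.isOpenEmbedding_subtypeVal.baireSpace
  have : ContinuousSMul G (MulAction.orbit G ξ) := by
    refine ⟨continuous_induced_rng.2 ?_⟩
    have h1 : Continuous fun p : G × MulAction.orbit G ξ =>
        (((p.1 : (V →L[ℝ] V)ˣ) : V →L[ℝ] V) (p.2 : V)) :=
      (Units.continuous_val.comp (continuous_subtype_val.comp continuous_fst)).clm_apply
        (continuous_subtype_val.comp continuous_snd)
    exact h1
  set ξ' : MulAction.orbit G ξ := ⟨ξ, MulAction.mem_orbit_self ξ⟩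
  set U : Set G := {u | ‖((u : (V →L[ℝ] V)ˣ) : V →L[ℝ] V) - 1‖ < δ}
  have hU : U ∈ 𝓝 (1 : G) := by
    refine IsOpen.mem_nhds ?_ (by simpa [U] using hδ)
    exact isOpen_lt ((Units.continuous_val.comp continuous_subtype_val).sub
      continuous_const).norm continuous_const
  have h2 := smul_singleton_mem_nhds_of_sigmaCompact hU ξ'
  have h3 := hopen'.isOpenEmbedding_subtypeVal.image_mem_nhds.2 h2
  filter_upwards [h3] with η hη
  obtain ⟨_, ⟨u, hu, _, rfl, rfl⟩, rfl⟩ := hη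
  exact ⟨u, u.2, le_of_lt hu, rfl⟩

omit [FiniteDimensional ℝ V] in
/-- If the velocities at `ξ` of finitely many one-parameter subgroups of `G` span, then the orbit
of `ξ` is a neighbourhood of `ξ`. -/
theorem orbit_mem_nhds_of_span_eq_top [CompleteSpace V] {ι : Type*} [Fintype ι]
    {G : Subgroup (V →L[ℝ] V)ˣ} {X : ι → V →L[ℝ] V} (hX : ∀ i, X i ∈ generators G) {ξ : V}
    (hspan : Submodule.span ℝ (Set.range fun i => X i ξ) = ⊤) :
    {η | ∃ u ∈ G, (u : V →L[ℝ] V) ξ = η} ∈ 𝓝 ξ := by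
  classical
  -- Products of exponentials in a fixed order stay in `G`. At the origin, `F t = Φ l t ξ` has
  -- partial derivatives `X i ξ`, so its derivative is surjective and `F` maps neighbourhoods of `0`
  -- onto neighbourhoods of `ξ`.
  set Φ : List ι → (ι → ℝ) → V →L[ℝ] V :=
    fun l t => (l.map fun i => NormedSpace.exp (t i • X i)).prod with hΦ
  have hΦG : ∀ l t, ∃ u ∈ G, (u : V →L[ℝ] V) = Φ l t := by
    intro l t
    induction l with
    | nil => exact ⟨1, G.one_mem, rfl⟩
    | cons i l ih =>
      obtain ⟨u, hu, h⟩ := ih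
      obtain ⟨g, hg, h'⟩ := hX i (t i)
      exact ⟨g * u, G.mul_mem hg hu, by rw [Units.val_mul, h, h']; simp [hΦ]⟩
  have hΦs : ∀ l, ContDiff ℝ ∞ (Φ l) := by
    intro l
    induction l with
    | nil => exact contDiff_const
    | cons i l ih =>
      have h1 : ContDiff ℝ ∞ fun t : ι → ℝ => NormedSpace.exp (t i • X i) :=
        contDiff_exp_real.comp ((contDiff_apply ℝ ℝ i).smul contDiff_const)
      have h2 : Φ (i :: l) = fun t => NormedSpace.exp (t i • X i) * Φ l t := by
        funext t; simp [hΦ]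
      rw [h2]
      exact h1.mul ih
  set l : List ι := (Finset.univ : Finset ι).toList
  set F : (ι → ℝ) → V := fun t => Φ l t ξ with hF
  have hFs : ContDiff ℝ ∞ F := (hΦs l).clm_apply contDiff_const
  have hF0 : F 0 = ξ := by
    have : Φ l 0 = 1 := by
      refine List.prod_eq_one fun a ha => ?_
      obtain ⟨i, -, rfl⟩ := List.mem_map.1 ha
      rw [Pi.zero_apply, zero_smul, NormedSpace.exp_zero]
    rw [hF]; simp only [this]; rfl
  have hFd : HasStrictFDerivAt F (fderiv ℝ F 0) 0 :=
    hFs.contDiffAt.hasStrictFDerivAt (by simp)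
  have hline : ∀ i, fderiv ℝ F 0 (Pi.single i 1) = X i ξ := by
    intro i
    have h1 : ∀ s : ℝ, F (s • Pi.single i 1) = NormedSpace.exp (s • X i) ξ := by
      intro s
      have : Φ l (s • Pi.single i 1) = NormedSpace.exp (s • X i) := by
        have h := List.prod_map_eq_pow_single (l := l) i
          (fun j => NormedSpace.exp ((s • Pi.single i 1 : ι → ℝ) j • X j)) (fun j hj _ => by
            simp [hj, NormedSpace.exp_zero])
        rw [hΦ]; simp only
        rw [h, List.count_eq_one_of_mem (Finset.nodup_toList _) (by simp)]
        simp
      rw [hF]; simp only [this]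
    have h2 : HasDerivAt (fun s : ℝ => F (s • Pi.single i 1)) (X i ξ) 0 := by
      simp only [h1]
      have := (hasDerivAt_exp_smul_const (𝕂 := ℝ) (X i) 0).clm_apply (hasDerivAt_const 0 ξ)
      simpa [NormedSpace.exp_zero] using this
    have h3 : HasDerivAt (fun s : ℝ => F (s • Pi.single i 1))
        (fderiv ℝ F 0 (Pi.single i 1)) 0 := by
      have h4 : HasFDerivAt F (fderiv ℝ F 0) ((0 : ℝ) • (Pi.single i 1 : ι → ℝ)) := by
        rw [zero_smul]; exact hFd.hasFDerivAt
      have h5 := (hasDerivAt_id (0 : ℝ)).smul_const (Pi.single i 1 : ι → ℝ)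
      rw [one_smul] at h5
      exact h4.comp_hasDerivAt (0 : ℝ) h5
    exact h3.unique h2
  have hsurj : (fderiv ℝ F 0 : (ι → ℝ) →ₗ[ℝ] V).range = ⊤ := by
    rw [eq_top_iff, ← hspan, Submodule.span_le]
    rintro _ ⟨i, rfl⟩
    exact ⟨Pi.single i 1, hline i⟩
  have := hFd.map_nhds_eq_of_surj hsurj
  rw [hF0] at this
  rw [← this]
  refine Filter.mem_map.2 (Filter.univ_mem' fun t => ?_)
  obtain ⟨u, hu, h⟩ := hΦG l t
  exact ⟨u, hu, by rw [h]⟩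

end OpenOrbit

/-! ### A polynomial vanishing on the complement of the open orbit -/

/-- The transposes of the elements of `H`, as a group of continuous linear maps. -/
noncomputable def dualGroup (H : Subgroup (GL (Fin d) ℝ)) : Subgroup (E d →L[ℝ] E d)ˣ where
  carrier := {T | ∃ h ∈ H, (T : E d →L[ℝ] E d) = actCLM (h : Matrix (Fin d) (Fin d) ℝ)ᵀ}
  one_mem' := ⟨1, H.one_mem, by
    rw [Units.val_one, Units.val_one, Matrix.transpose_one, actCLM_one]⟩
  mul_mem' := by
    rintro S T ⟨g, hg, hS⟩ ⟨h, hh, hT⟩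
    exact ⟨h * g, H.mul_mem hh hg, by
      rw [Units.val_mul, Units.val_mul, Matrix.transpose_mul, actCLM_mul, hS, hT]⟩
  inv_mem' := by
    rintro T ⟨h, hh, hT⟩
    refine ⟨h⁻¹, H.inv_mem hh, ?_⟩
    have : (T : E d →L[ℝ] E d) *
        actCLM ((h⁻¹ : GL (Fin d) ℝ) : Matrix (Fin d) (Fin d) ℝ)ᵀ = 1 := by
      rw [hT, ← actCLM_mul, ← Matrix.transpose_mul, ← Units.val_mul, inv_mul_cancel,
        Units.val_one, Matrix.transpose_one, actCLM_one]
    exact Units.inv_eq_of_mul_eq_one_right this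

/-- Transposition is continuous from units to units, and the dual group is the preimage of `H` under
it. -/
theorem isClosed_dualGroup {H : Subgroup (GL (Fin d) ℝ)}
    (hH : IsClosed (H : Set (GL (Fin d) ℝ))) :
    IsClosed (dualGroup H : Set (E d →L[ℝ] E d)ˣ) := by
  set e := Matrix.toEuclideanCLM (n := Fin d) (𝕜 := ℝ) with he
  have hes : Continuous e.symm :=
    LinearMap.continuous_of_finiteDimensional e.symm.toAlgEquiv.toLinearMap
  set θ : (E d →L[ℝ] E d)ˣ → GL (Fin d) ℝ := fun T =>
    ⟨(e.symm T)ᵀ, (e.symm (T⁻¹ : (E d →L[ℝ] E d)ˣ))ᵀ,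
      by rw [← Matrix.transpose_mul, ← map_mul, ← Units.val_mul, inv_mul_cancel, Units.val_one,
        map_one, Matrix.transpose_one],
      by rw [← Matrix.transpose_mul, ← map_mul, ← Units.val_mul, mul_inv_cancel, Units.val_one,
        map_one, Matrix.transpose_one]⟩ with hθ
  have hθc : Continuous θ := Units.continuous_iff.2
    ⟨(hes.comp Units.continuous_val).matrix_transpose,
      (hes.comp (Units.continuous_val.comp continuous_inv)).matrix_transpose⟩
  have : (dualGroup H : Set (E d →L[ℝ] E d)ˣ) = θ ⁻¹' H := by
    ext T
    constructor
    · rintro ⟨h, hh, hT⟩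
      have : θ T = h := Units.ext (by
        change (e.symm T)ᵀ = h
        rw [hT]
        change (e.symm (e (h : Matrix (Fin d) (Fin d) ℝ)ᵀ))ᵀ = h
        rw [e.symm_apply_apply, Matrix.transpose_transpose])
      rw [Set.mem_preimage, this]
      exact hh
    · intro hT
      refine ⟨θ T, hT, ?_⟩
      change (T : E d →L[ℝ] E d) = e (e.symm T)ᵀᵀ
      rw [Matrix.transpose_transpose, e.apply_symm_apply]
  rw [this]
  exact hH.preimage hθc

theorem dualOrbit_eq_dualGroup (H : Subgroup (GL (Fin d) ℝ)) (ξ : E d) :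
    dualOrbit H ξ = {η | ∃ u ∈ dualGroup H, (u : E d →L[ℝ] E d) ξ = η} := by
  ext η
  constructor
  · rintro ⟨h, hh, rfl⟩
    have h1 : actCLM (h : Matrix (Fin d) (Fin d) ℝ)ᵀ *
        actCLM ((h⁻¹ : GL (Fin d) ℝ) : Matrix (Fin d) (Fin d) ℝ)ᵀ = 1 := by
      rw [← actCLM_mul, ← Matrix.transpose_mul, ← Units.val_mul, inv_mul_cancel,
        Units.val_one, Matrix.transpose_one, actCLM_one]
    have h2 : actCLM ((h⁻¹ : GL (Fin d) ℝ) : Matrix (Fin d) (Fin d) ℝ)ᵀ *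
        actCLM (h : Matrix (Fin d) (Fin d) ℝ)ᵀ = 1 := by
      rw [← actCLM_mul, ← Matrix.transpose_mul, ← Units.val_mul, mul_inv_cancel,
        Units.val_one, Matrix.transpose_one, actCLM_one]
    exact ⟨⟨_, _, h1, h2⟩, ⟨h, hh, rfl⟩, rfl⟩
  · rintro ⟨u, ⟨h, hh, hu⟩, rfl⟩
    exact ⟨h, hh, by rw [hu]; rfl⟩

/-- A determinant of linear vector fields vanishes on the complement of the open orbit without
vanishing identically. -/
theorem exists_det_eq_zero_on_compl_orbit {H : Subgroup (GL (Fin d) ℝ)} [MeasurableSpace H]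
    {μ : Measure H} (hH : IsAdmissible H μ) {O : Set (E d)} (hO : IsOpenDualOrbit H O) :
    ∃ X : Fin d → E d →L[ℝ] E d, ∃ ξ₀ : E d, (∀ j, X j ξ₀ = stdVec j) ∧
      ∀ ξ ∈ Oᶜ, (Matrix.of fun i j => X j ξ i).det = 0 := by
  obtain ⟨hOo, ξ₀, hξ₀⟩ := id hO
  have hcl := isClosed_dualGroup hH.isClosed
  have hopen : IsOpen {η | ∃ u ∈ dualGroup H, (u : E d →L[ℝ] E d) ξ₀ = η} := by
    rwa [← dualOrbit_eq_dualGroup, ← hξ₀]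
  choose X hX hXξ using fun j : Fin d => exists_generator_apply_eq hcl (ξ := ξ₀)
    (fun δ hδ => eventually_exists_apply_eq hcl hopen hδ) (stdVec j)
  refine ⟨X, ξ₀, hXξ, fun ξ hξ => ?_⟩
  by_contra hdet
  refine hξ ?_
  -- A nonzero determinant makes the velocities `X j ξ` a basis, with coordinates given by the
  -- inverse matrix; the orbit of `ξ` then has interior, and irreducibility puts `ξ` in `O`.
  have hspan : Submodule.span ℝ (Set.range fun j => X j ξ) = ⊤ := by
    refine eq_top_iff.2 fun y _ => ?_
    set M : Matrix (Fin d) (Fin d) ℝ := Matrix.of fun i j => X j ξ i with hM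
    have hu : IsUnit M.det := isUnit_iff_ne_zero.2 hdet
    have hy : y = ∑ j, (M⁻¹ *ᵥ y.ofLp) j • X j ξ := by
      ext i
      have h1 : (M *ᵥ (M⁻¹ *ᵥ y.ofLp)) i = y.ofLp i := by
        rw [Matrix.mulVec_mulVec, Matrix.mul_nonsing_inv _ hu, Matrix.one_mulVec]
      rw [← h1]
      simp [Matrix.mulVec, dotProduct, hM, mul_comm]
    rw [hy]
    exact Submodule.sum_mem _ fun j _ => Submodule.smul_mem _ _ (Submodule.subset_span ⟨j, rfl⟩)
  have h1 := orbit_mem_nhds_of_span_eq_top hX hspan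
  rw [← dualOrbit_eq_dualGroup] at h1
  exact mem_of_open_subset_orbit hH hO isOpen_interior ⟨ξ, mem_interior_iff_mem_nhds.2 h1⟩
    interior_subset

/-! ### Test functions with vanishing moments -/

section TestFunctions

open scoped SchwartzMap LineDeriv

/-- The Fourier transforms of the smooth functions of compact support. -/
noncomputable def testFourier (d : ℕ) : Submodule ℂ (E d → ℂ) where
  carrier := {f | ∃ ρ : 𝓢(E d, ℂ), HasCompactSupport ρ ∧ f = ⇑(𝓕 ρ : 𝓢(E d, ℂ))}
  zero_mem' := ⟨0, HasCompactSupport.zero, by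
    rw [show 𝓕 (0 : 𝓢(E d, ℂ)) = 0 from map_zero (FourierTransform.fourierCLM ℂ 𝓢(E d, ℂ))]; rfl⟩
  add_mem' := by
    rintro _ _ ⟨ρ, hρ, rfl⟩ ⟨σ, hσ, rfl⟩
    exact ⟨ρ + σ, hρ.add hσ, by rw [FourierTransform.fourier_add]; rfl⟩
  smul_mem' := by
    rintro c _ ⟨ρ, hρ, rfl⟩
    exact ⟨c • ρ, hρ.smul_left (f := fun _ => c), by rw [FourierTransform.fourier_smul]; rfl⟩

/-- The functions which map Fourier transforms of test functions to such by multiplication. -/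
noncomputable def testMultiplier (d : ℕ) : Subalgebra ℂ (E d → ℂ) where
  carrier := {p | ∀ f ∈ testFourier d, p * f ∈ testFourier d}
  mul_mem' := fun {p q} hp hq f hf => by rw [mul_assoc]; exact hp _ (hq _ hf)
  add_mem' := fun {p q} hp hq f hf => by
    rw [add_mul]; exact (testFourier d).add_mem (hp _ hf) (hq _ hf)
  algebraMap_mem' := fun c f hf => by
    rw [← Algebra.smul_def]; exact (testFourier d).smul_mem c hf

/-- Up to the factor `2πi`, this multiplication is the Fourier image of the directional derivative
along `m`, which preserves compact support. -/
theorem inner_mem_testMultiplier (m : E d) :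
    (fun ξ : E d => ((inner ℝ ξ m : ℝ) : ℂ)) ∈ testMultiplier d := by
  rintro _ ⟨ρ, hρ, rfl⟩
  have h1 : (⇑(𝓕 (∂_{m} ρ : 𝓢(E d, ℂ)) : 𝓢(E d, ℂ)) : E d → ℂ) ∈ testFourier d := by
    refine ⟨∂_{m} ρ, ?_, rfl⟩
    exact hρ.fderiv_apply ℝ m
  have hg : (fun ξ : E d => (inner ℝ ξ m : ℝ)).HasTemperateGrowth :=
    ((innerSL ℝ).flip m).hasTemperateGrowth
  have h2 := (testFourier d).smul_mem (2 * Real.pi * Complex.I)⁻¹ h1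
  convert h2 using 1
  funext ξ
  have h3 : (𝓕 (∂_{m} ρ : 𝓢(E d, ℂ)) : 𝓢(E d, ℂ)) ξ =
      (2 * Real.pi * Complex.I) * ((inner ℝ ξ m : ℝ) * (𝓕 ρ : 𝓢(E d, ℂ)) ξ) := by
    rw [SchwartzMap.fourier_lineDerivOp_eq, smul_apply,
      SchwartzMap.smulLeftCLM_apply_apply hg, Complex.real_smul, smul_eq_mul]
  have h0 : (2 * Real.pi * Complex.I) ≠ 0 := Complex.two_pi_I_ne_zero
  rw [Pi.smul_apply, h3, smul_eq_mul, inv_mul_cancel_left₀ h0, Pi.mul_apply]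

theorem linear_mem_testMultiplier (L : E d →L[ℝ] ℝ) :
    (fun ξ : E d => ((L ξ : ℝ) : ℂ)) ∈ testMultiplier d := by
  have := inner_mem_testMultiplier ((InnerProductSpace.toDual ℝ (E d)).symm L)
  convert this using 3 with ξ
  rw [real_inner_comm, InnerProductSpace.toDual_symm_apply]

/-- The determinant is a polynomial in linear functionals, and the multipliers form an algebra. -/
theorem det_mem_testMultiplier (X : Fin d → E d →L[ℝ] E d) :
    (fun ξ : E d => (((Matrix.of fun i j => X j ξ i).det : ℝ) : ℂ)) ∈ testMultiplier d := by
  have h : (fun ξ : E d => (((Matrix.of fun i j => X j ξ i).det : ℝ) : ℂ)) =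
      ∑ σ : Equiv.Perm (Fin d), (((Equiv.Perm.sign σ : ℤ) : ℂ)) •
        ∏ j, fun ξ : E d => ((X j ξ (σ j) : ℝ) : ℂ) := by
    funext ξ
    simp [Matrix.det_apply, Finset.sum_apply, Finset.prod_apply, Units.smul_def]
  rw [h]
  refine Subalgebra.sum_mem _ fun σ _ => Subalgebra.smul_mem _ (Subalgebra.prod_mem _ fun j _ => ?_) _
  exact linear_mem_testMultiplier ((EuclideanSpace.proj (σ j)).comp (X j))

/-- The derivatives of order `k` of `p ^ (m + k) * g` are divisible by `p ^ m`. -/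
theorem exists_partialDeriv_pow_mul_eq {p : E d → ℂ} (hp : ContDiff ℝ ∞ p) {k : ℕ} (m : ℕ)
    (i : Fin k → Fin d) {g : E d → ℂ} (hg : ContDiff ℝ ∞ g) :
    ∃ q : E d → ℂ, ContDiff ℝ ∞ q ∧
      partialDeriv i (fun ξ => p ξ ^ (m + k) * g ξ) = fun ξ => p ξ ^ m * q ξ := by
  induction k generalizing m with
  | zero => exact ⟨g, hg, by funext ξ; simp [partialDeriv]⟩
  | succ k ih =>
    obtain ⟨j, i', rfl⟩ : ∃ (j : Fin d) (i' : Fin k → Fin d), i = Fin.cons j i' :=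
      ⟨i 0, Fin.tail i, (Fin.cons_self_tail i).symm⟩
    -- The induction hypothesis is taken with `m + 1`, as the outermost derivative uses up one power
    -- of `p`.
    obtain ⟨q, hq, h⟩ := ih (m + 1) i'
    rw [add_assoc, add_comm 1 k] at h
    have hs : ContDiff ℝ ∞ (fun ξ => p ξ ^ (m + (k + 1)) * g ξ) := (hp.pow _).mul hg
    refine ⟨fun ξ => ((m : ℂ) + 1) * fderiv ℝ p ξ (stdVec j) * q ξ + p ξ * fderiv ℝ q ξ (stdVec j),
      ((contDiff_const.mul (contDiff_fderiv_apply hp _)).mul hq).add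
        (hp.mul (contDiff_fderiv_apply hq _)), ?_⟩
    funext ξ
    rw [partialDeriv_cons j i' (hs.differentiable_iteratedFDeriv
      (by exact_mod_cast WithTop.coe_lt_coe.2 (WithTop.coe_lt_top k))), h]
    have hpd : HasFDerivAt p (fderiv ℝ p ξ) ξ := (hp.differentiable (by simp) ξ).hasFDerivAt
    have hqd : HasFDerivAt q (fderiv ℝ q ξ) ξ := (hq.differentiable (by simp) ξ).hasFDerivAt
    have hd := ((hpd.pow (m + 1)).mul hqd).fderiv
    rw [show (fun ξ => p ξ ^ (m + 1) * q ξ) = (fun ξ => p ξ ^ (m + 1)) * q from rfl, hd]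
    simp
    ring

/-- A derivative of order `k < t` of `p^t g` retains the factor `p^(t-k)`, which vanishes on `C`. -/
theorem hasVanishingMoments_of_fourier_eq {C : Set (E d)} {t : ℕ} {ψ p g : E d → ℂ}
    (hp : ContDiff ℝ ∞ p) (hg : ContDiff ℝ ∞ g) (hpC : ∀ ξ ∈ C, p ξ = 0)
    (h : 𝓕 ψ = fun ξ => p ξ ^ t * g ξ) : HasVanishingMoments C t ψ := by
  intro k hk i
  have hs : ContDiff ℝ ∞ (𝓕 ψ) := by rw [h]; exact (hp.pow _).mul hg
  refine ⟨partialDeriv i (𝓕 ψ), hasContDistribDeriv_partialDeriv i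
    (hs.of_le (by exact_mod_cast le_top)), fun hkt ξ hξ => ?_⟩
  obtain ⟨q, -, hq⟩ := exists_partialDeriv_pow_mul_eq hp (t - k) i hg
  rw [Nat.sub_add_cancel hk, ← h] at hq
  rw [hq]
  simp only
  rw [hpC ξ hξ, zero_pow (by omega), zero_mul]

theorem schwartzNorm_lt_top (r m : ℕ) (f : 𝓢(E d, ℂ)) : schwartzNorm r m f < ⊤ := by
  refine lt_of_le_of_lt ?_ (ENNReal.ofReal_lt_top
    (r := 2 ^ m * (Finset.Iic (m, r)).sup (fun m => SchwartzMap.seminorm ℝ m.1 m.2) f))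
  refine iSup_le fun x => iSup_le fun k => iSup_le fun hk => iSup_le fun i =>
    ENNReal.ofReal_le_ofReal ?_
  refine le_trans ?_ (SchwartzMap.one_add_le_sup_seminorm_apply (𝕜 := ℝ) (m := (m, r))
    (le_refl m) hk f x)
  refine mul_le_mul_of_nonneg_left ?_ (by positivity)
  have := (iteratedFDeriv ℝ k f x).le_opNorm fun j => stdVec (i j)
  simpa [partialDeriv] using this

end TestFunctions

/-- There are nonzero test functions with vanishing moments in the complement of the open dual
orbit of any order. -/
theorem exists_test_hasVanishingMoments {H : Subgroup (GL (Fin d) ℝ)} [MeasurableSpace H]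
    {μ : Measure H} (hH : IsAdmissible H μ) {O : Set (E d)} (hO : IsOpenDualOrbit H O) (t : ℕ) :
    ∃ ψ : SchwartzMap (E d) ℂ, ψ ≠ 0 ∧ HasCompactSupport ψ ∧ HasVanishingMoments Oᶜ t ψ := by
  obtain ⟨X, ξ₀, hX, hXO⟩ := exists_det_eq_zero_on_compl_orbit hH hO
  set P : E d → ℝ := fun ξ => (Matrix.of fun i j => X j ξ i).det with hP
  have hP0 : P ξ₀ = 1 := by
    have : (Matrix.of fun i j => X j ξ₀ i) = (1 : Matrix (Fin d) (Fin d) ℝ) := by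
      ext i j
      simp [hX, Matrix.one_apply]
    rw [hP]; simp only [this, Matrix.det_one]
  have hPr : ∀ (r : ℝ) (ξ : E d), P (r • ξ) = r ^ d * P ξ := fun r ξ => by
    have : (Matrix.of fun i j => X j (r • ξ) i) = r • (Matrix.of fun i j => X j ξ i) := by
      ext i j
      simp
    rw [hP]; simp only [this, Matrix.det_smul, Fintype.card_fin]
  have hPs : ContDiff ℝ ∞ fun ξ => (P ξ : ℂ) := by
    have h1 : P = fun ξ => ∑ σ : Equiv.Perm (Fin d), ((Equiv.Perm.sign σ : ℤ) : ℝ) *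
        ∏ j, X j ξ (σ j) := by
      funext ξ
      simp [hP, Matrix.det_apply']
    have h2 : ContDiff ℝ ∞ P := by
      rw [h1]
      refine ContDiff.sum fun σ _ => contDiff_const.mul (contDiff_prod fun j _ => ?_)
      exact ((EuclideanSpace.proj (σ j)).comp (X j) : E d →L[ℝ] ℝ).contDiff
    exact Complex.ofRealCLM.contDiff.comp h2
  set b : ContDiffBump (0 : E d) := ⟨1, 2, one_pos, one_lt_two⟩
  have hbc : HasCompactSupport fun x => (b x : ℂ) := b.hasCompactSupport.comp_left Complex.ofReal_zero
  set ρ : SchwartzMap (E d) ℂ :=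
    hbc.toSchwartzMap (Complex.ofRealCLM.contDiff.comp b.contDiff) with hρ
  -- The transform at `0` is the integral of a nonnegative bump function, hence positive.
  have hρ0 : (𝓕 ρ : SchwartzMap (E d) ℂ) 0 ≠ 0 := by
    have h1 : (𝓕 ρ : SchwartzMap (E d) ℂ) 0 = ((∫ x, b x : ℝ) : ℂ) := by
      rw [SchwartzMap.fourier_coe, Real.fourier_eq, ← integral_complex_ofReal]
      simp only [inner_zero_right, neg_zero, AddChar.map_zero_eq_one, one_smul]
      rfl
    rw [h1]
    exact Complex.ofReal_ne_zero.2 b.integral_pos.ne'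
  obtain ⟨ψ, hψc, hψ⟩ := (testMultiplier d).pow_mem (det_mem_testMultiplier X) t (⇑(𝓕 ρ : SchwartzMap (E d) ℂ))
    ⟨ρ, hbc, rfl⟩
  have hψ' : 𝓕 (ψ : E d → ℂ) = fun ξ => (P ξ : ℂ) ^ t * (𝓕 ρ : SchwartzMap (E d) ℂ) ξ := by
    rw [← SchwartzMap.fourier_coe, ← hψ]; rfl
  refine ⟨ψ, ?_, hψc, hasVanishingMoments_of_fourier_eq hPs ((𝓕 ρ : SchwartzMap (E d) ℂ).smooth ⊤)
    (fun ξ hξ => by rw [hP]; simp only [hXO ξ hξ, Complex.ofReal_zero]) hψ'⟩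
  rintro rfl
  -- Nonvanishing is tested on the line through `ξ₀`: homogeneity gives `P(r ξ₀) = r^d`, nonzero for
  -- `r ≠ 0`, while the transform of `ρ` at `r ξ₀` is nonzero for small `r`.
  have hlim : Filter.Tendsto (fun r : ℝ => (𝓕 ρ : SchwartzMap (E d) ℂ) (r • ξ₀)) (nhdsWithin 0 {0}ᶜ)
      (nhds ((𝓕 ρ : SchwartzMap (E d) ℂ) 0)) := by
    have h1 : Continuous fun r : ℝ => (𝓕 ρ : SchwartzMap (E d) ℂ) (r • ξ₀) := by fun_prop
    have h2 := h1.tendsto 0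
    rw [zero_smul] at h2
    exact h2.mono_left nhdsWithin_le_nhds
  obtain ⟨r, hr, hr0⟩ := ((hlim.eventually_ne hρ0).and self_mem_nhdsWithin).exists
  have h3 := congrFun hψ' (r • ξ₀)
  have h4 : 𝓕 ((0 : SchwartzMap (E d) ℂ) : E d → ℂ) (r • ξ₀) = 0 := by
    rw [Real.fourier_eq]; simp
  rw [h4, hPr, hP0, mul_one] at h3
  exact mul_ne_zero (pow_ne_zero _ (Complex.ofReal_ne_zero.2 (pow_ne_zero _ hr0))) hr h3.symm

end DualOrbit

/-! ### The main theorem -/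

theorem corollary4p3 {d : ℕ} (hd : 0 < d)
    (H : Subgroup (Matrix.GeneralLinearGroup (Fin d) ℝ)) [MeasurableSpace H] [BorelSpace H]
    (μ : MeasureTheory.Measure H) [μ.IsHaarMeasure]
    (hH : DualOrbit.IsAdmissible H μ)
    (O : Set (DualOrbit.E d)) (hO : DualOrbit.IsOpenDualOrbit H O)
    (N : Seminorm ℝ (Matrix (Fin d) (Fin d) ℝ)) (hN : ∀ B, N B = 0 → B = 0)
    (s : ℝ) (hs : 0 ≤ s)
    (w : H → ℝ) (hw : DualOrbit.IsWeight (fun a b : H => a * b) w)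
    (v : DualOrbit.E d × H → ℝ) (hv : DualOrbit.IsWeight (DualOrbit.affMul H) v)
    (hvw : ∀ (x : DualOrbit.E d) (h : H), v (x, h) ≤ (1 + ‖x‖) ^ s * w h)
    (ℓ : ℕ) (hemb : DualOrbit.TemperatelyEmbedded H μ N O s 1 w ℓ) :
    (∀ t : ℕ, (ℓ : ℝ) + s + d + 1 < t → ∀ ψ : DualOrbit.E d → ℂ,
      MeasureTheory.Integrable ψ → DualOrbit.HasVanishingMoments Oᶜ t ψ →
      DualOrbit.schwartzNorm t t (𝓕 ψ) < ⊤ →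
      DualOrbit.MemIntegrableVectors H μ v ψ) ∧
    (∀ t : ℕ, (ℓ : ℝ) + s + d + 1 < t → ∃ ψ : DualOrbit.E d → ℂ,
      ψ ≠ 0 ∧ ContDiff ℝ ((⊤ : ℕ∞) : WithTop ℕ∞) ψ ∧ HasCompactSupport ψ ∧
      DualOrbit.HasVanishingMoments Oᶜ t ψ ∧ DualOrbit.schwartzNorm t t (𝓕 ψ) < ⊤ ∧
      DualOrbit.MemIntegrableVectors H μ v ψ) := by
  refine ⟨fun t ht ψ h1 h2 h3 =>
    DualOrbit.memIntegrableVectors_of_hasVanishingMoments hd hH hO hN hs hw hv hvw hemb ht h1 h2 h3,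
    fun t ht => ?_⟩
  obtain ⟨ψ, hψ, hψc, hψv⟩ := DualOrbit.exists_test_hasVanishingMoments hH hO t
  have hS : DualOrbit.schwartzNorm t t (𝓕 (ψ : DualOrbit.E d → ℂ)) < ⊤ :=
    DualOrbit.schwartzNorm_lt_top t t (𝓕 ψ : SchwartzMap (DualOrbit.E d) ℂ)
  exact ⟨ψ, fun h => hψ (DFunLike.coe_injective h), ψ.smooth ⊤, hψc, hψv, hS,
    DualOrbit.memIntegrableVectors_of_hasVanishingMoments hd hH hO hN hs hw hv hvw hemb ht
      ψ.integrable hψv hS⟩
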